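/- **Setting.** Let $E$ be a locally compact separable metric space and $m$ a $\sigma$-finite Borel measure on $E$ with full support. Let $\xi=\{\xi_t,\Pi_x\}$ be a Hunt process on $E$ with cemetery point $\partial$ (functions on $E$ are extended by $0$ to $\partial$), and suppose there are continuous, strictly positive functions $p(t,\cdot,\cdot)$ on $E\times E$, $t>0$, with $\Pi_x[f(\xi_t)]=\int_E p(t,x,y)f(y)\,m(dy)$ for all $t>0$, $x\in E$ and Borel $f\ge 0$. Put $a_t(x)=\int_E p(t,x,y)^2m(dy)$ and $\widehat a_t(x)=\int_E p(t,y,x)^2m(dy)$, and assume: $\int_E p(t,y,x)\,m(dy)\le 1$ for all $t>0$, $x\in E$; for every $t>0$, $a_t$ and $\widehat a_t$ are (finite) continuous functions in $L^1(E,m)$; and $a_{t_0},\widehat a_{t_0}\in L^2(E,m)$ for some $t_0>0$. Let $\beta\ge 0$ be a bounded measurable function on $E$ and, for $x\in E$, let $\{p_n(x)\}_{n\ge0}$ be a probability distribution, measurable in $x$, with $\sup_x\sum_n n^2p_n(x)<\infty$; put $\alpha(x)=\beta(x)\left(\sum_{n}np_n(x)-1\right)$. For $t>0$ let $T_tf(x)=\Pi_x\big[e^{\int_0^t\alpha(\xi_s)ds}f(\xi_t)\big]$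 for bounded Borel $f$, and let $q(t,x,y)$ be the mean kernel, i.e. the function, continuous in $(x,y)\in E\times E$ for each $t>0$, with $T_tf(x)=\int_E q(t,x,y)f(y)\,m(dy)$ for all bounded Borel $f$. Put $b_t(x)=\int_E q(t,x,y)^2m(dy)$ and $\widehat b_t(y)=\int_E q(t,x,y)^2m(dx)$. Let $T_t$ also denote the operator with kernel $q(t,\cdot,\cdot)$ on $L^2=L^2(E,m;\mathbb C)$, let $\widehat T_t$ be its adjoint, let $\langle f,g\rangle_m=\int_E f\overline g\,dm$, and let $\mathcal A$ be the infinitesimal generator of $\{T_t\}$ in $L^2$. List the distinct eigenvalues of $\mathcal A$ as $\{-\lambda_k:k\in\mathbb I\}$, where $\mathbb I=\{1,\dots,N\}$ or $\mathbb I=\{1,2,\dots\}$, so that $\Re\lambda_1\le\Re\lambda_2\le\cdots$. Put $\Re_k=\Re\lambda_k$ for $k\in\mathbb I$ and $\Re_k=\infty$ for $k\notin\mathbb I$. Fix $t^*>0$ such that the numbers $e^{-\lambda_kt^*}$, $k\in\mathbb I$, are distinct. For $k\in\mathbb I$ let $\nu_k$ be the least $n$ with $\mathcal N((e^{-\lambda_kt^*}I-T_{t^*})^n)=\mathcal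 N((e^{-\lambda_kt^*}I-T_{t^*})^{n+1})$, where $\mathcal N(\cdot)$ denotes the null space in $L^2$, and let $\mathcal N_k=\mathcal N((e^{-\lambda_kt^*}I-T_{t^*})^{\nu_k})$ and $\widehat{\mathcal N}_k=\mathcal N((e^{-\overline{\lambda_k}t^*}I-\widehat T_{t^*})^{\nu_k})$. Let $\phi^{(k)}_1,\dots,\phi^{(k)}_{n_k}$ be a basis of $\mathcal N_k$ of continuous functions with $\mathcal A(\phi^{(k)}_1,\dots,\phi^{(k)}_{n_k})=(\phi^{(k)}_1,\dots,\phi^{(k)}_{n_k})D_k$, where $D_k$ is block diagonal with Jordan blocks that have $-\lambda_k$ on the diagonal and $1$ on the superdiagonal. Let $D_k(t)$ be the block diagonal matrix with blocks of the same sizes, each upper triangular with $t^r/r!$ on its $r$-th superdiagonal, $r\ge0$. Let $\widehat\psi^{(k)}_1,\dots,\widehat\psi^{(k)}_{n_k}$ be a basis of $\widehat{\mathcal N}_k$ of continuous functions, let $\widetilde A_k=(\langle\phi^{(k)}_j,\widehat\psi^{(k)}_l\rangle_m)_{j,l}$, and put $\Phi_k=(\phi^{(k)}_1,\dots,\phi^{(k)}_{n_k})^T$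 and $\Psi_k^T=(\widehat\psi^{(k)}_1,\dots,\widehat\psi^{(k)}_{n_k})\,\overline{\widetilde A_k^{-1}}$. **Lemma.** For each $k\in\mathbb I$, each $t_1>0$ and each real $a<\Re_{k+1}$, there exists a constant $c=c(k,a,t_1)>0$ such that for all $(t,x,y)\in(2t_1,\infty)\times E\times E$, $$\Big|q(t,x,y)-\sum_{j=1}^k e^{-\lambda_jt}\,\Phi_j(x)^TD_j(t)\overline{\Psi_j(y)}\Big|\le c\,e^{-at}\,b_{t_1}(x)^{1/2}\,\widehat b_{t_1}(y)^{1/2}.$$ -/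

import Mathlib

open MeasureTheory ProbabilityTheory Filter Topology
open scoped NNReal ENNReal

namespace BranchingCLT

/-! ### Functions on `E ∪ {∂}` and Hunt processes

The cemetery point `∂` is the point `∞` of the one-point compactification `OnePoint E`
(it is isolated when `E` is compact). -/

/-- The state space `E ∪ {∂}` carries its Borel σ-algebra. -/
instance instMeasurableSpaceOnePoint (E : Type*) [TopologicalSpace E] :
    MeasurableSpace (OnePoint E) := borel (OnePoint E)

instance instBorelSpaceOnePoint (E : Type*) [TopologicalSpace E] :
    BorelSpace (OnePoint E) := ⟨rfl⟩

/-- Extension of a function on `E` to `E ∪ {∂}` by `f(∂) = 0`. -/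
def extend {E V : Type*} [Zero V] (f : E → V) (z : OnePoint E) : V := z.elim 0 f

/-- A Hunt process on `E`, with sample space `Ω`: a normal strong Markov process on `E ∪ {∂}`
with cemetery `∂`, shift operators, right-continuous paths with left limits in `E ∪ {∂}`, and
quasi-left-continuity, all relative to a right-continuous filtration to which it is adapted. -/
structure HuntProcess (E : Type*) [TopologicalSpace E] (Ω : Type*) [MeasurableSpace Ω] where
  /-- the laws `Π_x`, `x ∈ E ∪ {∂}`, measurable in `x` -/
  P : Kernel (OnePoint E) Ω
  isMarkovKernel : IsMarkovKernel P
  /-- the paths `ξ_t` -/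
  X : ℝ≥0 → Ω → OnePoint E
  /-- the shift operators -/
  shift : ℝ≥0 → Ω → Ω
  /-- the filtration -/
  ℱ : Filtration ℝ≥0 (inferInstance : MeasurableSpace Ω)
  rightCont_filtration : ∀ t, ⨅ s > t, ℱ s = ℱ t
  adapted : ∀ t, Measurable[ℱ t] (X t)
  X_shift : ∀ s t ω, X s (shift t ω) = X (s + t) ω
  normal : ∀ x, ∀ᵐ ω ∂(P x), X 0 ω = x
  cemetery : ∀ s t ω, s ≤ t → X s ω = OnePoint.infty → X t ω = OnePoint.infty
  rightCont_paths : ∀ ω t, ContinuousWithinAt (fun s => X s ω) (Set.Ici t) t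
  leftLimits : ∀ ω (t : ℝ≥0), 0 < t → ∃ l, Tendsto (fun s => X s ω) (𝓝[<] t) (𝓝 l)
  /-- `Π_x (ξ_{σ+s} ∈ B | ℱ_σ) = Π_{ξ_σ} (ξ_s ∈ B)` on `{σ < ∞}`, for every stopping time `σ` -/
  strongMarkov : ∀ (σ : Ω → WithTop ℝ≥0) (hσ : IsStoppingTime ℱ σ) (x : OnePoint E) (s : ℝ≥0)
    (B : Set (OnePoint E)) (A : Set Ω), MeasurableSet B → MeasurableSet[hσ.measurableSpace] A →
    P x {ω | ω ∈ A ∧ σ ω ≠ ⊤ ∧ X ((σ ω).untopD 0 + s) ω ∈ B} =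
      ∫⁻ ω in {ω | ω ∈ A ∧ σ ω ≠ ⊤}, P (X ((σ ω).untopD 0) ω) {ω' | X s ω' ∈ B} ∂(P x)
  /-- if stopping times `σ_n` increase to `σ`, then `ξ_{σ_n} → ξ_σ` a.s. on `{σ < ∞}` -/
  quasiLeftCont : ∀ (σ : ℕ → Ω → WithTop ℝ≥0) (τ : Ω → WithTop ℝ≥0),
    (∀ n, IsStoppingTime ℱ (σ n)) → (∀ ω, Monotone fun n => σ n ω) →
    (∀ ω, IsLUB (Set.range fun n => σ n ω) (τ ω)) → ∀ x, ∀ᵐ ω ∂(P x), τ ω ≠ ⊤ →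
      Tendsto (fun n => X ((σ n ω).untopD 0) ω) atTop (𝓝 (X ((τ ω).untopD 0) ω))

/-! ### The spatial motion -/

section Spatial

variable {E : Type*} [TopologicalSpace E] [MeasurableSpace E]

/-- `a_t(x) = ∫ p(t,x,y)² m(dy)` -/
noncomputable def sqInt (m : Measure E) (p : ℝ → E → E → ℝ) (t : ℝ) (x : E) : ℝ :=
  ∫ y, p t x y ^ 2 ∂m

/-- `â_t(x) = ∫ p(t,y,x)² m(dy)` -/
noncomputable def sqIntDual (m : Measure E) (p : ℝ → E → E → ℝ) (t : ℝ) (x : E) : ℝ :=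
  ∫ y, p t y x ^ 2 ∂m

/-- `p` is a family of continuous, strictly positive transition densities of `ξ` relative
to `m`: `P_t f(x) = Π_x [f(ξ_t)] = ∫ p(t,x,y) f(y) m(dy)` for all `t > 0` and Borel `f ≥ 0`. -/
structure IsTransitionDensity {Ω : Type*} [MeasurableSpace Ω] (m : Measure E)
    (ξ : HuntProcess E Ω) (p : ℝ → E → E → ℝ) : Prop where
  continuous : ∀ t, 0 < t → Continuous (Function.uncurry (p t))
  pos : ∀ t, 0 < t → ∀ x y, 0 < p t x y
  density : ∀ t, 0 < t → ∀ f : E → ℝ≥0∞, Measurable f → ∀ x : E,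
    ∫⁻ ω, extend f (ξ.X t.toNNReal ω) ∂(ξ.P x) = ∫⁻ y, ENNReal.ofReal (p t x y) * f y ∂m

/-- The standing assumptions on the transition densities: `∫ p(t,y,x) m(dy) ≤ 1`; `a_t` and `â_t`
are (finite) continuous functions in `L¹(m)` for every `t > 0`; and `a_{t₀}, â_{t₀} ∈ L²(m)` for
some `t₀ > 0`. -/
structure DensityAssumption (m : Measure E) (p : ℝ → E → E → ℝ) : Prop where
  dual_subMarkov : ∀ t, 0 < t → ∀ x, ∫⁻ y, ENNReal.ofReal (p t y x) ∂m ≤ 1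
  sq_integrable : ∀ t, 0 < t → ∀ x, Integrable (fun y => p t x y ^ 2) m
  sq_integrable_dual : ∀ t, 0 < t → ∀ x, Integrable (fun y => p t y x ^ 2) m
  continuous_sqInt : ∀ t, 0 < t → Continuous (sqInt m p t)
  continuous_sqIntDual : ∀ t, 0 < t → Continuous (sqIntDual m p t)
  integrable_sqInt : ∀ t, 0 < t → Integrable (sqInt m p t) m
  integrable_sqIntDual : ∀ t, 0 < t → Integrable (sqIntDual m p t) m
  memLp_two : ∃ t₀, 0 < t₀ ∧ MemLp (sqInt m p t₀) 2 m ∧ MemLp (sqIntDual m p t₀) 2 m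

/-! ### Branching and the mean kernel -/

/-- A bounded branching rate `β ≥ 0` and offspring distributions `{p_n(x)}` with
`sup_x ∑ n² p_n(x) < ∞`. -/
structure Branching (E : Type*) [MeasurableSpace E] where
  β : E → ℝ
  measurable_β : Measurable β
  β_nonneg : ∀ x, 0 ≤ β x
  β_bounded : ∃ C, ∀ x, β x ≤ C
  offspring : ℕ → E → ℝ
  measurable_offspring : ∀ n, Measurable (offspring n)
  offspring_nonneg : ∀ n x, 0 ≤ offspring n x
  offspring_sum : ∀ x, HasSum (fun n => offspring n x) 1
  secondMoment : ∃ C, ∀ x, Summable (fun n : ℕ => (n : ℝ) ^ 2 * offspring n x) ∧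
    ∑' n : ℕ, (n : ℝ) ^ 2 * offspring n x ≤ C

/-- `α(x) = β(x) (∑ n p_n(x) - 1)` -/
noncomputable def Branching.α (𝔟 : Branching E) (x : E) : ℝ :=
  𝔟.β x * (∑' n : ℕ, (n : ℝ) * 𝔟.offspring n x - 1)

/-- The mean semigroup `T_t f(x) = Π_x [exp(∫_0^t α(ξ_s) ds) f(ξ_t)]`. -/
noncomputable def meanSemigroup {Ω : Type*} [MeasurableSpace Ω] (ξ : HuntProcess E Ω)
    (𝔟 : Branching E) (t : ℝ) (f : E → ℝ) (x : E) : ℝ :=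
  ∫ ω, Real.exp (∫ s in (0 : ℝ)..t, extend 𝔟.α (ξ.X s.toNNReal ω)) *
    extend f (ξ.X t.toNNReal ω) ∂(ξ.P x)

/-- `q` is the mean kernel: for `t > 0` it is the density of `T_t` relative to `m` that is
continuous in `(x, y)`. -/
structure IsMeanKernel {Ω : Type*} [MeasurableSpace Ω] (m : Measure E) (ξ : HuntProcess E Ω)
    (𝔟 : Branching E) (q : ℝ → E → E → ℝ) : Prop where
  continuous : ∀ t, 0 < t → Continuous (Function.uncurry (q t))
  density : ∀ t, 0 < t → ∀ f : E → ℝ, Measurable f → (∃ C, ∀ y, |f y| ≤ C) → ∀ x,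
    meanSemigroup ξ 𝔟 t f x = ∫ y, q t x y * f y ∂m

end Spatial

/-! ### Integral operators on `L²(E, m; ℂ)` -/

section Operator

variable {E : Type*} [MeasurableSpace E]

/-- `L²(E, m; ℂ)` -/
noncomputable abbrev L2 (m : Measure E) := Lp ℂ 2 m

lemma kernel_bound (m : Measure E) (k : E → E → ℝ) (f : E → ℂ) (hf : AEStronglyMeasurable f m)
    (x : E) (hk : AEStronglyMeasurable (k x) m) :
    ‖∫ y, (k x y : ℂ) * f y ∂m‖ₑ ^ 2 ≤ (∫⁻ y, ‖k x y‖ₑ ^ 2 ∂m) * eLpNorm f 2 m ^ 2 := by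
  have h1 : ‖∫ y, (k x y : ℂ) * f y ∂m‖ₑ ≤ ∫⁻ y, ‖k x y‖ₑ * ‖f y‖ₑ ∂m := by
    refine (enorm_integral_le_lintegral_enorm _).trans (le_of_eq ?_)
    refine lintegral_congr fun y => ?_
    rw [enorm_mul, ← ofReal_norm, Complex.norm_real, ofReal_norm]
  have h2 := ENNReal.lintegral_mul_le_Lp_mul_Lq m Real.HolderConjugate.two_two
    hk.enorm hf.enorm
  have e1 : eLpNorm f 2 m ^ 2 = ∫⁻ y, ‖f y‖ₑ ^ 2 ∂m := by
    rw [eLpNorm_eq_lintegral_rpow_enorm_toReal (by norm_num) (by norm_num)]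
    rw [← ENNReal.rpow_natCast, ← ENNReal.rpow_mul]
    norm_num
  have h3 := pow_le_pow_left' (h1.trans h2) 2
  refine h3.trans (le_of_eq ?_)
  rw [mul_pow, e1, ← ENNReal.rpow_natCast, ← ENNReal.rpow_natCast, ← ENNReal.rpow_mul,
    ← ENNReal.rpow_mul]
  norm_num

variable (m : Measure E) [SFinite m] (k : E → E → ℝ)

lemma kernel_sq (hk : MemLp (Function.uncurry k) 2 (m.prod m)) :
    ∫⁻ x, ∫⁻ y, ‖k x y‖ₑ ^ 2 ∂m ∂m = eLpNorm (Function.uncurry k) 2 (m.prod m) ^ 2 := by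
  rw [eLpNorm_eq_lintegral_rpow_enorm_toReal (by norm_num) (by norm_num)]
  rw [← ENNReal.rpow_natCast, ← ENNReal.rpow_mul]
  have : AEMeasurable (fun z => ‖Function.uncurry k z‖ₑ ^ (2 : ℝ)) (m.prod m) :=
    hk.1.enorm.pow_const _
  have h := lintegral_prod _ this
  simp only [Function.uncurry_apply_pair, ENNReal.rpow_ofNat] at h
  norm_num
  exact h.symm

lemma kernel_eLpNorm_le (hk : MemLp (Function.uncurry k) 2 (m.prod m)) (f : L2 m) :
    eLpNorm (fun x => ∫ y, (k x y : ℂ) * f y ∂m) 2 m ≤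
      eLpNorm (Function.uncurry k) 2 (m.prod m) * eLpNorm f 2 m := by
  have h : ∫⁻ x, ‖∫ y, (k x y : ℂ) * f y ∂m‖ₑ ^ 2 ∂m ≤
      (eLpNorm (Function.uncurry k) 2 (m.prod m) * eLpNorm f 2 m) ^ 2 := by
    rw [mul_pow, ← kernel_sq m k hk, ← lintegral_mul_const' _ _
      (ENNReal.pow_ne_top (Lp.memLp f).2.ne)]
    refine lintegral_mono_ae ?_
    filter_upwards [hk.1.prodMk_left] with x hx
    exact kernel_bound m k f (Lp.aestronglyMeasurable f) x hx
  rw [eLpNorm_eq_lintegral_rpow_enorm_toReal (by norm_num) (by norm_num)]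
  have h' := ENNReal.rpow_le_rpow h (z := 1 / 2) (by norm_num)
  refine (le_of_eq ?_).trans (h'.trans (le_of_eq ?_))
  · norm_num
  · rw [← ENNReal.rpow_natCast, ← ENNReal.rpow_mul]
    norm_num

lemma kernel_memLp (hk : MemLp (Function.uncurry k) 2 (m.prod m)) (f : L2 m) :
    MemLp (fun x => ∫ y, (k x y : ℂ) * f y ∂m) 2 m := by
  refine ⟨?_, (kernel_eLpNorm_le m k hk f).trans_lt (ENNReal.mul_lt_top hk.2 (Lp.memLp f).2)⟩
  have h1 : AEStronglyMeasurable (fun z : E × E => (k z.1 z.2 : ℂ) * f z.2) (m.prod m) :=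
    (Complex.continuous_ofReal.comp_aestronglyMeasurable hk.1).mul
      (Lp.aestronglyMeasurable f).comp_snd
  exact h1.integral_prod_right'

lemma kernel_integrable (hk : MemLp (Function.uncurry k) 2 (m.prod m)) :
    ∀ᵐ x ∂m, ∀ f : L2 m, Integrable (fun y => (k x y : ℂ) * f y) m := by
  have h : ∀ᵐ x ∂m, ∫⁻ y, ‖k x y‖ₑ ^ 2 ∂m < ∞ := by
    refine ae_lt_top' ?_ ?_
    · have : AEMeasurable (fun z => ‖Function.uncurry k z‖ₑ ^ 2) (m.prod m) :=
        hk.1.enorm.pow_const _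
      exact this.lintegral_prod_right'
    · rw [kernel_sq m k hk]
      exact ENNReal.pow_ne_top hk.2.ne
  filter_upwards [h, hk.1.prodMk_left] with x hx hx' f
  have hkx : MemLp (k x) 2 m := by
    refine ⟨hx', ?_⟩
    rw [eLpNorm_lt_top_iff_lintegral_rpow_enorm_lt_top (by norm_num) (by norm_num)]
    simpa using hx
  exact hkx.ofReal.integrable_mul (Lp.memLp f)

/-- The bounded operator `f ↦ ∫ k(·, y) f(y) m(dy)` on `L²(E, m; ℂ)` given by a kernel
`k ∈ L²(m ⊗ m)` (and `0` for other kernels). -/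
noncomputable def kernelOp : L2 m →L[ℂ] L2 m :=
  open Classical in
  if hk : MemLp (Function.uncurry k) 2 (m.prod m) then
    LinearMap.mkContinuous
      { toFun := fun f => (kernel_memLp m k hk f).toLp
        map_add' := fun f g => by
          rw [← MemLp.toLp_add, MemLp.toLp_eq_toLp_iff]
          filter_upwards [kernel_integrable m k hk] with x hx
          rw [Pi.add_apply, ← integral_add (hx f) (hx g)]
          refine integral_congr_ae ?_
          filter_upwards [Lp.coeFn_add f g] with y hy
          rw [hy, Pi.add_apply, mul_add]
        map_smul' := fun c f => by
          rw [RingHom.id_apply, ← MemLp.toLp_const_smul, MemLp.toLp_eq_toLp_iff]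
          refine Filter.Eventually.of_forall fun x => ?_
          rw [Pi.smul_apply, ← integral_smul]
          refine integral_congr_ae ?_
          filter_upwards [Lp.coeFn_smul c f] with y hy
          rw [hy, Pi.smul_apply, smul_eq_mul, smul_eq_mul, mul_left_comm] }
      (eLpNorm (Function.uncurry k) 2 (m.prod m)).toReal
      (fun f => by
        change ‖(kernel_memLp m k hk f).toLp‖ ≤ _
        rw [Lp.norm_toLp, Lp.norm_def, ← ENNReal.toReal_mul]
        exact ENNReal.toReal_mono (ENNReal.mul_lt_top hk.2 (Lp.memLp f).2).ne
          (kernel_eLpNorm_le m k hk f))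
  else 0

lemma kernelOp_apply (hk : MemLp (Function.uncurry k) 2 (m.prod m)) (f : L2 m) :
    kernelOp m k f =ᵐ[m] fun x => ∫ y, (k x y : ℂ) * f y ∂m := by
  rw [kernelOp, dif_pos hk]
  exact (kernel_memLp m k hk f).coeFn_toLp

end Operator

/-! ### Spectral theory of semigroups -/

section Spectral

section Abstract

variable {H : Type*} [NormedAddCommGroup H] [NormedSpace ℂ H]

/-- `f` is in the domain of the infinitesimal generator `𝒜` of the semigroup `{T_t}`,
and `𝒜 f = g`. -/
def GeneratorMaps (T : ℝ → H →L[ℂ] H) (f g : H) : Prop :=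
  Tendsto (fun t : ℝ => (t⁻¹ : ℂ) • (T t f - f)) (𝓝[>] 0) (𝓝 g)

/-- `μ` is an eigenvalue of the infinitesimal generator of `{T_t}`. -/
def IsGeneratorEigenvalue (T : ℝ → H →L[ℂ] H) (μ : ℂ) : Prop :=
  ∃ f, f ≠ 0 ∧ GeneratorMaps T f (μ • f)

/-- The null space of `(μ I - S)^n`. -/
def nullSpace (S : H →L[ℂ] H) (μ : ℂ) (n : ℕ) : Submodule ℂ H :=
  LinearMap.ker (((μ • ContinuousLinearMap.id ℂ H - S) ^ n : H →L[ℂ] H) : H →ₗ[ℂ] H)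

/-- The index at which the null spaces of `(μ I - S)^n` become stationary. -/
noncomputable def nullIndex (S : H →L[ℂ] H) (μ : ℂ) : ℕ :=
  sInf {n | nullSpace S μ n = nullSpace S μ (n + 1)}

end Abstract

/-- The `d × d` Jordan block with `-λ` on the diagonal and `1` above it. -/
def jordanBlock (lam : ℂ) (d : ℕ) : Matrix (Fin d) (Fin d) ℂ :=
  Matrix.of fun i j => if i = j then -lam else if (i : ℕ) + 1 = j then 1 else 0

/-- The `d × d` upper triangular matrix with `t^r / r!` on the `r`-th superdiagonal. -/
noncomputable def jordanBlockExp (t : ℝ) (d : ℕ) : Matrix (Fin d) (Fin d) ℂ :=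
  Matrix.of fun i j =>
    if i ≤ j then (t : ℂ) ^ ((j : ℕ) - i) / (((j : ℕ) - i).factorial : ℂ) else 0

variable {E : Type*} [TopologicalSpace E] [MeasurableSpace E]

/-- A choice of the spectral objects of a semigroup `{T_t}` on `L²(E, m; ℂ)`: a listing
`-λ_1, -λ_2, …` (indexed by `𝕀 = {k ≥ 1 : k ≤ N}`) of the distinct eigenvalues of its generator,
a time `t* > 0` at which the numbers `e^{-λ_k t*}` are distinct, and, for `k ∈ 𝕀`, a continuous
Jordan basis of `𝒩_k` and a continuous basis of `𝒩̂_k`, where `𝒩_k` and `𝒩̂_k` are the null spaces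
of `(e^{-λ_k t*} I - T_{t*})^{ν_k}` and of `(e^{-λ̄_k t*} I - T_{t*}^*)^{ν_k}`. The entries of the
bases are indexed by pairs (Jordan block, position in the block). The listing is by nondecreasing
real part of `λ_k`. -/
structure SpectralData (m : Measure E) (T : ℝ → L2 m →L[ℂ] L2 m) where
  /-- the number of eigenvalues -/
  N : ℕ∞
  lam : ℕ → ℂ
  eigenvalues : ∀ μ, IsGeneratorEigenvalue T μ ↔ ∃ k : ℕ, 1 ≤ k ∧ (k : ℕ∞) ≤ N ∧ μ = -lam k
  re_mono : ∀ j k : ℕ, 1 ≤ j → j ≤ k → (k : ℕ∞) ≤ N → (lam j).re ≤ (lam k).re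
  tstar : ℝ
  tstar_pos : 0 < tstar
  exp_distinct : ∀ j k : ℕ, 1 ≤ j → (j : ℕ∞) ≤ N → 1 ≤ k → (k : ℕ∞) ≤ N → j ≠ k →
    Complex.exp (-lam j * tstar) ≠ Complex.exp (-lam k * tstar)
  /-- the number `r_k` of Jordan blocks -/
  r : ℕ → ℕ
  /-- the sizes `d_{k,j}` of the Jordan blocks -/
  d : (k : ℕ) → Fin (r k) → ℕ
  d_pos : ∀ k i, 0 < d k i
  φ : (k : ℕ) → (Σ i : Fin (r k), Fin (d k i)) → E → ℂ
  φ_continuous : ∀ k : ℕ, 1 ≤ k → (k : ℕ∞) ≤ N → ∀ i, Continuous (φ k i)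
  φ_jordan : ∀ k : ℕ, 1 ≤ k → (k : ℕ∞) ≤ N →
    ∃ e : Module.Basis (Σ i : Fin (r k), Fin (d k i)) ℂ
        (nullSpace (T tstar) (Complex.exp (-lam k * tstar))
          (nullIndex (T tstar) (Complex.exp (-lam k * tstar)))),
      (∀ i, ((e i : L2 m) : E → ℂ) =ᵐ[m] φ k i) ∧
      ∀ j, GeneratorMaps T (e j : L2 m)
        (∑ i, Matrix.blockDiagonal' (fun b => jordanBlock (lam k) (d k b)) i j • (e i : L2 m))
  ψhat : (k : ℕ) → (Σ i : Fin (r k), Fin (d k i)) → E → ℂ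
  ψhat_continuous : ∀ k : ℕ, 1 ≤ k → (k : ℕ∞) ≤ N → ∀ i, Continuous (ψhat k i)
  ψhat_basis : ∀ k : ℕ, 1 ≤ k → (k : ℕ∞) ≤ N →
    ∃ e : Module.Basis (Σ i : Fin (r k), Fin (d k i)) ℂ
        (nullSpace (ContinuousLinearMap.adjoint (T tstar))
          (Complex.exp (-(starRingEnd ℂ (lam k)) * tstar))
          (nullIndex (T tstar) (Complex.exp (-lam k * tstar)))),
      ∀ i, ((e i : L2 m) : E → ℂ) =ᵐ[m] ψhat k i

namespace SpectralData

variable {m : Measure E} {T : ℝ → L2 m →L[ℂ] L2 m} (S : SpectralData m T)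

/-- `Re_k = Re λ_k` for `k ∈ 𝕀`, and `Re_k = ∞` otherwise. -/
noncomputable def reIndex (k : ℕ) : EReal :=
  open Classical in if 1 ≤ k ∧ (k : ℕ∞) ≤ S.N then (((S.lam k).re : ℝ) : EReal) else ⊤

/-- `D_k(t)`, the block diagonal matrix with blocks `J_{k,j}(t)`. -/
noncomputable def D (k : ℕ) (t : ℝ) :
    Matrix (Σ i : Fin (S.r k), Fin (S.d k i)) (Σ i : Fin (S.r k), Fin (S.d k i)) ℂ :=
  Matrix.blockDiagonal' fun b => jordanBlockExp t (S.d k b)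

/-- The matrix `Ã_k` with entries `⟨φ_j, ψ̂_l⟩_m`. -/
noncomputable def Atilde (k : ℕ) :
    Matrix (Σ i : Fin (S.r k), Fin (S.d k i)) (Σ i : Fin (S.r k), Fin (S.d k i)) ℂ :=
  Matrix.of fun j l => ∫ x, S.φ k j x * starRingEnd ℂ (S.ψhat k l x) ∂m

/-- `Ψ_k`, defined by `Ψ_k^T = (ψ̂_1, …, ψ̂_{n_k}) conj(Ã_k⁻¹)`. -/
noncomputable def ψ (k : ℕ) (l : Σ i : Fin (S.r k), Fin (S.d k i)) (x : E) : ℂ :=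
  ∑ j, S.ψhat k j x * starRingEnd ℂ ((S.Atilde k)⁻¹ j l)

/-- The sum of `e^{-λ_j t} Φ_j(x)^T D_j(t) conj(Ψ_j(y))` over `1 ≤ j ≤ k`. -/
noncomputable def expansion (k : ℕ) (t : ℝ) (x y : E) : ℂ :=
  ∑ j ∈ Finset.Icc 1 k, Complex.exp (-S.lam j * t) *
    ((fun i => S.φ j i x) ⬝ᵥ (S.D j t).mulVec (fun l => starRingEnd ℂ (S.ψ j l y)))

end SpectralData

end Spectral

end BranchingCLT

namespace BranchingCLT

/-! ### Riesz theory of compact operators -/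

section Riesz

variable {H : Type*} [NormedAddCommGroup H]

section Normed

variable [NormedSpace ℂ H]

/-! The operators $T_t$ form a strongly continuous semigroup of compact operators on $L^2$. The
expansion is the part of $T_t$ carried by the generalised eigenspaces $\mathcal N_1,\dots,\mathcal
N_k$. The remainder decays in operator norm, and its kernel is controlled pointwise by smoothing
with $T_{t_1}$ on both sides.

Probabilistic input. Since $|\alpha|\le K$, the Feynman–Kac weight lies in $[e^{-Kt},e^{Kt}]$, so
$e^{-Kt}p\le q\le e^{Kt}p$ (`IsMeanKernel.mem_Icc`), first for integrals over sets and then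
pointwise by continuity. Hence $q(t,\cdot,\cdot)\in L^2(m\otimes m)$, $T_t$ is Hilbert–Schmidt, and
Schur's test gives $\|T_t\|\le e^{Kt}$. The Markov property for path functionals gives
$T_{s+t}=T_sT_t$. Strong continuity at $0$ is proved for the kernel $p$ from right-continuity of
paths and transferred to $q$ by Schur's test (`IsMeanKernel.isC0Semigroup`).

Spectral input. For compact $T$ and $\mu\ne0$ the null spaces of $(\mu-T)^n$ stabilise, and the
stationary ones of $T$ and $T^*$ pair nondegenerately (`eq_zero_of_inner_nullSpace_eq_zero`). The
basis of $\mathcal N_j$ and its biorthogonal system, which is $\Psi_j$, therefore define a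
projection $P_j$ commuting with every $T_t$. On $\mathcal N_j$ the semigroup solves a linear ODE
with matrix $D_j$, so it acts by $e^{-\lambda_jt}D_j(t)$. With $P=\sum_{j\le k}P_j$, every
eigenvector of $T_{t^*}$ in $\ker P$ with nonzero eigenvalue belongs to some $e^{-\lambda_jt^*}$
with $j>k$. So $T_{t^*}(1-P)$ has spectral radius below $e^{-at^*}$, and Gelfand's formula yields
$\|T_t(1-P)\|\le Ce^{-at}$ (`exists_spectral_decomposition`).

Conclusion. The kernel $q(t,x,y)$ minus the expansion belongs to
$T_{t_1}\,[T_{t-2t_1}(1-P)]\,T_{t_1}$. By Cauchy–Schwarz the left factor costs $b_{t_1}(x)^{1/2}$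
and the right one $\widehat b_{t_1}(y)^{1/2}$. The resulting bound for averages over small open sets
becomes a bound at every point, since all the functions involved are continuous and $m$ has full
support (`norm_kernel_le_of_factor`). -/

lemma mem_nullSpace {S : H →L[ℂ] H} {μ : ℂ} {n : ℕ} {f : H} :
    f ∈ nullSpace S μ n ↔ ((μ • ContinuousLinearMap.id ℂ H - S) ^ n) f = 0 := Iff.rfl

lemma mem_nullSpace_one {S : H →L[ℂ] H} {μ : ℂ} {f : H} :
    f ∈ nullSpace S μ 1 ↔ S f = μ • f := by
  rw [mem_nullSpace, pow_one, eq_comm (a := S f)]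
  exact sub_eq_zero

lemma mem_nullSpace_succ {S : H →L[ℂ] H} {μ : ℂ} {n : ℕ} {f : H} :
    f ∈ nullSpace S μ (n + 1) ↔ (μ • ContinuousLinearMap.id ℂ H - S) f ∈ nullSpace S μ n := by
  rw [mem_nullSpace, mem_nullSpace, pow_succ]
  rfl

lemma nullSpace_mono (S : H →L[ℂ] H) (μ : ℂ) : Monotone (nullSpace S μ) := by
  refine monotone_nat_of_le_succ fun n f hf => ?_
  rw [mem_nullSpace, pow_succ']
  rw [mem_nullSpace] at hf
  change (μ • ContinuousLinearMap.id ℂ H - S) (((μ • ContinuousLinearMap.id ℂ H - S) ^ n) f) = 0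
  rw [hf, map_zero]

lemma isClosed_nullSpace (S : H →L[ℂ] H) (μ : ℂ) (n : ℕ) :
    IsClosed (nullSpace S μ n : Set H) :=
  ((μ • ContinuousLinearMap.id ℂ H - S) ^ n).isClosed_ker

lemma map_mem_nullSpace {S U : H →L[ℂ] H} (h : S * U = U * S) {μ : ℂ} {n : ℕ} {f : H}
    (hf : f ∈ nullSpace S μ n) : U f ∈ nullSpace S μ n := by
  have hc : Commute U ((μ • ContinuousLinearMap.id ℂ H - S) ^ n) := by
    refine Commute.pow_right (Commute.sub_right ?_ h.symm) n
    exact ((Commute.one_right U).smul_right μ)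
  rw [mem_nullSpace] at hf ⊢
  have := DFunLike.congr_fun hc.eq f
  change U (((μ • ContinuousLinearMap.id ℂ H - S) ^ n) f) =
    ((μ • ContinuousLinearMap.id ℂ H - S) ^ n) (U f) at this
  rw [← this, hf, map_zero]

lemma nullSpace_eq_add (S : H →L[ℂ] H) (μ : ℂ) {n : ℕ}
    (h : nullSpace S μ n = nullSpace S μ (n + 1)) (j : ℕ) :
    nullSpace S μ n = nullSpace S μ (n + j) := by
  induction j with
  | zero => rfl
  | succ j ih =>
    rw [h]
    ext f
    rw [← add_assoc, mem_nullSpace_succ, mem_nullSpace_succ, ih]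

/-- Powers of $\mu-T$ stay compact perturbations of a scalar, so the Fredholm alternative applies to
them as well. -/
lemma exists_pow_eq_sub_isCompactOperator {T : H →L[ℂ] H} (hT : IsCompactOperator T) (μ : ℂ)
    (n : ℕ) : ∃ K : H →L[ℂ] H, IsCompactOperator K ∧
      (μ • ContinuousLinearMap.id ℂ H - T) ^ n = μ ^ n • ContinuousLinearMap.id ℂ H - K := by
  induction n with
  | zero => exact ⟨0, isCompactOperator_zero, by simp; rfl⟩
  | succ n ih =>
    obtain ⟨K, hK, h⟩ := ih
    refine ⟨μ ^ n • T + μ • K - K * T, ?_, ?_⟩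
    · exact ((hT.smul (μ ^ n)).add (hK.smul μ)).sub (hK.comp_clm T)
    · rw [pow_succ, h]
      ext f
      simp [pow_succ, mul_smul]
      module

/-- Fredholm alternative: a nonzero number is either an eigenvalue of a compact operator or in its
resolvent set, and injectivity excludes the first. -/
lemma surjective_of_injective_sub_isCompactOperator [CompleteSpace H] {K : H →L[ℂ] H}
    (hK : IsCompactOperator K) {c : ℂ} (hc : c ≠ 0)
    (h : ∀ f, (c • ContinuousLinearMap.id ℂ H - K) f = 0 → f = 0) :
    Function.Surjective (c • ContinuousLinearMap.id ℂ H - K) := by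
  rcases hK.hasEigenvalue_or_mem_resolventSet hc with h' | h'
  · obtain ⟨v, hv, hv0⟩ := h'.exists_hasEigenvector
    refine absurd (h v ?_) hv0
    rw [Module.End.mem_eigenspace_iff] at hv
    simpa [sub_eq_zero] using hv.symm
  · rw [spectrum.mem_resolventSet_iff, ContinuousLinearMap.isUnit_iff_bijective] at h'
    exact h'.2

end Normed

variable [InnerProductSpace ℂ H] [CompleteSpace H]

/-- A compact operator on a Hilbert space has finite ascent at every `μ ≠ 0`. -/
theorem exists_nullSpace_eq_succ {T : H →L[ℂ] H} (hT : IsCompactOperator T) {μ : ℂ}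
    (hμ : μ ≠ 0) : ∃ n, nullSpace T μ n = nullSpace T μ (n + 1) := by
  by_contra! hne
  -- If the chain never stabilised, each step would contain a unit vector orthogonal to the previous
  -- null space. The images of these vectors under $T$ would be $|\mu|$-separated, against
  -- compactness.
  have key : ∀ n, ∃ e ∈ nullSpace T μ (n + 1), ‖e‖ = 1 ∧ ∀ g ∈ nullSpace T μ n, 1 ≤ ‖e + g‖ := by
    intro n
    have hlt : nullSpace T μ n < nullSpace T μ (n + 1) :=
      lt_of_le_of_ne (nullSpace_mono T μ (Nat.le_succ n)) (hne n)
    obtain ⟨x, hx, hxn⟩ := SetLike.exists_of_lt hlt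
    have : CompleteSpace (nullSpace T μ n) := (isClosed_nullSpace T μ n).completeSpace_coe
    obtain ⟨y, hy, z, hz, rfl⟩ := (nullSpace T μ n).exists_add_mem_mem_orthogonal x
    have hz' : z ∈ nullSpace T μ (n + 1) := by
      simpa using Submodule.sub_mem _ hx (hlt.le hy)
    have hz0 : z ≠ 0 := by
      rintro rfl
      exact hxn (by simpa using hy)
    have hz1 : ‖((‖z‖⁻¹ : ℝ) : ℂ) • z‖ = 1 := by
      rw [norm_smul]
      simp [hz0]
    refine ⟨((‖z‖⁻¹ : ℝ) : ℂ) • z, Submodule.smul_mem _ _ hz', hz1, fun g hg => ?_⟩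
    have ho : inner ℂ (((‖z‖⁻¹ : ℝ) : ℂ) • z) g = 0 := by
      rw [inner_smul_left, Submodule.inner_left_of_mem_orthogonal hg hz, mul_zero]
    have := norm_add_sq_eq_norm_sq_add_norm_sq_of_inner_eq_zero _ _ ho
    rw [hz1] at this
    nlinarith [norm_nonneg (((‖z‖⁻¹ : ℝ) : ℂ) • z + g), sq_nonneg ‖g‖]
  choose e he he1 hed using key
  have hsep : ∀ i j, i < j → ‖μ‖ ≤ ‖T (e j) - T (e i)‖ := by
    intro i j hij
    have h1 : (μ • ContinuousLinearMap.id ℂ H - T) (e j) ∈ nullSpace T μ j :=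
      mem_nullSpace_succ.1 (he j)
    have h2 : T (e i) ∈ nullSpace T μ j :=
      nullSpace_mono T μ hij (map_mem_nullSpace rfl (he i))
    -- Up to the factor $\mu$, the difference is $e_j$ plus an element of the $j$-th null space, to
    -- which $e_j$ is orthogonal.
    have h3 : T (e j) - T (e i) = μ • (e j + μ⁻¹ • (-(μ • ContinuousLinearMap.id ℂ H - T) (e j)
        - T (e i))) := by
      rw [smul_add, smul_inv_smul₀ hμ]
      simp
      abel
    rw [h3, norm_smul]
    refine le_mul_of_one_le_right (norm_nonneg _) (hed j _ ?_)
    exact Submodule.smul_mem _ _ (Submodule.sub_mem _ (Submodule.neg_mem _ h1) h2)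
  obtain ⟨K, hK, hK'⟩ := hT.image_closedBall_subset_compact 1
  obtain ⟨y, -, ψ, hψ, hψy⟩ := hK.tendsto_subseq (fun n => hK' ⟨e n, by simp [he1], rfl⟩)
  obtain ⟨N, hN⟩ := Metric.cauchySeq_iff'.1 hψy.cauchySeq ‖μ‖ (norm_pos_iff.2 hμ)
  have h1 := hN (N + 1) (Nat.le_succ N)
  rw [dist_eq_norm] at h1
  exact absurd h1 (not_lt.2 (hsep _ _ (hψ (Nat.lt_succ_self N))))

lemma nullSpace_nullIndex {T : H →L[ℂ] H} (hT : IsCompactOperator T) {μ : ℂ} (hμ : μ ≠ 0) :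
    nullSpace T μ (nullIndex T μ) = nullSpace T μ (nullIndex T μ + 1) :=
  Nat.sInf_mem (s := {n | nullSpace T μ n = nullSpace T μ (n + 1)})
    (exists_nullSpace_eq_succ hT hμ)

/-- An eigenvector belongs to the stationary null space. -/
lemma mem_nullSpace_nullIndex_of_eigenvector {T : H →L[ℂ] H} (hT : IsCompactOperator T) {μ : ℂ}
    (hμ : μ ≠ 0) {f : H} (hf : T f = μ • f) : f ∈ nullSpace T μ (nullIndex T μ) := by
  rw [nullSpace_eq_add T μ (nullSpace_nullIndex hT hμ) 1]
  exact nullSpace_mono T μ (by omega) (mem_nullSpace_one.2 hf)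

lemma adjoint_pow_sub (T : H →L[ℂ] H) (μ : ℂ) (n : ℕ) :
    ContinuousLinearMap.adjoint ((μ • ContinuousLinearMap.id ℂ H - T) ^ n) =
      ((starRingEnd ℂ μ) • ContinuousLinearMap.id ℂ H - ContinuousLinearMap.adjoint T) ^ n := by
  rw [← ContinuousLinearMap.star_eq_adjoint, star_pow, star_sub, star_smul,
    ContinuousLinearMap.star_eq_adjoint T]
  congr 3
  exact star_one (H →L[ℂ] H)

/-- `⟨g, (μ - T)^n h⟩ = 0` for `g` in the null space of the adjoint power. -/
lemma inner_pow_eq_zero {T : H →L[ℂ] H} {μ : ℂ} {n : ℕ} {g : H}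
    (hg : g ∈ nullSpace (ContinuousLinearMap.adjoint T) (starRingEnd ℂ μ) n) (h : H) :
    inner ℂ g (((μ • ContinuousLinearMap.id ℂ H - T) ^ n) h) = 0 := by
  rw [← ContinuousLinearMap.adjoint_inner_left, adjoint_pow_sub, mem_nullSpace.1 hg,
    inner_zero_left]

/-- The pairing between the stationary null spaces of `T` and of its adjoint is nondegenerate
as soon as these have the same finite dimension. -/
theorem eq_zero_of_inner_nullSpace_eq_zero {T : H →L[ℂ] H} (hT : IsCompactOperator T) {μ : ℂ}
    (hμ : μ ≠ 0) {ι : Type*} [Fintype ι]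
    (e : Module.Basis ι ℂ (nullSpace T μ (nullIndex T μ)))
    (e' : Module.Basis ι ℂ (nullSpace (ContinuousLinearMap.adjoint T) (starRingEnd ℂ μ)
      (nullIndex T μ)))
    {f : H} (hf : f ∈ nullSpace T μ (nullIndex T μ))
    (h0 : ∀ g ∈ nullSpace (ContinuousLinearMap.adjoint T) (starRingEnd ℂ μ) (nullIndex T μ),
      inner ℂ g f = 0) : f = 0 := by
  set ν := nullIndex T μ with hν
  set N := nullSpace T μ ν with hN
  set N' := nullSpace (ContinuousLinearMap.adjoint T) (starRingEnd ℂ μ) ν with hN'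
  have : FiniteDimensional ℂ N := e.finiteDimensional_of_finite
  have : FiniteDimensional ℂ N' := e'.finiteDimensional_of_finite
  set S := (μ • ContinuousLinearMap.id ℂ H - T) ^ ν with hS
  -- Equal dimensions provide an isomorphism $N\cong N'$. Composed with the orthogonal projection
  -- onto $N$ it gives a finite-rank $J$ for which $S+J$ is injective, because the range of $S$ is
  -- orthogonal to $N'$. By the Fredholm alternative $S+J$ is then onto, so $f=Sh+Jh$ for some $h$.
  let J₀ : N →ₗ[ℂ] H := N'.subtype ∘ₗ (e.equiv e' (Equiv.refl ι)).toLinearMap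
  let J : H →L[ℂ] H := (LinearMap.toContinuousLinearMap J₀) ∘L N.orthogonalProjectionOnto
  have hJmem : ∀ h, J h ∈ N' := fun h => Subtype.coe_prop _
  have hJinj : ∀ h ∈ N, J h = 0 → h = 0 := by
    intro h hh hJ
    have h1 : N.orthogonalProjectionOnto h = ⟨h, hh⟩ :=
      Submodule.orthogonalProjectionOnto_mem_subspace_eq_self (⟨h, hh⟩ : N)
    have h2 : J₀ ⟨h, hh⟩ = 0 := by
      rw [← hJ, ← h1]
      rfl
    have h3 : e.equiv e' (Equiv.refl ι) ⟨h, hh⟩ = 0 := Subtype.ext h2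
    have h4 := (LinearEquiv.map_eq_zero_iff _).1 h3
    exact congrArg Subtype.val h4
  have hJcomp : IsCompactOperator J := by
    have : IsCompactOperator (LinearMap.toContinuousLinearMap J₀) :=
      have : ProperSpace N := FiniteDimensional.proper ℂ N
      isCompactOperator_of_locallyCompactSpace_rng _
    exact this.comp_clm _
  obtain ⟨K, hK, hKS⟩ := exists_pow_eq_sub_isCompactOperator hT μ ν
  have hKS' : ∀ h, (μ ^ ν • ContinuousLinearMap.id ℂ H - (K - J)) h = S h + J h := by
    intro h
    rw [hS, hKS]
    simp
    abel
  have hself : ∀ g ∈ N', (∀ g' ∈ N', inner ℂ g' g = 0) → g = 0 := fun g hg h =>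
    inner_self_eq_zero.1 (h g hg)
  have hSJ : ∀ g' ∈ N', ∀ h, inner ℂ g' (S h) = 0 := fun g' hg' h => inner_pow_eq_zero hg' h
  have hinj : ∀ h, (μ ^ ν • ContinuousLinearMap.id ℂ H - (K - J)) h = 0 → h = 0 := by
    intro h hh
    rw [hKS'] at hh
    have hJ0 : J h = 0 := by
      refine hself _ (hJmem h) fun g' hg' => ?_
      rw [eq_neg_of_add_eq_zero_right hh, inner_neg_right, hSJ g' hg', neg_zero]
    rw [hJ0, add_zero] at hh
    exact hJinj h hh hJ0
  obtain ⟨h, hh⟩ := surjective_of_injective_sub_isCompactOperator (hK.sub hJcomp)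
    (pow_ne_zero ν hμ) hinj f
  rw [hKS'] at hh
  -- Both $f$ and $Sh$ are orthogonal to $N'$, hence so is $Jh\in N'$, which must vanish.
  have hJ0 : J h = 0 := by
    refine hself _ (hJmem h) fun g' hg' => ?_
    rw [eq_sub_of_add_eq' hh, inner_sub_right, h0 g' hg', hSJ g' hg', sub_zero]
  rw [hJ0, add_zero] at hh
  -- Now $f=Sh$ with $S^2h=Sf=0$; stationarity of the null spaces gives $Sh=0$.
  have h2 : h ∈ nullSpace T μ (ν + ν) := by
    rw [mem_nullSpace, pow_add, ← hS]
    change S (S h) = 0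
    rw [hh]
    exact hf
  rw [← nullSpace_eq_add T μ (nullSpace_nullIndex hT hμ) ν] at h2
  rw [← hh]
  exact h2

/-- Stationary null spaces of `T` and of its adjoint for different eigenvalues are orthogonal. -/
theorem inner_nullSpace_eq_zero_of_ne {T : H →L[ℂ] H} {μ μ' : ℂ} (hne : μ ≠ μ') {n n' : ℕ}
    [FiniteDimensional ℂ (nullSpace T μ n)] {f g : H} (hf : f ∈ nullSpace T μ n)
    (hg : g ∈ nullSpace (ContinuousLinearMap.adjoint T) (starRingEnd ℂ μ') n') :
    inner ℂ g f = 0 := by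
  set N := nullSpace T μ n with hN
  set A : H →L[ℂ] H := (μ' • ContinuousLinearMap.id ℂ H - T) ^ n' with hA
  have hcomm : T * A = A * T := by
    refine (Commute.pow_right (Commute.sub_right ?_ (Commute.refl T)) n').eq
    exact (Commute.one_right T).smul_right μ'
  -- On the finite-dimensional $N$ the operator $(\mu'-T)^{n'}$ is injective, since generalised
  -- eigenspaces for different eigenvalues are disjoint. It is therefore onto, and $f$ lies in its
  -- range, which is orthogonal to the null space of the adjoint power.
  let A₀ : N →ₗ[ℂ] N := (A : H →ₗ[ℂ] H).restrict fun h hh => map_mem_nullSpace hcomm hh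
  have hdisj : Disjoint (nullSpace T μ n) (nullSpace T μ' n') := by
    have hgen : ∀ (c : ℂ) (j : ℕ), nullSpace T c j ≤
        Module.End.genEigenspace (T : Module.End ℂ H) c j := by
      intro c j h hh
      rw [Module.End.mem_genEigenspace_nat, LinearMap.mem_ker]
      have h1 : ((T : Module.End ℂ H) - c • 1) = - ((c • ContinuousLinearMap.id ℂ H - T :
          H →L[ℂ] H) : H →ₗ[ℂ] H) := by
        ext; simp
      rw [h1, neg_pow, Module.End.mul_apply]
      have h2 : (((c • ContinuousLinearMap.id ℂ H - T : H →L[ℂ] H) : Module.End ℂ H) ^ j) h = 0 := by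
        rw [← mem_nullSpace.1 hh, ← ContinuousLinearMap.toLinearMap_pow]
        rfl
      rw [h2, map_zero]
    exact (Module.End.disjoint_genEigenspace _ hne _ _).mono (hgen μ n) (hgen μ' n')
  have hinj : Function.Injective A₀ := by
    rw [injective_iff_map_eq_zero]
    intro h hh
    have h1 : (h : H) ∈ nullSpace T μ' n' := congrArg Subtype.val hh
    exact Subtype.ext (Submodule.disjoint_def.1 hdisj _ h.2 h1)
  obtain ⟨h, hh⟩ := LinearMap.surjective_of_injective hinj ⟨f, hf⟩
  have h1 : A (h : H) = f := congrArg Subtype.val hh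
  rw [← h1]
  exact inner_pow_eq_zero hg _

end Riesz

/-! ### Strongly continuous semigroups -/

section Semigroup

variable {H : Type*} [NormedAddCommGroup H] [NormedSpace ℂ H]

/-- `{T_t, t > 0}` is a strongly continuous semigroup with `‖T_t‖ ≤ e^{Kt}`. -/
structure IsC0Semigroup (T : ℝ → H →L[ℂ] H) (K : ℝ) : Prop where
  add : ∀ s t, 0 < s → 0 < t → T (s + t) = T s * T t
  bound : ∀ t, 0 < t → ‖T t‖ ≤ Real.exp (K * t)
  tendsto : ∀ f, Tendsto (fun t => T t f) (𝓝[>] 0) (𝓝 f)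

/-- The orbit `t ↦ T_t f`, extended by `f` to `t ≤ 0`. -/
noncomputable def orbit (T : ℝ → H →L[ℂ] H) (f : H) (t : ℝ) : H := if t ≤ 0 then f else T t f

lemma orbit_of_pos (T : ℝ → H →L[ℂ] H) (f : H) {t : ℝ} (ht : 0 < t) : orbit T f t = T t f :=
  if_neg (not_le.2 ht)

lemma orbit_of_nonpos (T : ℝ → H →L[ℂ] H) (f : H) {t : ℝ} (ht : t ≤ 0) : orbit T f t = f :=
  if_pos ht

namespace IsC0Semigroup

variable {T : ℝ → H →L[ℂ] H} {K : ℝ} (hT : IsC0Semigroup T K)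
include hT

lemma commute {s t : ℝ} (hs : 0 < s) (ht : 0 < t) : T s * T t = T t * T s := by
  rw [← hT.add s t hs ht, ← hT.add t s ht hs, add_comm]

lemma orbit_add (f : H) {s t : ℝ} (hs : 0 < s) (ht : 0 ≤ t) :
    orbit T f (s + t) = T s (orbit T f t) := by
  rw [orbit_of_pos T f (by linarith)]
  rcases ht.eq_or_lt with rfl | ht
  · rw [orbit_of_nonpos T f le_rfl, add_zero]
  · rw [orbit_of_pos T f ht, hT.add s t hs ht]
    rfl

/-- Factoring out $T_s$ reduces the increment at $s$ to an increment at $0$. The absolute value of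
$K$ makes the constant monotone in $s$. -/
lemma norm_orbit_sub_le (f : H) {s t : ℝ} (hs : 0 ≤ s) (hst : s ≤ t) :
    ‖orbit T f t - orbit T f s‖ ≤ Real.exp (|K| * s) * ‖orbit T f (t - s) - f‖ := by
  rcases hs.eq_or_lt with rfl | hs
  · rw [orbit_of_nonpos T f le_rfl]
    simp
  · have h1 : orbit T f t = T s (orbit T f (t - s)) := by
      rw [← hT.orbit_add f hs (by linarith)]
      congr 1
      ring
    rw [h1, orbit_of_pos T f hs, ← map_sub]
    refine (ContinuousLinearMap.le_opNorm _ _).trans ?_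
    gcongr
    refine (hT.bound s hs).trans (Real.exp_le_exp.2 ?_)
    gcongr
    exact le_abs_self K

lemma tendsto_orbit_zero (f : H) : Tendsto (orbit T f) (𝓝 0) (𝓝 f) := by
  rw [← nhdsLE_sup_nhdsGT]
  refine Tendsto.sup ?_ ?_
  · refine tendsto_const_nhds.congr' ?_
    filter_upwards [self_mem_nhdsWithin] with t ht
    exact (orbit_of_nonpos T f ht).symm
  · refine (hT.tendsto f).congr' ?_
    filter_upwards [self_mem_nhdsWithin] with t ht
    exact (orbit_of_pos T f ht).symm

lemma continuous_orbit (f : H) : Continuous (orbit T f) := by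
  rw [continuous_iff_continuousAt]
  intro t₀
  have hmax : ∀ t, orbit T f t = orbit T f (max t 0) := by
    intro t
    rcases le_total t 0 with h | h
    · rw [max_eq_right h, orbit_of_nonpos T f h, orbit_of_nonpos T f le_rfl]
    · rw [max_eq_left h]
  -- The earlier of the two times is factored out; which one it is decides the exponential. Both
  -- exponentials stay bounded near $t_0$, so their sum serves in either case.
  have key : ∀ t, ‖orbit T f t - orbit T f t₀‖ ≤
      Real.exp (|K| * |t₀|) * ‖orbit T f |max t 0 - max t₀ 0| - f‖ ∨
      ‖orbit T f t - orbit T f t₀‖ ≤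
      Real.exp (|K| * |t|) * ‖orbit T f |max t 0 - max t₀ 0| - f‖ := by
    intro t
    rw [hmax t, hmax t₀]
    have hm : ∀ u : ℝ, max u 0 ≤ |u| := fun u => max_le (le_abs_self u) (abs_nonneg u)
    rcases le_total (max t 0) (max t₀ 0) with h | h
    · right
      rw [norm_sub_rev, abs_sub_comm, abs_of_nonneg (sub_nonneg.2 h)]
      refine (hT.norm_orbit_sub_le f (le_max_right t 0) h).trans ?_
      gcongr
      exact hm t
    · left
      rw [abs_of_nonneg (sub_nonneg.2 h)]
      refine (hT.norm_orbit_sub_le f (le_max_right t₀ 0) h).trans ?_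
      gcongr
      exact hm t₀
  have hlim : Tendsto (fun t => ‖orbit T f |max t 0 - max t₀ 0| - f‖) (𝓝 t₀) (𝓝 0) := by
    have h1 : Tendsto (fun t => |max t 0 - max t₀ 0|) (𝓝 t₀) (𝓝 0) := by
      have : Continuous fun t : ℝ => |max t 0 - max t₀ 0| := by fun_prop
      simpa using this.tendsto t₀
    have h2 := ((hT.tendsto_orbit_zero f).comp h1).sub_const f
    simpa using h2.norm
  rw [ContinuousAt, tendsto_iff_norm_sub_tendsto_zero]
  have h3 : Tendsto (fun t : ℝ => (Real.exp (|K| * |t₀|) + Real.exp (|K| * |t|)) *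
      ‖orbit T f |max t 0 - max t₀ 0| - f‖) (𝓝 t₀) (𝓝 0) := by
    have h4 : Tendsto (fun t : ℝ => Real.exp (|K| * |t₀|) + Real.exp (|K| * |t|)) (𝓝 t₀)
        (𝓝 (Real.exp (|K| * |t₀|) + Real.exp (|K| * |t₀|))) := by
      have : Continuous fun t : ℝ => Real.exp (|K| * |t₀|) + Real.exp (|K| * |t|) := by fun_prop
      exact this.tendsto t₀
    simpa using h4.mul hlim
  refine squeeze_zero (fun t => norm_nonneg _) (fun t => ?_) h3
  rw [add_mul]
  have e1 : 0 ≤ Real.exp (|K| * |t₀|) * ‖orbit T f |max t 0 - max t₀ 0| - f‖ := by positivity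
  have e2 : 0 ≤ Real.exp (|K| * |t|) * ‖orbit T f |max t 0 - max t₀ 0| - f‖ := by positivity
  rcases key t with h | h <;> linarith

/-- Only the right derivative is needed: $T_t$ is pulled out of the forward difference quotient, and
ODE uniqueness accepts right derivatives of continuous curves. -/
lemma hasDerivWithinAt_orbit {f g : H} (hf : GeneratorMaps T f g) {t : ℝ} (ht : 0 ≤ t) :
    HasDerivWithinAt (orbit T f) (orbit T g t) (Set.Ici t) t := by
  rw [hasDerivWithinAt_iff_tendsto_slope]
  have hset : Set.Ici t \ {t} = Set.Ioi t := by
    ext s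
    simp [lt_iff_le_and_ne, and_comm]
  rw [hset]
  have hsub : Tendsto (fun s => s - t) (𝓝[>] t) (𝓝[>] 0) := by
    refine tendsto_nhdsWithin_iff.2 ⟨?_, ?_⟩
    · have : Tendsto (fun s => s - t) (𝓝 t) (𝓝 (t - t)) := (continuous_sub_right t).tendsto t
      rw [sub_self] at this
      exact this.mono_left nhdsWithin_le_nhds
    · filter_upwards [self_mem_nhdsWithin] with s hs
      exact sub_pos.2 (Set.mem_Ioi.1 hs)
  have h1 := hf.comp hsub
  rcases ht.eq_or_lt with rfl | ht
  · rw [orbit_of_nonpos T g le_rfl]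
    refine h1.congr' ?_
    filter_upwards [self_mem_nhdsWithin] with s hs
    rw [slope_def_module, orbit_of_nonpos T f le_rfl, orbit_of_pos T f hs]
    simp only [Function.comp_apply, sub_zero]
    rw [← Complex.ofReal_inv, Complex.coe_smul]
  · rw [orbit_of_pos T g ht]
    refine (((T t).continuous.tendsto g).comp h1).congr' ?_
    filter_upwards [self_mem_nhdsWithin] with s hs
    have hs' : 0 < s - t := sub_pos.2 (Set.mem_Ioi.1 hs)
    have e : s = t + (s - t) := by ring
    rw [slope_def_module, orbit_of_pos T f ht]
    conv_rhs => rw [e]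
    rw [hT.orbit_add f ht hs'.le, orbit_of_pos T f hs', ← map_sub]
    simp only [Function.comp_apply, map_smul, add_sub_cancel]
    rw [← Complex.ofReal_inv, Complex.coe_smul]

/-- The action of the semigroup on a finite system on which the generator acts by the matrix `B`
is the solution of the corresponding linear ODE. -/
theorem apply_eq_sum {ι : Type*} [Fintype ι] [DecidableEq ι] {e : ι → H} {B : Matrix ι ι ℂ}
    (he : ∀ j, GeneratorMaps T (e j) (∑ i, B i j • e i)) {M : ℝ → Matrix ι ι ℂ}
    (hM : ∀ i j t, HasDerivAt (fun s => M s i j) ((M t * B) i j) t) (hM0 : M 0 = 1)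
    {t : ℝ} (ht : 0 < t) (j : ι) : T t (e j) = ∑ i, M t i j • e i := by
  -- The system $(T_te_j)_j$ and the combinations $\sum_iM_{ij}(t)e_i$ both solve $u'=Lu$ with the
  -- same initial value. Since $L$ is bounded, hence Lipschitz, they coincide.
  let L : (ι → H) →L[ℂ] (ι → H) :=
    ContinuousLinearMap.pi fun j => ∑ i, B i j • ContinuousLinearMap.proj i
  have hL : ∀ u j, L u j = ∑ i, B i j • u i := by
    intro u j
    simp [L]
  have hsum : ∀ (g : ι → H) (c : ι → ℂ) (s : ℝ),
      orbit T (∑ i, c i • g i) s = ∑ i, c i • orbit T (g i) s := by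
    intro g c s
    unfold orbit
    split_ifs
    · rfl
    · simp
  have hcont : Continuous fun (s : ℝ) (j : ι) => ∑ i, M s i j • e i :=
    continuous_iff_continuousAt.2 fun s => continuousAt_pi.2 fun j =>
      tendsto_finsetSum _ fun i _ => ((hM i j s).continuousAt.smul continuousAt_const)
  have huniq := ODE_solution_unique (v := fun _ => L) (K := ‖L‖₊) (a := 0) (b := t)
    (f := fun s j => orbit T (e j) s) (g := fun s j => ∑ i, M s i j • e i)
    (fun _ => L.lipschitz)
    (continuous_pi fun j => hT.continuous_orbit (e j)).continuousOn
    (fun s hs => by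
      rw [hasDerivWithinAt_pi]
      intro j
      rw [hL, ← hsum]
      exact hT.hasDerivWithinAt_orbit (he j) hs.1)
    hcont.continuousOn
  have h2 := huniq (fun s _ => by
      rw [hasDerivWithinAt_pi]
      intro j
      rw [hL]
      have h3 : HasDerivAt (fun s => ∑ i, M s i j • e i) (∑ i, (M s * B) i j • e i) s :=
        HasDerivAt.fun_sum fun i _ => (hM i j s).smul_const (e i)
      have h4 : ∑ i, (M s * B) i j • e i = ∑ i, B i j • ∑ l, M s l i • e l := by
        simp only [Matrix.mul_apply, Finset.sum_smul, Finset.smul_sum]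
        rw [Finset.sum_comm]
        refine Finset.sum_congr rfl fun i _ => Finset.sum_congr rfl fun l _ => ?_
        rw [smul_smul, mul_comm]
      rw [← h4]
      exact h3.hasDerivWithinAt) (by
      funext j
      simp [orbit_of_nonpos, hM0, Matrix.one_apply, ite_smul])
  have h5 := congrFun (h2 (Set.right_mem_Icc.2 ht.le)) j
  simp only at h5
  rw [← h5, orbit_of_pos T _ ht]

lemma apply_eq_exp_smul {f : H} {c : ℂ} (hf : GeneratorMaps T f (c • f)) {t : ℝ} (ht : 0 < t) :
    T t f = Complex.exp (c * t) • f := by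
  have h := hT.apply_eq_sum (ι := Unit) (e := fun _ => f) (B := Matrix.of fun _ _ => c)
    (M := fun s => Matrix.of fun _ _ => Complex.exp (c * s)) (fun _ => by simpa using hf)
    (fun i j s => by
      have h1 : HasDerivAt (fun s : ℝ => c * (s : ℂ)) c s := by
        simpa using (Complex.ofRealCLM.hasDerivAt (x := s)).const_mul c
      simpa [Matrix.mul_apply] using h1.cexp) (by ext; simp) ht ()
  simpa using h

/-- A common eigenvector of the semigroup is an eigenvector of its generator. -/
theorem exists_generatorMaps_of_forall_eq_smul {f : H} (hf : f ≠ 0)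
    (h : ∀ t, 0 < t → ∃ c : ℂ, T t f = c • f) : ∃ c : ℂ, GeneratorMaps T f (c • f) := by
  obtain ⟨ℓ, -, hℓ⟩ := exists_dual_vector ℂ f (norm_ne_zero_iff.2 hf)
  have hnf : ((‖f‖ : ℝ) : ℂ) ≠ 0 := by simpa using hf
  have hℓ0 : ℓ f ≠ 0 := by
    rw [hℓ]
    exact hnf
  -- Reading the eigenvalue off through a functional makes it continuous in $t$.
  set c : ℝ → ℂ := fun t => ℓ (orbit T f t) / ℓ f with hc
  have hcc : Continuous c := (ℓ.continuous.comp (hT.continuous_orbit f)).div_const _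
  have hc0 : c 0 = 1 := by simp [hc, orbit_of_nonpos, hℓ0]
  have hcT : ∀ t, 0 ≤ t → orbit T f t = c t • f := by
    intro t ht
    rcases ht.eq_or_lt with rfl | ht
    · rw [hc0, orbit_of_nonpos T f le_rfl, one_smul]
    · obtain ⟨d, hd⟩ := h t ht
      have : c t = d := by
        simp only [hc, orbit_of_pos T f ht, hd, map_smul, smul_eq_mul]
        field_simp
      rw [this, orbit_of_pos T f ht, hd]
  have hcadd : ∀ s t, 0 ≤ s → 0 ≤ t → c (s + t) = c s * c t := by
    intro s t hs ht
    rcases hs.eq_or_lt with rfl | hs'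
    · rw [hc0, zero_add, one_mul]
    · have h1 := hT.orbit_add f hs' ht
      rw [hcT _ (by linarith), hcT t ht, map_smul, ← orbit_of_pos T f hs', hcT s hs, smul_smul]
        at h1
      rw [smul_left_injective ℂ hf h1, mul_comm]
  -- A continuous solution of $c(s+t)=c(s)c(t)$ is differentiable: integrating over $s\in[0,h_0]$
  -- gives $c(t)F(h_0)=F(t+h_0)-F(t)$, whose right side is $C^1$. Some $F(h_0)$ is nonzero because
  -- $F'(0)=c(0)=1$.
  set F : ℝ → ℂ := fun t => ∫ s in (0 : ℝ)..t, c s with hF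
  have hFd : ∀ t, HasDerivAt F (c t) t := fun t =>
    intervalIntegral.integral_hasDerivAt_right (hcc.intervalIntegrable 0 t)
      (hcc.stronglyMeasurableAtFilter _ _) hcc.continuousAt
  obtain ⟨h₀, hh₀, hFh⟩ : ∃ h₀, 0 < h₀ ∧ F h₀ ≠ 0 := by
    have h1 : Tendsto (slope F 0) (𝓝[>] 0) (𝓝 1) := by
      have := hasDerivAt_iff_tendsto_slope.1 (hFd 0)
      rw [hc0] at this
      exact this.mono_left (nhdsWithin_mono _ fun x hx => ne_of_gt hx)
    have h2 := (h1.eventually_ne one_ne_zero).and self_mem_nhdsWithin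
    obtain ⟨h₀, h3, h4⟩ := h2.exists
    refine ⟨h₀, h4, fun h5 => h3 ?_⟩
    rw [slope_def_module, h5]
    simp [hF]
  have hcF : ∀ t, 0 ≤ t → c t = (F (t + h₀) - F t) / F h₀ := by
    intro t ht
    rw [eq_div_iff hFh]
    have h1 : F (t + h₀) - F t = ∫ s in t..(t + h₀), c s :=
      intervalIntegral.integral_interval_sub_left (hcc.intervalIntegrable _ _)
        (hcc.intervalIntegrable _ _)
    have h2 : ∫ s in (0 : ℝ)..h₀, c (t + s) = ∫ s in t..(t + h₀), c s := by
      rw [intervalIntegral.integral_comp_add_left (fun s => c s) t, add_zero]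
    rw [h1, ← h2, hF]
    simp only
    rw [← intervalIntegral.integral_const_mul]
    refine intervalIntegral.integral_congr fun s hs => ?_
    rw [Set.uIcc_of_le hh₀.le] at hs
    exact (hcadd t s ht hs.1).symm
  have hder : HasDerivAt (fun t => (F (t + h₀) - F t) / F h₀) ((c h₀ - 1) / F h₀) 0 := by
    have h1 : HasDerivAt (fun t => F (t + h₀)) (c h₀) 0 := by
      have := (hFd (0 + h₀)).comp_add_const 0 h₀
      simpa using this
    have h2 := hFd 0
    rw [hc0] at h2
    exact (h1.sub h2).div_const _
  refine ⟨(c h₀ - 1) / F h₀, ?_⟩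
  have h1 := (hasDerivAt_iff_tendsto_slope.1 hder).mono_left
    (nhdsWithin_mono (0 : ℝ) fun x (hx : x ∈ Set.Ioi (0 : ℝ)) => ne_of_gt hx)
  refine (h1.smul_const f).congr' ?_
  filter_upwards [self_mem_nhdsWithin] with t ht
  rw [Set.mem_Ioi] at ht
  rw [← orbit_of_pos T f ht, hcT t ht.le, slope_def_module, ← hcF t ht.le, ← hcF 0 le_rfl, hc0,
    sub_zero]
  conv_rhs => rw [show c t • f - f = (c t - 1) • f by rw [sub_smul, one_smul]]
  rw [smul_smul, Complex.real_smul, Complex.ofReal_inv]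

end IsC0Semigroup

end Semigroup

/-! ### Eigenvalues of a compact semigroup and decay off a spectral projection -/

section SpectralGap

variable {H : Type*} [NormedAddCommGroup H] [NormedSpace ℂ H]

/-- A commuting family of operators leaving invariant a nonzero finite-dimensional subspace has
a common eigenvector in it. -/
theorem exists_common_eigenvector {ι : Type*} (A : ι → H →L[ℂ] H)
    (hA : ∀ i j, A i * A j = A j * A i) (W : Submodule ℂ H) [FiniteDimensional ℂ W]
    (hW : W ≠ ⊥) (hinv : ∀ i, ∀ f ∈ W, A i f ∈ W) :
    ∃ f ∈ W, f ≠ 0 ∧ ∀ i, ∃ c : ℂ, A i f = c • f := by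
  classical
  -- In a nonzero invariant subspace $V$ of least dimension every $A_i$ is scalar: its eigenspace
  -- inside $V$ is nonzero and, by commutation, invariant, hence all of $V$.
  let s : Set ℕ := {n | ∃ V : Submodule ℂ H, V ≤ W ∧ V ≠ ⊥ ∧ (∀ i, ∀ f ∈ V, A i f ∈ V) ∧
    Module.finrank ℂ V = n}
  have hs : s.Nonempty := ⟨_, W, le_rfl, hW, hinv, rfl⟩
  obtain ⟨V, hVW, hV, hVinv, hVn⟩ := Nat.sInf_mem hs
  have : FiniteDimensional ℂ V := Submodule.finiteDimensional_of_le hVW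
  have : Nontrivial V := Submodule.nontrivial_iff_ne_bot.2 hV
  obtain ⟨f, hfV, hf⟩ := Submodule.exists_mem_ne_zero_of_ne_bot hV
  refine ⟨f, hVW hfV, hf, fun i => ?_⟩
  let B : V →ₗ[ℂ] V := (A i : H →ₗ[ℂ] H).restrict (hVinv i)
  obtain ⟨c, hc⟩ := Module.End.exists_eigenvalue B
  obtain ⟨v, hv, hv0⟩ := hc.exists_hasEigenvector
  let V' : Submodule ℂ H := V ⊓ LinearMap.ker ((A i - c • ContinuousLinearMap.id ℂ H :
    H →L[ℂ] H) : H →ₗ[ℂ] H)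
  have hmem : ∀ g, g ∈ V' ↔ g ∈ V ∧ A i g = c • g := by
    intro g
    refine and_congr_right fun _ => ?_
    exact sub_eq_zero
  have hV' : V' ≠ ⊥ := by
    intro h
    rw [Module.End.mem_eigenspace_iff] at hv
    have h1 : (v : H) ∈ V' := (hmem _).2 ⟨v.2, congrArg Subtype.val hv⟩
    rw [h, Submodule.mem_bot] at h1
    exact hv0 (Subtype.ext h1)
  have hV'inv : ∀ j, ∀ g ∈ V', A j g ∈ V' := by
    intro j g hg
    rw [hmem] at hg ⊢
    refine ⟨hVinv j g hg.1, ?_⟩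
    have h1 := DFunLike.congr_fun (hA i j) g
    change A i (A j g) = A j (A i g) at h1
    rw [h1, hg.2, map_smul]
  have hle : Module.finrank ℂ V ≤ Module.finrank ℂ V' := by
    rw [hVn]
    exact Nat.sInf_le ⟨V', inf_le_left.trans hVW, hV', hV'inv, rfl⟩
  have heq : V' = V := Submodule.eq_of_le_of_finrank_le inf_le_left hle
  exact ⟨c, ((hmem f).1 (heq ▸ hfV)).2⟩

/-- On the eigenspace the identity equals $\mu^{-1}T$, a compact operator, which forces finite
dimension. -/
lemma finiteDimensional_nullSpace_one {T : H →L[ℂ] H} (hT : IsCompactOperator T) {μ : ℂ}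
    (hμ : μ ≠ 0) : FiniteDimensional ℂ (nullSpace T μ 1) := by
  have hinv : ∀ f ∈ nullSpace T μ 1, T f ∈ nullSpace T μ 1 := fun f hf =>
    map_mem_nullSpace rfl hf
  have h1 : IsCompactOperator ((T : H →ₗ[ℂ] H).restrict hinv) :=
    IsCompactOperator.restrict (f := (T : H →ₗ[ℂ] H)) hT hinv (isClosed_nullSpace T μ 1)
  have h2 := h1.smul μ⁻¹
  refine FiniteDimensional.of_isCompactOperator_id (𝕜 := ℂ) ?_
  have h4 : (id : nullSpace T μ 1 → nullSpace T μ 1) =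
      μ⁻¹ • ⇑((T : H →ₗ[ℂ] H).restrict hinv) := by
    funext f
    have h3 : T f = μ • (f : H) := mem_nullSpace_one.1 f.2
    refine Subtype.ext ?_
    change (f : H) = μ⁻¹ • T f
    rw [h3, inv_smul_smul₀ hμ]
  rw [h4]
  exact h2

namespace IsC0Semigroup

variable {T : ℝ → H →L[ℂ] H} {K : ℝ} (hT : IsC0Semigroup T K)
include hT

/-- The nonzero eigenvalues of `T_τ` are exponentials of eigenvalues of the generator. -/
theorem exists_generatorEigenvalue {τ : ℝ} (hτ : 0 < τ) (hc : IsCompactOperator (T τ)) {μ : ℂ}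
    (hμ : μ ≠ 0) {f : H} (hf : f ≠ 0) (hTf : T τ f = μ • f) :
    ∃ c : ℂ, IsGeneratorEigenvalue T c ∧ μ = Complex.exp (c * τ) := by
  have := finiteDimensional_nullSpace_one hc hμ
  have hW : nullSpace (T τ) μ 1 ≠ ⊥ := by
    intro h
    have h1 := mem_nullSpace_one.2 hTf
    rw [h, Submodule.mem_bot] at h1
    exact hf h1
  -- The eigenspace of $T_\tau$ is finite-dimensional and invariant under the whole commuting
  -- semigroup. A common eigenvector in it is an eigenvector of the generator, and evaluation at
  -- $\tau$ identifies $\mu$.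
  obtain ⟨g, hg, hg0, hgc⟩ := exists_common_eigenvector
    (fun t : Set.Ioi (0 : ℝ) => T t) (fun s t => hT.commute s.2 t.2) _ hW
    (fun t g hg => map_mem_nullSpace (hT.commute hτ t.2) hg)
  obtain ⟨c, hgen⟩ := hT.exists_generatorMaps_of_forall_eq_smul hg0 fun t ht => hgc ⟨t, ht⟩
  refine ⟨c, ⟨g, hg0, hgen⟩, ?_⟩
  have h1 := mem_nullSpace_one.1 hg
  rw [hT.apply_eq_exp_smul hgen hτ] at h1
  exact (smul_left_injective ℂ hg0 h1).symm

/-- Exponential decay of a compact semigroup on the kernel of a projection commuting with it. -/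
theorem exists_norm_mul_le [CompleteSpace H] {τ : ℝ} (hτ : 0 < τ)
    (hc : IsCompactOperator (T τ)) {P : H →L[ℂ] H} (hP : P * P = P)
    (hPT : ∀ t, 0 < t → T t * P = P * T t) {a : ℝ}
    (ha : ∀ (z : ℂ) (f : H), z ≠ 0 → f ≠ 0 → P f = 0 → T τ f = z • f →
      ‖z‖ < Real.exp (-a * τ)) :
    ∃ C, 0 < C ∧ ∀ t, 0 < t → ‖T t * (1 - P)‖ ≤ C * Real.exp (-a * t) := by
  rcases subsingleton_or_nontrivial H with hH | hH
  · refine ⟨1, one_pos, fun t _ => ?_⟩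
    rw [Subsingleton.elim (T t * (1 - P)) 0, norm_zero]
    positivity
  set Q : H →L[ℂ] H := 1 - P with hQ
  have hQQ : Q * Q = Q := by
    rw [hQ, mul_sub, sub_mul, sub_mul, hP]
    simp
  have hTQ : ∀ t, 0 < t → T t * Q = Q * T t := by
    intro t ht
    rw [hQ, mul_sub, sub_mul, hPT t ht, mul_one, one_mul]
  have hPQ : P * Q = 0 := by
    rw [hQ, mul_sub, hP, mul_one, sub_self]
  set R : H →L[ℂ] H := T τ * Q with hR
  have hRc : IsCompactOperator R := hc.comp_clm Q
  set r : ℝ≥0 := ⟨Real.exp (-a * τ), (Real.exp_pos _).le⟩ with hr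
  have hr0 : 0 < r := Real.exp_pos _
  -- A nonzero spectral value of the compact $R=T_\tau Q$ is an eigenvalue. Its eigenvectors lie in
  -- $\ker P$, where $R$ and $T_\tau$ agree, so the assumption on the eigenvalues applies.
  have hspec : spectralRadius ℂ R < r := by
    refine spectrum.spectralRadius_lt_of_forall_lt R fun z hz => ?_
    rcases eq_or_ne z 0 with rfl | hz0
    · simpa using hr0
    obtain ⟨f, hf, hf0⟩ := ((hRc.hasEigenvalue_iff_mem_spectrum hz0).2 hz).exists_hasEigenvector
    rw [Module.End.mem_eigenspace_iff] at hf
    have hRf : T τ (Q f) = z • f := hf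
    have hPf : P f = 0 := by
      have h1 : z • P f = 0 := by
        rw [← map_smul, ← hRf]
        have h2 := DFunLike.congr_fun (hPT τ hτ) (Q f)
        change T τ (P (Q f)) = P (T τ (Q f)) at h2
        have h3 : P (Q f) = 0 := DFunLike.congr_fun hPQ f
        rw [← h2, h3, map_zero]
      exact (smul_eq_zero.1 h1).resolve_left hz0
    have hQf : Q f = f := by
      rw [hQ]
      change f - P f = f
      rw [hPf, sub_zero]
    rw [hQf] at hRf
    exact ha z f hz0 hf0 hPf hRf
  -- Gelfand's formula; the finitely many remaining powers are then absorbed into $C_0$.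
  have hev : ∀ᶠ n : ℕ in atTop, ‖R ^ n‖ ≤ (r : ℝ) ^ n := by
    have h1 := (spectrum.pow_nnnorm_pow_one_div_tendsto_nhds_spectralRadius R).eventually_lt_const
      hspec
    filter_upwards [h1, eventually_gt_atTop 0] with n hn hn0
    have h2 := ENNReal.rpow_le_rpow hn.le (z := (n : ℝ)) (by positivity)
    rw [← ENNReal.rpow_mul, one_div, inv_mul_cancel₀ (by positivity), ENNReal.rpow_one,
      ENNReal.rpow_natCast] at h2
    exact_mod_cast h2
  obtain ⟨C₀, hC₀, hpow⟩ : ∃ C₀ : ℝ, 0 < C₀ ∧ ∀ n : ℕ, ‖R ^ n‖ ≤ C₀ * (r : ℝ) ^ n := by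
    obtain ⟨N, hN⟩ := eventually_atTop.1 hev
    have hrn : ∀ n, (0 : ℝ) < (r : ℝ) ^ n := fun n => pow_pos hr0 n
    refine ⟨1 + ∑ i ∈ Finset.range N, ‖R ^ i‖ / (r : ℝ) ^ i, ?_, fun n => ?_⟩
    · have : 0 ≤ ∑ i ∈ Finset.range N, ‖R ^ i‖ / (r : ℝ) ^ i :=
        Finset.sum_nonneg fun i _ => div_nonneg (norm_nonneg _) (hrn i).le
      linarith
    · have h0 : 0 ≤ ∑ i ∈ Finset.range N, ‖R ^ i‖ / (r : ℝ) ^ i :=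
        Finset.sum_nonneg fun i _ => div_nonneg (norm_nonneg _) (hrn i).le
      rcases le_or_gt N n with h | h
      · refine (hN n h).trans ?_
        exact le_mul_of_one_le_left (hrn n).le (by linarith)
      · rw [← div_le_iff₀ (hrn n)]
        have := Finset.single_le_sum (f := fun i => ‖R ^ i‖ / (r : ℝ) ^ i)
          (fun i _ => div_nonneg (norm_nonneg _) (hrn i).le) (Finset.mem_range.2 h)
        linarith
  have hsplit : ∀ s, 0 < s → ∀ n : ℕ, T (s + n * τ) * Q = T s * R ^ n * Q := by
    intro s hs n
    induction n with
    | zero => simp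
    | succ n ih =>
      have h1 : s + ((n + 1 : ℕ) : ℝ) * τ = (s + n * τ) + τ := by
        push_cast
        ring
      have hsn : 0 < s + n * τ := by positivity
      calc T (s + ((n + 1 : ℕ) : ℝ) * τ) * Q = T (s + n * τ) * (T τ * Q) * Q := by
            rw [h1, hT.add _ _ hsn hτ, mul_assoc, mul_assoc, mul_assoc, hQQ]
        _ = T (s + n * τ) * Q * R := by
            rw [mul_assoc (T (s + n * τ)), mul_assoc (T τ), hQQ, hR, mul_assoc, ← mul_assoc Q,
              ← hTQ τ hτ, mul_assoc, hQQ]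
        _ = T s * R ^ (n + 1) * Q := by
            rw [ih, pow_succ, mul_assoc, mul_assoc, mul_assoc, mul_assoc, hR, ← mul_assoc Q,
              ← hTQ τ hτ, mul_assoc, hQQ]
  -- The factors bound in turn $\|T_s\|$ for $s\le\tau$, the powers of $R$, the norm of $Q$ (with
  -- $1$ added for positivity), and the loss $e^{as}$ in replacing $e^{-an\tau}$ by
  -- $e^{-a(s+n\tau)}$.
  refine ⟨Real.exp (|K| * τ) * C₀ * (1 + ‖Q‖) * Real.exp (|a| * τ), by positivity,
    fun t ht => ?_⟩
  -- Taking $n=\lceil t/\tau\rceil-1$ keeps $s$ in $(0,\tau]$; $s=0$ must be avoided because the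
  -- semigroup axioms concern positive times only.
  obtain ⟨n, s, hs, hsτ, rfl⟩ : ∃ (n : ℕ) (s : ℝ), 0 < s ∧ s ≤ τ ∧ t = s + n * τ := by
    have hpos : 0 < ⌈t / τ⌉₊ := Nat.ceil_pos.2 (by positivity)
    have h1 := Nat.ceil_lt_add_one (a := t / τ) (by positivity)
    have h2 := Nat.le_ceil (t / τ)
    obtain ⟨n, hn⟩ := Nat.exists_eq_succ_of_ne_zero hpos.ne'
    rw [hn] at h1 h2
    push_cast at h1 h2
    refine ⟨n, t - n * τ, ?_, ?_, by ring⟩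
    · have : (n : ℝ) < t / τ := by linarith
      rw [lt_div_iff₀ hτ] at this
      linarith
    · rw [div_le_iff₀ hτ] at h2
      linarith
  rw [hsplit s hs n]
  have hTs : ‖T s‖ ≤ Real.exp (|K| * τ) := by
    refine (hT.bound s hs).trans (Real.exp_le_exp.2 ?_)
    exact mul_le_mul (le_abs_self K) hsτ hs.le (abs_nonneg K)
  have hrn : (r : ℝ) ^ n ≤ Real.exp (|a| * τ) * Real.exp (-a * (s + n * τ)) := by
    have e1 : (r : ℝ) ^ n = Real.exp (n * (-a * τ)) := (Real.exp_nat_mul _ _).symm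
    rw [e1, ← Real.exp_add, Real.exp_le_exp]
    have : a * s ≤ |a| * τ := mul_le_mul (le_abs_self a) hsτ hs.le (abs_nonneg a)
    nlinarith
  calc ‖T s * R ^ n * Q‖ ≤ ‖T s‖ * ‖R ^ n‖ * ‖Q‖ :=
        (norm_mul_le _ _).trans (mul_le_mul_of_nonneg_right (norm_mul_le _ _) (norm_nonneg _))
    _ ≤ Real.exp (|K| * τ) * (C₀ * (Real.exp (|a| * τ) * Real.exp (-a * (s + n * τ)))) *
        (1 + ‖Q‖) := by
        gcongr
        · exact (hpow n).trans (mul_le_mul_of_nonneg_left hrn hC₀.le)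
        · linarith
    _ = _ := by ring

end IsC0Semigroup

end SpectralGap

/-! ### Spectral projections from biorthogonal bases -/

section Projections

variable {H : Type*} [NormedAddCommGroup H] [InnerProductSpace ℂ H]

/-- The operator `f ↦ ∑ ⟨w_l, f⟩ e_l`. -/
noncomputable def pairingOp {ι : Type*} [Fintype ι] (w e : ι → H) : H →L[ℂ] H :=
  ∑ l, (innerSL ℂ (w l)).smulRight (e l)

lemma pairingOp_apply {ι : Type*} [Fintype ι] (w e : ι → H) (f : H) :
    pairingOp w e f = ∑ l, inner ℂ (w l) f • e l := by
  simp [pairingOp]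

lemma eq_sum_repr {V : Submodule ℂ H} {ι : Type*} [Fintype ι] (e : Module.Basis ι ℂ V) {f : H}
    (hf : f ∈ V) : f = ∑ l, (e.repr ⟨f, hf⟩) l • (e l : H) := by
  have h := congrArg V.subtype (e.sum_repr ⟨f, hf⟩)
  rw [map_sum] at h
  exact h.symm

lemma pairingOp_mem {V : Submodule ℂ H} {ι : Type*} [Fintype ι] (e : ι → V) (w : ι → H) (f : H) :
    pairingOp w (fun i => (e i : H)) f ∈ V := by
  rw [pairingOp_apply]
  exact Submodule.sum_mem _ fun l _ => Submodule.smul_mem _ _ (e l).2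

variable {ι : Type*} [Fintype ι] [DecidableEq ι]

/-- The matrix of the pairing between two bases. -/
noncomputable def pairingMatrix (e e' : ι → H) : Matrix ι ι ℂ :=
  Matrix.of fun j l => inner ℂ (e' l) (e j)

/-- The system in the span of `e'` biorthogonal to `e`. -/
noncomputable def dualSystem (e e' : ι → H) (l : ι) : H :=
  ∑ j, starRingEnd ℂ ((pairingMatrix e e')⁻¹ j l) • e' j

lemma inner_dualSystem (e e' : ι → H) (l : ι) (f : H) :
    inner ℂ (dualSystem e e' l) f =
      Matrix.vecMul (fun j => inner ℂ (e' j) f) (pairingMatrix e e')⁻¹ l := by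
  simp [dualSystem, Matrix.vecMul, dotProduct]

section Bases

variable [CompleteSpace H] {T : H →L[ℂ] H} {μ : ℂ} (hT : IsCompactOperator T) (hμ : μ ≠ 0)
  (e : Module.Basis ι ℂ (nullSpace T μ (nullIndex T μ)))
  (e' : Module.Basis ι ℂ (nullSpace (ContinuousLinearMap.adjoint T) (starRingEnd ℂ μ)
      (nullIndex T μ)))
include hT hμ

/-- A vector in the left kernel of the matrix yields a combination of the $e_j$ orthogonal to the
whole adjoint null space. Nondegeneracy of the pairing makes it zero, and independence kills the
coefficients. -/
lemma isUnit_det_pairingMatrix :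
    IsUnit (pairingMatrix (fun i => (e i : H)) (fun i => (e' i : H))).det := by
  rw [isUnit_iff_ne_zero]
  intro h
  obtain ⟨v, hv, hv0⟩ := Matrix.exists_vecMul_eq_zero_iff.2 h
  refine hv ?_
  have h1 : ((∑ j, v j • e j : nullSpace T μ (nullIndex T μ)) : H) = 0 := by
    refine eq_zero_of_inner_nullSpace_eq_zero hT hμ e e' (Subtype.coe_prop _) fun g hg => ?_
    have h2 : ∀ l, inner ℂ (e' l : H) (∑ j, v j • (e j : H)) = 0 := by
      intro l
      have := congrFun hv0 l
      simpa [Matrix.vecMul, dotProduct, pairingMatrix, inner_sum, inner_smul_right] using this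
    have h3 := eq_sum_repr e' hg
    rw [h3]
    simp only [sum_inner, inner_smul_left]
    refine Finset.sum_eq_zero fun l _ => ?_
    have h4 := h2 l
    simp only [AddSubmonoidClass.coe_finsetSum, SetLike.val_smul] at h4 ⊢
    rw [h4, mul_zero]
  have h5 : ∑ j, v j • e j = 0 := Subtype.ext h1
  exact funext fun j => Fintype.linearIndependent_iff.1 e.linearIndependent v h5 j

/-- The conjugates in `dualSystem` undo conjugate-linearity in the first slot, so the pairing is an
entry of $AA^{-1}$ for the pairing matrix $A$. -/
lemma inner_dualSystem_basis (l i : ι) :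
    inner ℂ (dualSystem (fun i => (e i : H)) (fun i => (e' i : H)) l) (e i : H) =
      if i = l then 1 else 0 := by
  have h := Matrix.mul_nonsing_inv _ (isUnit_det_pairingMatrix hT hμ e e')
  have h1 := congrFun (congrFun h i) l
  rw [Matrix.one_apply] at h1
  rw [inner_dualSystem, ← h1]
  rfl

/-- Invertibility of the pairing matrix means that the dual system spans the same space as $e'$. -/
lemma inner_eq_zero_of_inner_dualSystem {f : H}
    (hf : ∀ l, inner ℂ (dualSystem (fun i => (e i : H)) (fun i => (e' i : H)) l) f = 0)
    {g : H} (hg : g ∈ nullSpace (ContinuousLinearMap.adjoint T) (starRingEnd ℂ μ)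
      (nullIndex T μ)) : inner ℂ g f = 0 := by
  have h := Matrix.nonsing_inv_mul _ (isUnit_det_pairingMatrix hT hμ e e')
  have h1 : (fun j => inner ℂ (e' j : H) f) = 0 := by
    have h2 : Matrix.vecMul (fun j => inner ℂ (e' j : H) f)
        (pairingMatrix (fun i => (e i : H)) (fun i => (e' i : H)))⁻¹ = 0 := by
      funext l
      rw [← inner_dualSystem]
      exact hf l
    have h3 := congrArg (fun v => Matrix.vecMul v
      (pairingMatrix (fun i => (e i : H)) (fun i => (e' i : H)))) h2
    simpa [Matrix.vecMul_vecMul, h] using h3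
  have h3 := eq_sum_repr e' hg
  rw [h3]
  simp only [sum_inner, inner_smul_left]
  refine Finset.sum_eq_zero fun l _ => ?_
  rw [congrFun h1 l, Pi.zero_apply, mul_zero]

lemma pairingOp_dualSystem_of_mem {f : H} (hf : f ∈ nullSpace T μ (nullIndex T μ)) :
    pairingOp (dualSystem (fun i => (e i : H)) (fun i => (e' i : H))) (fun i => (e i : H)) f
      = f := by
  have h3 := eq_sum_repr e hf
  rw [pairingOp_apply]
  conv_rhs => rw [h3]
  refine Finset.sum_congr rfl fun l _ => ?_
  congr 1
  conv_lhs => rw [h3]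
  simp [inner_dualSystem_basis hT hμ e e']

/-- The spectral projection commutes with every operator commuting with `T`. -/
lemma pairingOp_dualSystem_comm {U : H →L[ℂ] H} (hU : T * U = U * T) :
    U * pairingOp (dualSystem (fun i => (e i : H)) (fun i => (e' i : H))) (fun i => (e i : H)) =
      pairingOp (dualSystem (fun i => (e i : H)) (fun i => (e' i : H))) (fun i => (e i : H)) *
        U := by
  set w := dualSystem (fun i => (e i : H)) (fun i => (e' i : H)) with hw
  set P := pairingOp w (fun i => (e i : H)) with hP
  ext1 f
  change U (P f) = P (U f)
  have h1 : P (U (P f)) = U (P f) :=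
    pairingOp_dualSystem_of_mem hT hμ e e' (map_mem_nullSpace hU (pairingOp_mem e w f))
  -- By biorthogonality $f-Pf$ is orthogonal to the adjoint null space. That space is invariant
  -- under $U^*$, so $U(f-Pf)$ is orthogonal to it too and is killed by $P$.
  have h2 : ∀ l, inner ℂ (w l) (f - P f) = 0 := by
    intro l
    rw [inner_sub_right, hP, pairingOp_apply, inner_sum]
    simp [hw, inner_smul_right, inner_dualSystem_basis hT hμ e e']
  have hwmem : ∀ l, w l ∈ nullSpace (ContinuousLinearMap.adjoint T) (starRingEnd ℂ μ)
      (nullIndex T μ) := fun l =>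
    Submodule.sum_mem _ fun j _ => Submodule.smul_mem _ _ (e' j).2
  have hU' : ContinuousLinearMap.adjoint T * ContinuousLinearMap.adjoint U =
      ContinuousLinearMap.adjoint U * ContinuousLinearMap.adjoint T := by
    simp only [← ContinuousLinearMap.star_eq_adjoint]
    rw [← star_mul, ← star_mul, hU]
  have h3 : P (U (f - P f)) = 0 := by
    rw [hP, pairingOp_apply]
    refine Finset.sum_eq_zero fun l _ => ?_
    rw [← ContinuousLinearMap.adjoint_inner_left,
      inner_eq_zero_of_inner_dualSystem hT hμ e e' h2 (map_mem_nullSpace hU' (hwmem l)), zero_smul]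
  rw [map_sub, map_sub, h1, sub_eq_zero] at h3
  exact h3.symm

end Bases

end Projections

/-! ### Exponentials of Jordan blocks -/

section Jordan

lemma jordanBlockExp_zero (d : ℕ) : jordanBlockExp 0 d = 1 := by
  ext i j
  rw [Matrix.one_apply]
  simp only [jordanBlockExp, Matrix.of_apply]
  rcases lt_trichotomy i j with h | h | h
  · have h' : (i : ℕ) < j := h
    rw [if_pos h.le, if_neg h.ne, Complex.ofReal_zero, zero_pow (by omega), zero_div]
  · subst h
    simp
  · rw [if_neg (not_le.2 h), if_neg h.ne']

lemma hasDerivAt_pow_div_factorial (n : ℕ) (t : ℝ) :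
    HasDerivAt (fun s : ℝ => (s : ℂ) ^ (n + 1) / ((n + 1).factorial : ℂ))
      ((t : ℂ) ^ n / (n.factorial : ℂ)) t := by
  have h1 := ((hasDerivAt_pow (n + 1) (t : ℂ)).comp_ofReal).div_const ((n + 1).factorial : ℂ)
  refine h1.congr_deriv ?_
  have : (n.factorial : ℂ) ≠ 0 := by exact_mod_cast n.factorial_ne_zero
  have h2 : ((n : ℂ) + 1) ≠ 0 := by exact_mod_cast n.succ_ne_zero
  rw [Nat.factorial_succ]
  push_cast
  field_simp

/-- This is $M'=MB$ for $M=e^{-\lambda t}J(t)$: the exponential produces the diagonal of the Jordan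
block, and right multiplication by its nilpotent part shifts the columns of $J$, which matches
differentiation of $t^r/r!$. -/
lemma hasDerivAt_jordanBlockExp (lam : ℂ) (d : ℕ) (i j : Fin d) (t : ℝ) :
    HasDerivAt (fun s : ℝ => Complex.exp (-lam * s) * jordanBlockExp s d i j)
      (∑ l, Complex.exp (-lam * t) * jordanBlockExp t d i l * jordanBlock lam d l j) t := by
  have hexp : HasDerivAt (fun s : ℝ => Complex.exp (-lam * s))
      (Complex.exp (-lam * t) * (-lam)) t := by
    have h1 : HasDerivAt (fun s : ℝ => -lam * (s : ℂ)) (-lam) t := by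
      simpa using (Complex.ofRealCLM.hasDerivAt (x := t)).const_mul (-lam)
    exact h1.cexp
  have hE : HasDerivAt (fun s : ℝ => jordanBlockExp s d i j)
      (∑ l, jordanBlockExp t d i l * (if (l : ℕ) + 1 = j then 1 else 0)) t := by
    rcases lt_or_ge i j with h | h
    · have h' : (i : ℕ) < j := h
      obtain ⟨n, hn⟩ : ∃ n, (j : ℕ) = i + (n + 1) := ⟨j - i - 1, by omega⟩
      have hl : (j : ℕ) - 1 < d := by omega
      -- Above the diagonal $j>i\ge0$, so column $j-1$ exists and is the only one the nilpotent part
      -- sends to column $j$.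
      rw [Finset.sum_eq_single (⟨(j : ℕ) - 1, hl⟩ : Fin d)]
      · have e1 : (if ((⟨(j : ℕ) - 1, hl⟩ : Fin d) : ℕ) + 1 = j then (1 : ℂ) else 0) = 1 :=
          if_pos (by simp; omega)
        rw [e1, mul_one]
        have e2 : jordanBlockExp t d i ⟨(j : ℕ) - 1, hl⟩ = (t : ℂ) ^ n / (n.factorial : ℂ) := by
          have hle : i ≤ (⟨(j : ℕ) - 1, hl⟩ : Fin d) := by
            rw [Fin.le_def]
            simp only
            omega
          have hn2 : (j : ℕ) - 1 - i = n := by omega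
          simp only [jordanBlockExp, Matrix.of_apply, if_pos hle, hn2]
        have e3 : (fun s : ℝ => jordanBlockExp s d i j) =
            fun s : ℝ => (s : ℂ) ^ (n + 1) / ((n + 1).factorial : ℂ) := by
          funext s
          have hn2 : (j : ℕ) - i = n + 1 := by omega
          simp only [jordanBlockExp, Matrix.of_apply, if_pos h.le, hn2]
        rw [e2, e3]
        exact hasDerivAt_pow_div_factorial n t
      · intro l _ hl'
        rw [if_neg, mul_zero]
        intro hl2
        exact hl' (Fin.ext (by simp; omega))
      · simp
    · have e3 : (fun s : ℝ => jordanBlockExp s d i j) = fun _ => if i = j then 1 else 0 := by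
        funext s
        simp only [jordanBlockExp, Matrix.of_apply]
        rcases h.eq_or_lt with h | h
        · subst h
          simp
        · rw [if_neg (not_le.2 h), if_neg h.ne']
      -- On and below the diagonal the entry is constant, and the shifted column $j-1$ lies strictly
      -- below the diagonal in row $i$.
      have e4 : ∑ l, jordanBlockExp t d i l * (if (l : ℕ) + 1 = j then 1 else 0) = 0 := by
        refine Finset.sum_eq_zero fun l _ => ?_
        split_ifs with hl
        · have h' : (j : ℕ) ≤ i := h
          have : ¬ i ≤ l := by
            rw [Fin.le_def]
            omega
          simp [jordanBlockExp, this]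
        · rw [mul_zero]
      rw [e3, e4]
      exact hasDerivAt_const _ _
  have hJ : ∀ l, jordanBlock lam d l j =
      (if l = j then -lam else 0) + (if (l : ℕ) + 1 = j then 1 else 0) := by
    intro l
    simp only [jordanBlock, Matrix.of_apply]
    split_ifs with h1 h2
    · subst h1
      omega
    · simp
    · simp
    · simp
  refine (hexp.mul hE).congr_deriv ?_
  simp only [hJ, mul_add, Finset.sum_add_distrib]
  congr 1
  · simp [mul_comm, mul_left_comm]
  · rw [Finset.mul_sum]
    exact Finset.sum_congr rfl fun l _ => by ring

lemma hasDerivAt_blockDiagonal_jordanBlockExp {r : ℕ} (lam : ℂ) (d : Fin r → ℕ)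
    (i j : Σ b : Fin r, Fin (d b)) (t : ℝ) :
    HasDerivAt (fun s : ℝ => (Complex.exp (-lam * s) •
        Matrix.blockDiagonal' fun b => jordanBlockExp s (d b)) i j)
      (((Complex.exp (-lam * t) • Matrix.blockDiagonal' fun b => jordanBlockExp t (d b)) *
        Matrix.blockDiagonal' fun b => jordanBlock lam (d b)) i j) t := by
  rw [Matrix.smul_mul, ← Matrix.blockDiagonal'_mul]
  simp only [Matrix.smul_apply, smul_eq_mul]
  obtain ⟨b, i⟩ := i
  obtain ⟨b', j⟩ := j
  rcases eq_or_ne b b' with rfl | hb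
  · simp only [Matrix.blockDiagonal'_apply_eq, Matrix.mul_apply, Finset.mul_sum]
    refine (hasDerivAt_jordanBlockExp lam (d b) i j t).congr_deriv ?_
    exact Finset.sum_congr rfl fun l _ => by ring
  · simp only [Matrix.blockDiagonal'_apply_ne _ _ _ hb, mul_zero]
    exact hasDerivAt_const _ _

end Jordan

/-! ### The spectral projections of the mean semigroup and the decay of the remainder -/

section SpectralDecomposition

variable {E : Type*} [TopologicalSpace E] [MeasurableSpace E] {m : Measure E}
  {T : ℝ → L2 m →L[ℂ] L2 m} (S : SpectralData m T)

lemma exp_neg_conj_mul (c : ℂ) (t : ℝ) :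
    Complex.exp (-(starRingEnd ℂ c) * t) = starRingEnd ℂ (Complex.exp (-c * t)) := by
  rw [← Complex.exp_conj]
  simp

/-- The spectral projection onto `𝒩_k`, with its properties. -/
structure IsSpectralProjection (k : ℕ) (P : L2 m →L[ℂ] L2 m) : Prop where
  mem : ∀ f, P f ∈ nullSpace (T S.tstar) (Complex.exp (-S.lam k * S.tstar))
    (nullIndex (T S.tstar) (Complex.exp (-S.lam k * S.tstar)))
  self : ∀ f ∈ nullSpace (T S.tstar) (Complex.exp (-S.lam k * S.tstar))
    (nullIndex (T S.tstar) (Complex.exp (-S.lam k * S.tstar))), P f = f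
  comm : ∀ U, T S.tstar * U = U * T S.tstar → U * P = P * U
  other : ∀ j : ℕ, 1 ≤ j → (j : ℕ∞) ≤ S.N → j ≠ k →
    ∀ f ∈ nullSpace (T S.tstar) (Complex.exp (-S.lam j * S.tstar))
      (nullIndex (T S.tstar) (Complex.exp (-S.lam j * S.tstar))), P f = 0
  apply_semigroup : ∀ t, 0 < t → ∀ f, T t (P f) =ᵐ[m] fun x =>
    Complex.exp (-S.lam k * t) * ((fun i => S.φ k i x) ⬝ᵥ (S.D k t).mulVec
      (fun l => ∫ y, starRingEnd ℂ (S.ψ k l y) * f y ∂m))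
  memLp_φ : ∀ i, MemLp (S.φ k i) 2 m
  memLp_ψ : ∀ i, MemLp (S.ψ k i) 2 m

/-- The projection is $f\mapsto\sum_l\langle f,\psi_l\rangle_m\,\phi_l$. The matrix $\widetilde A_k$
is the pairing matrix of the chosen bases, so $\Psi_k$ is exactly the biorthogonal system. The
Jordan form of the generator turns into $e^{-\lambda_kt}D_k(t)$ by ODE uniqueness. -/
theorem exists_isSpectralProjection {K : ℝ} (hT : IsC0Semigroup T K)
    (hc : ∀ t, 0 < t → IsCompactOperator (T t)) {k : ℕ} (hk : 1 ≤ k) (hkN : (k : ℕ∞) ≤ S.N) :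
    ∃ P, IsSpectralProjection S k P := by
  classical
  set μ := Complex.exp (-S.lam k * S.tstar) with hμ
  have hμ0 : μ ≠ 0 := Complex.exp_ne_zero _
  have hcs := hc _ S.tstar_pos
  obtain ⟨e, heφ, hegen⟩ := S.φ_jordan k hk hkN
  obtain ⟨e', heψ⟩ : ∃ e' : Module.Basis (Σ i : Fin (S.r k), Fin (S.d k i)) ℂ
        (nullSpace (ContinuousLinearMap.adjoint (T S.tstar)) (starRingEnd ℂ μ)
          (nullIndex (T S.tstar) μ)), ∀ i, ((e' i : L2 m) : E → ℂ) =ᵐ[m] S.ψhat k i := by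
    have h := S.ψhat_basis k hk hkN
    rw [exp_neg_conj_mul] at h
    exact h
  set w := dualSystem (fun i => (e i : L2 m)) (fun i => (e' i : L2 m)) with hw
  have hA : S.Atilde k = pairingMatrix (fun i => (e i : L2 m)) (fun i => (e' i : L2 m)) := by
    ext j l
    simp only [SpectralData.Atilde, pairingMatrix, Matrix.of_apply]
    rw [L2.inner_def]
    refine integral_congr_ae ?_
    filter_upwards [heφ j, heψ l] with x h1 h2
    rw [h1, h2]
    rfl
  have hwψ : ∀ l, (w l : E → ℂ) =ᵐ[m] S.ψ k l := by
    intro l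
    have h1 : (w l : E → ℂ) =ᵐ[m] ∑ j,
        ⇑(starRingEnd ℂ ((S.Atilde k)⁻¹ j l) • (e' j : L2 m)) := by
      rw [hw, hA]
      exact Lp.coeFn_finsetSum _ _
    have h2 : ∀ᵐ x ∂m, ∀ j, (starRingEnd ℂ ((S.Atilde k)⁻¹ j l) • (e' j : L2 m) : L2 m) x =
        S.ψhat k j x * starRingEnd ℂ ((S.Atilde k)⁻¹ j l) := by
      rw [ae_all_iff]
      intro j
      filter_upwards [Lp.coeFn_smul (starRingEnd ℂ ((S.Atilde k)⁻¹ j l)) (e' j : L2 m), heψ j]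
        with x h3 h4
      rw [h3, Pi.smul_apply, h4, smul_eq_mul, mul_comm]
    filter_upwards [h1, h2] with x h3 h4
    rw [h3, Finset.sum_apply]
    exact Finset.sum_congr rfl fun j _ => h4 j
  refine ⟨pairingOp w (fun i => (e i : L2 m)), ⟨fun f => pairingOp_mem e w f,
    fun f hf => pairingOp_dualSystem_of_mem hcs hμ0 e e' hf,
    fun U hU => pairingOp_dualSystem_comm hcs hμ0 e e' hU, ?_, ?_, ?_, ?_⟩⟩
  · intro j hj hjN hjk f hf
    obtain ⟨ej, -⟩ := S.φ_jordan j hj hjN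
    have : FiniteDimensional ℂ (nullSpace (T S.tstar) (Complex.exp (-S.lam j * S.tstar))
      (nullIndex (T S.tstar) (Complex.exp (-S.lam j * S.tstar)))) :=
      ej.finiteDimensional_of_finite
    rw [pairingOp_apply]
    refine Finset.sum_eq_zero fun l _ => ?_
    have hwl : w l ∈ nullSpace (ContinuousLinearMap.adjoint (T S.tstar)) (starRingEnd ℂ μ)
        (nullIndex (T S.tstar) μ) :=
      Submodule.sum_mem _ fun j _ => Submodule.smul_mem _ _ (e' j).2
    -- Distinctness of the numbers $e^{-\lambda_jt^*}$ enters here: it makes different generalised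
    -- eigenspaces biorthogonal.
    rw [inner_nullSpace_eq_zero_of_ne (S.exp_distinct j k hj hjN hk hkN hjk) hf hwl, zero_smul]
  · intro t ht f
    have h1 : ∀ l, T t (e l : L2 m) = ∑ i, (Complex.exp (-S.lam k * t) • S.D k t) i l •
        (e i : L2 m) := fun l =>
      hT.apply_eq_sum hegen
        (M := fun s => Complex.exp (-S.lam k * s) • S.D k s)
        (fun i j s => hasDerivAt_blockDiagonal_jordanBlockExp (S.lam k) (S.d k) i j s)
        (by
          simp only [SpectralData.D, jordanBlockExp_zero]
          have : (Matrix.blockDiagonal' fun b => (1 : Matrix (Fin (S.d k b)) (Fin (S.d k b)) ℂ))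
            = 1 := Matrix.blockDiagonal'_one
          rw [this]
          simp) ht l
    have h2 : T t (pairingOp w (fun i => (e i : L2 m)) f) =
        ∑ i, (Complex.exp (-S.lam k * t) * ((S.D k t).mulVec fun l => inner ℂ (w l) f) i) •
          (e i : L2 m) := by
      rw [pairingOp_apply, map_sum]
      simp only [map_smul, h1, Finset.smul_sum, Matrix.mulVec, dotProduct, Finset.mul_sum,
        Finset.sum_smul, smul_smul, Matrix.smul_apply, smul_eq_mul]
      rw [Finset.sum_comm]
      refine Finset.sum_congr rfl fun i _ => Finset.sum_congr rfl fun l _ => ?_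
      congr 1
      ring
    have h3 : ∀ l, inner ℂ (w l) f = ∫ y, starRingEnd ℂ (S.ψ k l y) * f y ∂m := by
      intro l
      rw [L2.inner_def]
      refine integral_congr_ae ?_
      filter_upwards [hwψ l] with y hy
      rw [hy, mul_comm]
      rfl
    simp only [← h3]
    set c : (Σ i : Fin (S.r k), Fin (S.d k i)) → ℂ := fun i =>
      Complex.exp (-S.lam k * t) * ((S.D k t).mulVec fun l => inner ℂ (w l) f) i with hcdef
    rw [h2]
    have h4 : ((∑ i, c i • (e i : L2 m) : L2 m) : E → ℂ) =ᵐ[m] ∑ i, ⇑(c i • (e i : L2 m)) :=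
      Lp.coeFn_finsetSum _ _
    have h5 : ∀ᵐ x ∂m, ∀ i, (c i • (e i : L2 m) : L2 m) x = c i * S.φ k i x := by
      rw [ae_all_iff]
      intro i
      filter_upwards [Lp.coeFn_smul (c i) (e i : L2 m), heφ i] with x h6 h7
      rw [h6, Pi.smul_apply, h7, smul_eq_mul]
    filter_upwards [h4, h5] with x h6 h7
    rw [h6, Finset.sum_apply, dotProduct, Finset.mul_sum]
    refine Finset.sum_congr rfl fun i _ => ?_
    rw [h7 i, hcdef]
    ring
  · exact fun i => (Lp.memLp (e i : L2 m)).ae_eq (heφ i)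
  · exact fun i => (Lp.memLp (w i)).ae_eq (hwψ i)

/-- Spectral decomposition of a compact semigroup on `L²`: the part of the semigroup beyond the
first `k` eigenvalues of the generator decays like `e^{-at}` for every `a < Re_{k+1}`. -/
theorem exists_spectral_decomposition {K : ℝ} (hT : IsC0Semigroup T K)
    (hc : ∀ t, 0 < t → IsCompactOperator (T t)) {k : ℕ} (hkN : (k : ℕ∞) ≤ S.N)
    {a : ℝ} (ha : (a : EReal) < S.reIndex (k + 1)) :
    ∃ P : L2 m →L[ℂ] L2 m, (∀ t, 0 < t → T t * P = P * T t) ∧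
      (∃ C, 0 < C ∧ ∀ t, 0 < t → ‖T t * (1 - P)‖ ≤ C * Real.exp (-a * t)) ∧
      (∀ t, 0 < t → ∀ f, T t (P f) =ᵐ[m] fun x => ∑ j ∈ Finset.Icc 1 k,
        Complex.exp (-S.lam j * t) * ((fun i => S.φ j i x) ⬝ᵥ (S.D j t).mulVec
          (fun l => ∫ y, starRingEnd ℂ (S.ψ j l y) * f y ∂m))) ∧
      ∀ j ∈ Finset.Icc 1 k, (∀ i, MemLp (S.φ j i) 2 m) ∧ ∀ i, MemLp (S.ψ j i) 2 m := by
  have hjN : ∀ j ∈ Finset.Icc 1 k, (j : ℕ∞) ≤ S.N := fun j hj =>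
    le_trans (by exact_mod_cast (Finset.mem_Icc.1 hj).2) hkN
  have hex : ∀ j, ∃ P, j ∈ Finset.Icc 1 k → IsSpectralProjection S j P := by
    intro j
    by_cases hj : j ∈ Finset.Icc 1 k
    · obtain ⟨P, hP⟩ := exists_isSpectralProjection S hT hc (Finset.mem_Icc.1 hj).1 (hjN j hj)
      exact ⟨P, fun _ => hP⟩
    · exact ⟨0, fun h => absurd h hj⟩
  choose P hP using hex
  set Q := ∑ j ∈ Finset.Icc 1 k, P j with hQ
  have hQapp : ∀ f, Q f = ∑ j ∈ Finset.Icc 1 k, P j f := by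
    intro f
    simp [hQ]
  have hQself : ∀ j ∈ Finset.Icc 1 k, ∀ f ∈ nullSpace (T S.tstar)
      (Complex.exp (-S.lam j * S.tstar))
      (nullIndex (T S.tstar) (Complex.exp (-S.lam j * S.tstar))), Q f = f := by
    intro j hj f hf
    rw [hQapp, Finset.sum_eq_single_of_mem j hj, (hP j hj).self f hf]
    intro i hi hij
    exact (hP i hi).other j (Finset.mem_Icc.1 hj).1 (hjN j hj) hij.symm f hf
  have hQQ : Q * Q = Q := by
    ext1 f
    change Q (Q f) = Q f
    conv_lhs => rw [hQapp f, map_sum]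
    rw [hQapp f]
    exact Finset.sum_congr rfl fun j hj => hQself j hj _ ((hP j hj).mem f)
  have hQT : ∀ t, 0 < t → T t * Q = Q * T t := by
    intro t ht
    rw [hQ, Finset.mul_sum, Finset.sum_mul]
    exact Finset.sum_congr rfl fun j hj => (hP j hj).comm _ (hT.commute S.tstar_pos ht)
  refine ⟨Q, hQT, ?_, ?_, fun j hj => ⟨(hP j hj).memLp_φ, (hP j hj).memLp_ψ⟩⟩
  · refine hT.exists_norm_mul_le S.tstar_pos (hc _ S.tstar_pos) hQQ hQT fun z f hz hf hQf hTf => ?_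
    obtain ⟨c, hcgen, rfl⟩ := hT.exists_generatorEigenvalue S.tstar_pos (hc _ S.tstar_pos) hz hf hTf
    obtain ⟨j, hj1, hjN', rfl⟩ := (S.eigenvalues c).1 hcgen
    -- If $j\le k$, then $Q$ would fix the eigenvector $f$, whereas $Qf=0$.
    have hkj : k + 1 ≤ j := by
      by_contra! hlt
      have hj : j ∈ Finset.Icc 1 k := Finset.mem_Icc.2 ⟨hj1, by omega⟩
      have h1 := hQself j hj f
        (mem_nullSpace_nullIndex_of_eigenvector (hc _ S.tstar_pos) hz hTf)
      rw [hQf] at h1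
      exact hf h1.symm
    -- The existence of such a $j$ puts $k+1$ in $\mathbb I$, so $\Re_{k+1}$ is finite. If $k$ is
    -- the last index, no eigenvector remains and every real $a$ is admissible.
    have hk1N : ((k + 1 : ℕ) : ℕ∞) ≤ S.N := le_trans (by exact_mod_cast hkj) hjN'
    have hre := S.re_mono (k + 1) j (by omega) hkj hjN'
    rw [SpectralData.reIndex, if_pos ⟨by omega, hk1N⟩, EReal.coe_lt_coe_iff] at ha
    rw [Complex.norm_exp, Real.exp_lt_exp]
    simp only [Complex.mul_re, Complex.neg_re, Complex.ofReal_re, Complex.ofReal_im, mul_zero,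
      sub_zero]
    exact mul_lt_mul_of_pos_right (by linarith) S.tstar_pos
  · intro t ht f
    rw [hQapp, map_sum]
    have h1 : ((∑ j ∈ Finset.Icc 1 k, T t (P j f) : L2 m) : E → ℂ) =ᵐ[m]
        ∑ j ∈ Finset.Icc 1 k, ⇑(T t (P j f)) := Lp.coeFn_finsetSum _ _
    have h2 : ∀ᵐ x ∂m, ∀ j ∈ Finset.Icc 1 k, T t (P j f) x =
        Complex.exp (-S.lam j * t) * ((fun i => S.φ j i x) ⬝ᵥ (S.D j t).mulVec
          (fun l => ∫ y, starRingEnd ℂ (S.ψ j l y) * f y ∂m)) := by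
      refine (Finset.eventually_all _).2 fun j hj => ?_
      exact (hP j hj).apply_semigroup t ht f
    filter_upwards [h1, h2] with x h3 h4
    rw [h3, Finset.sum_apply]
    exact Finset.sum_congr rfl h4

end SpectralDecomposition

/-! ### Topology and measurability of the state space -/

section StateSpace

variable {E : Type*} [TopologicalSpace E]

/-- A countable basis of $E$ together with the complements of a compact exhaustion, which form
neighbourhoods of $\partial$. It makes the compactification pseudometrizable, as needed for
pointwise limits of measurable maps into it to be measurable. -/
theorem secondCountableTopology_onePoint [T2Space E] [SecondCountableTopology E]
    [LocallyCompactSpace E] : SecondCountableTopology (OnePoint E) := by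
  let K : CompactExhaustion E := CompactExhaustion.choice E
  let s : Set (Set (OnePoint E)) :=
    ((fun U => ((↑) : E → OnePoint E) '' U) '' TopologicalSpace.countableBasis E) ∪
      Set.range fun n => (((↑) : E → OnePoint E) '' (K n))ᶜ
  have hs : s.Countable :=
    ((TopologicalSpace.countable_countableBasis E).image _).union (Set.countable_range _)
  have hbasis : TopologicalSpace.IsTopologicalBasis s := by
    refine TopologicalSpace.isTopologicalBasis_of_isOpen_of_nhds ?_ ?_
    · rintro u (⟨U, hU, rfl⟩ | ⟨n, rfl⟩)
      · exact OnePoint.isOpen_image_coe.2 (TopologicalSpace.isOpen_of_mem_countableBasis hU)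
      · exact OnePoint.isOpen_compl_image_coe.2 ⟨(K.isCompact n).isClosed, K.isCompact n⟩
    · intro z u hz hu
      induction z using OnePoint.rec with
      | infty =>
        obtain ⟨n, hn⟩ := K.exists_superset_of_isCompact
          ((OnePoint.isOpen_iff_of_mem hz).1 hu).2
        refine ⟨_, Or.inr ⟨n, rfl⟩, by simp, ?_⟩
        rw [Set.compl_subset_comm]
        intro w hw
        induction w using OnePoint.rec with
        | infty => exact absurd hz hw
        | coe x => exact Set.mem_image_of_mem _ (hn hw)
      | coe x =>
        obtain ⟨U, hU, hxU, hUu⟩ := (TopologicalSpace.isBasis_countableBasis E).exists_subset_of_mem_open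
          (show x ∈ ((↑) : E → OnePoint E) ⁻¹' u from hz) (hu.preimage OnePoint.continuous_coe)
        exact ⟨_, Or.inl ⟨U, hU, rfl⟩, Set.mem_image_of_mem _ hxU, Set.image_subset_iff.2 hUu⟩
  exact hbasis.secondCountableTopology hs

theorem pseudoMetrizableSpace_onePoint [T2Space E] [SecondCountableTopology E]
    [LocallyCompactSpace E] : TopologicalSpace.PseudoMetrizableSpace (OnePoint E) := by
  have := secondCountableTopology_onePoint (E := E)
  infer_instance

end StateSpace

section Measurability

/-- A right-continuous process is jointly measurable in the time and the sample point. -/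
theorem measurable_uncurry_min_of_rightCont {S Ω : Type*} [TopologicalSpace S]
    [TopologicalSpace.PseudoMetrizableSpace S] [MeasurableSpace S] [BorelSpace S]
    {𝓜 : MeasurableSpace Ω} {X : ℝ≥0 → Ω → S} {t : ℝ≥0} (hX : ∀ r ≤ t, Measurable (X r))
    (hr : ∀ ω r, ContinuousWithinAt (fun s => X s ω) (Set.Ici r) r) :
    Measurable fun z : ℝ≥0 × Ω => X (min z.1 t) z.2 := by
  -- Times are approximated from the right by the grid of mesh $1/(n+1)$, as right-continuity
  -- requires. Capping at $t$ keeps the approximants measurable relative to the process up to time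
  -- $t$.
  obtain ⟨d, hdef⟩ : ∃ d : ℕ → ℝ≥0 → ℝ≥0, ∀ n r,
    d n r = ((⌊((n : ℝ≥0) + 1) * r⌋₊ : ℝ≥0) + 1) / ((n : ℝ≥0) + 1) := ⟨_, fun _ _ => rfl⟩
  have hd : ∀ n r, r ≤ d n r := by
    intro n r
    rw [hdef, le_div_iff₀ (by positivity), mul_comm]
    exact (Nat.lt_floor_add_one _).le
  have hd' : ∀ n r, d n r ≤ r + 1 / ((n : ℝ≥0) + 1) := by
    intro n r
    have h1 : ((⌊((n : ℝ≥0) + 1) * r⌋₊ : ℝ≥0)) ≤ ((n : ℝ≥0) + 1) * r := Nat.floor_le zero_le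
    have h2 : ((n : ℝ≥0) + 1) ≠ 0 := by positivity
    rw [hdef, div_le_iff₀ (by positivity), add_mul r, one_div, inv_mul_cancel₀ h2, mul_comm r]
    gcongr
  have hlim : ∀ r, Tendsto (fun n => d n r) atTop (𝓝 r) := by
    intro r
    refine tendsto_of_tendsto_of_tendsto_of_le_of_le tendsto_const_nhds ?_ (fun n => hd n r)
      (fun n => hd' n r)
    have : Tendsto (fun n : ℕ => 1 / ((n : ℝ≥0) + 1)) atTop (𝓝 0) :=
      tendsto_one_div_add_atTop_nhds_zero_nat
    simpa using this.const_add r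
  refine measurable_of_tendsto_metrizable
    (f := fun n (z : ℝ≥0 × Ω) => X (min (d n z.1) t) z.2) (fun n => ?_) ?_
  · have h1 : Measurable fun z : ℕ × Ω => X (min (((z.1 : ℝ≥0) + 1) / ((n : ℝ≥0) + 1)) t) z.2 :=
      measurable_from_prod_countable_right fun j =>
        hX (min (((j : ℝ≥0) + 1) / ((n : ℝ≥0) + 1)) t) (min_le_right _ _)
    have h2 : Measurable fun z : ℝ≥0 × Ω => (⌊((n : ℝ≥0) + 1) * z.1⌋₊, z.2) :=
      (Nat.measurable_floor.comp (measurable_fst.const_mul _)).prodMk measurable_snd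
    have h3 := h1.comp h2
    simp only [hdef]
    exact h3
  · rw [tendsto_pi_nhds]
    intro z
    refine (hr z.2 (min z.1 t)).tendsto.comp ?_
    refine tendsto_nhdsWithin_iff.2 ⟨(hlim z.1).min tendsto_const_nhds, ?_⟩
    exact Eventually.of_forall fun n => min_le_min_right t (hd n z.1)

theorem measurable_uncurry_of_rightCont {S Ω : Type*} [TopologicalSpace S]
    [TopologicalSpace.PseudoMetrizableSpace S] [MeasurableSpace S] [BorelSpace S]
    {𝓜 : MeasurableSpace Ω} {X : ℝ≥0 → Ω → S} (hX : ∀ r, Measurable (X r))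
    (hr : ∀ ω r, ContinuousWithinAt (fun s => X s ω) (Set.Ici r) r) :
    Measurable fun z : ℝ≥0 × Ω => X z.1 z.2 := by
  refine measurable_of_tendsto_metrizable
    (f := fun (n : ℕ) (z : ℝ≥0 × Ω) => X (min z.1 n) z.2)
    (fun n => measurable_uncurry_min_of_rightCont (fun r _ => hX r) hr) ?_
  rw [tendsto_pi_nhds]
  intro z
  refine tendsto_const_nhds.congr' ?_
  obtain ⟨N, hN⟩ := exists_nat_ge z.1
  filter_upwards [eventually_ge_atTop N] with n hn
  rw [min_eq_left (hN.trans (by exact_mod_cast hn))]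

/-- Time integrals of functions of a right-continuous process up to `t` are measurable relative
to the process up to `t`. -/
theorem measurable_integral_of_rightCont {S Ω : Type*} [TopologicalSpace S]
    [TopologicalSpace.PseudoMetrizableSpace S] [MeasurableSpace S] [BorelSpace S]
    {𝓜 : MeasurableSpace Ω} {X : ℝ≥0 → Ω → S} {t : ℝ} (ht : 0 ≤ t)
    (hX : ∀ r ≤ t.toNNReal, Measurable (X r))
    (hr : ∀ ω r, ContinuousWithinAt (fun s => X s ω) (Set.Ici r) r) {g : S → ℝ}
    (hg : Measurable g) : Measurable fun ω => ∫ s in (0 : ℝ)..t, g (X s.toNNReal ω) := by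
  have h1 : Measurable fun z : ℝ × Ω => g (X (min z.1.toNNReal t.toNNReal) z.2) :=
    hg.comp ((measurable_uncurry_min_of_rightCont hX hr).comp
      ((measurable_real_toNNReal.comp measurable_fst).prodMk measurable_snd))
  have h2 : (fun ω => ∫ s in (0 : ℝ)..t, g (X s.toNNReal ω)) =
      fun ω => ∫ s in Set.Ioc 0 t, g (X (min s.toNNReal t.toNNReal) ω) := by
    funext ω
    rw [intervalIntegral.integral_of_le ht]
    refine setIntegral_congr_fun measurableSet_Ioc fun s hs => ?_
    rw [min_eq_left (Real.toNNReal_le_toNNReal hs.2)]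
  rw [h2]
  exact (h1.stronglyMeasurable.integral_prod_left'
    (μ := volume.restrict (Set.Ioc 0 t))).measurable

variable {E : Type*} [TopologicalSpace E] [MeasurableSpace E] [BorelSpace E]

lemma measurable_extend {V : Type*} [Zero V] [MeasurableSpace V] {f : E → V} (hf : Measurable f) :
    Measurable (extend f) := by
  have h : extend f = Function.extend ((↑) : E → OnePoint E) f fun _ => 0 := by
    funext z
    induction z using OnePoint.rec with
    | infty =>
      rw [Function.extend_apply' _ _ _ (by simp)]
      rfl
    | coe x =>
      rw [OnePoint.coe_injective.extend_apply]
      rfl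
  rw [h]
  exact OnePoint.isOpenEmbedding_coe.measurableEmbedding.measurable_extend hf measurable_const

end Measurability

/-! ### The Markov property for path functionals -/

lemma measurableSet_setOf_forall_mem {Ω S : Type*} [MeasurableSpace S] {𝓜 : MeasurableSpace Ω}
    {X : ℝ≥0 → Ω → S} {t : Finset ℝ≥0} (hX : ∀ r ∈ t, Measurable (X r)) {B : ℝ≥0 → Set S}
    (hB : ∀ r, MeasurableSet (B r)) : MeasurableSet {ω | ∀ r ∈ t, X r ω ∈ B r} := by
  have h : {ω | ∀ r ∈ t, X r ω ∈ B r} = ⋂ r ∈ t, X r ⁻¹' B r := by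
    ext ω
    simp
  rw [h]
  exact Finset.measurableSet_biInter t fun r hr => hX r hr (hB r)

namespace HuntProcess

variable {E : Type*} [TopologicalSpace E] {Ω : Type*} [mΩ : MeasurableSpace Ω]
  (ξ : HuntProcess E Ω)

lemma measurable_X (t : ℝ≥0) : Measurable (ξ.X t) := (ξ.adapted t).mono (ξ.ℱ.le t) le_rfl

lemma measurable_X_of_le {s t : ℝ≥0} (h : s ≤ t) : Measurable[ξ.ℱ t] (ξ.X s) :=
  (ξ.adapted s).mono (ξ.ℱ.mono h) le_rfl

/-- The strong Markov property at a constant stopping time. -/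
lemma measure_inter_preimage (x : OnePoint E) (v w : ℝ≥0) {A : Set Ω}
    (hA : MeasurableSet[ξ.ℱ v] A) {B : Set (OnePoint E)} (hB : MeasurableSet B) :
    ξ.P x (A ∩ ξ.X (v + w) ⁻¹' B) = ∫⁻ ω in A, ξ.P (ξ.X v ω) (ξ.X w ⁻¹' B) ∂(ξ.P x) := by
  have h := ξ.strongMarkov (fun _ => (v : WithTop ℝ≥0)) (isStoppingTime_const ξ.ℱ v) x w B A hB
    (by rwa [IsStoppingTime.measurableSpace_const])
  have e1 : (v : WithTop ℝ≥0) ≠ ⊤ := WithTop.coe_ne_top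
  have e2 : WithTop.untopD 0 (v : WithTop ℝ≥0) = v := rfl
  simp only [e1, e2, ne_eq, not_false_eq_true, true_and, and_true] at h
  exact h

/-- The simple Markov property for functions of one later position. -/
theorem lintegral_markov (x : OnePoint E) (v w : ℝ≥0) {A : Set Ω}
    (hA : MeasurableSet[ξ.ℱ v] A) {h : OnePoint E → ℝ≥0∞} (hh : Measurable h) :
    ∫⁻ ω in A, h (ξ.X (v + w) ω) ∂(ξ.P x) =
      ∫⁻ ω in A, ∫⁻ ω', h (ξ.X w ω') ∂(ξ.P (ξ.X v ω)) ∂(ξ.P x) := by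
  have hA' : MeasurableSet A := ξ.ℱ.le v A hA
  have hk : ∀ g : OnePoint E → ℝ≥0∞, Measurable g →
      Measurable fun ω => ∫⁻ ω', g (ξ.X w ω') ∂(ξ.P (ξ.X v ω)) := fun g hg =>
    ((hg.comp (ξ.measurable_X w)).lintegral_kernel (κ := ξ.P)).comp (ξ.measurable_X v)
  have hX : ∀ g : OnePoint E → ℝ≥0∞, Measurable g → ∀ u, Measurable fun ω => g (ξ.X u ω) :=
    fun g hg u => hg.comp (ξ.measurable_X u)
  refine Measurable.ennreal_induction ?_ ?_ ?_ hh
  · intro c B hB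
    have h1 : ∀ u ω, B.indicator (fun _ => c) (ξ.X u ω) = (ξ.X u ⁻¹' B).indicator (fun _ => c) ω :=
      fun u ω => rfl
    simp only [h1]
    rw [lintegral_indicator_const (ξ.measurable_X _ hB), Measure.restrict_apply
      (ξ.measurable_X _ hB), Set.inter_comm, ξ.measure_inter_preimage x v w hA hB]
    simp only [lintegral_indicator_const (ξ.measurable_X _ hB)]
    rw [lintegral_const_mul]
    exact (ξ.P.measurable_coe (ξ.measurable_X _ hB)).comp (ξ.measurable_X v)
  · intro f g _ hf hg ihf ihg
    simp only [Pi.add_apply]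
    rw [lintegral_add_left (hX f hf _), ihf, ihg,
      ← lintegral_add_left (hk f hf)]
    refine lintegral_congr fun ω => ?_
    rw [lintegral_add_left (hX f hf _)]
  · intro f hf hmono ih
    rw [lintegral_iSup (fun n => hX _ (hf n) _) fun i j hij ω => hmono hij _]
    have h1 : ∀ ω, ∫⁻ ω', ⨆ n, f n (ξ.X w ω') ∂(ξ.P (ξ.X v ω)) =
        ⨆ n, ∫⁻ ω', f n (ξ.X w ω') ∂(ξ.P (ξ.X v ω)) := fun ω =>
      lintegral_iSup (fun n => hX _ (hf n) _) fun i j hij ω => hmono hij _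
    simp only [h1]
    rw [lintegral_iSup (fun n => hk _ (hf n))
      fun i j hij ω => lintegral_mono fun ω' => hmono hij _]
    exact iSup_congr ih

/-- The cylinder event `{ξ_r ∈ B_r, r ∈ t}`. -/
def cylinder (t : Finset ℝ≥0) (B : ℝ≥0 → Set (OnePoint E)) : Set Ω :=
  {ω | ∀ r ∈ t, ξ.X r ω ∈ B r}

/-- Induction on the largest time constraint: conditioning at that time replaces the last event and
$h$ by one function $g$ of the position there, leaving a cylinder with fewer times. Starting point
and base time vary in the induction because both sides are reduced this way. -/
theorem lintegral_markov_cylinder {B : ℝ≥0 → Set (OnePoint E)} (hB : ∀ r, MeasurableSet (B r))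
    (t : Finset ℝ≥0) : ∀ (x : OnePoint E) (s u : ℝ≥0) {A : Set Ω}, MeasurableSet[ξ.ℱ s] A →
    (∀ r ∈ t, r ≤ u) → ∀ {h : OnePoint E → ℝ≥0∞}, Measurable h →
    ∫⁻ ω in A ∩ {ω | ∀ r ∈ t, ξ.X (s + r) ω ∈ B r}, h (ξ.X (s + u) ω) ∂(ξ.P x) =
      ∫⁻ ω in A, ∫⁻ ω' in ξ.cylinder t B, h (ξ.X u ω') ∂(ξ.P (ξ.X s ω)) ∂(ξ.P x) := by
  induction t using Finset.induction_on_max with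
  | empty =>
    intro x s u A hA _ h hh
    simp [cylinder, ξ.lintegral_markov x s u hA hh]
  | insert r' t hr' ih =>
    intro x s u A hA hu h hh
    have hru : r' ≤ u := hu r' (Finset.mem_insert_self _ _)
    set g : OnePoint E → ℝ≥0∞ := (B r').indicator fun z => ∫⁻ ω', h (ξ.X (u - r') ω') ∂(ξ.P z)
      with hg
    have hgm : Measurable g :=
      ((hh.comp (ξ.measurable_X (u - r'))).lintegral_kernel (κ := ξ.P)).indicator (hB r')
    have hstep : ∀ (x : OnePoint E) (v : ℝ≥0) (D : Set Ω), MeasurableSet[ξ.ℱ (v + r')] D →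
        ∫⁻ ω in D ∩ ξ.X (v + r') ⁻¹' B r', h (ξ.X (v + u) ω) ∂(ξ.P x) =
          ∫⁻ ω in D, g (ξ.X (v + r') ω) ∂(ξ.P x) := by
      intro x v D hD
      have h1 : v + u = (v + r') + (u - r') := by
        rw [add_assoc, add_tsub_cancel_of_le hru]
      have h2 : MeasurableSet[ξ.ℱ (v + r')] (ξ.X (v + r') ⁻¹' B r') := ξ.adapted _ (hB r')
      rw [h1, ξ.lintegral_markov x (v + r') (u - r') (MeasurableSet.inter hD h2) hh]
      have h3 : ∀ ω, g (ξ.X (v + r') ω) = (ξ.X (v + r') ⁻¹' B r').indicator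
          (fun ω => ∫⁻ ω', h (ξ.X (u - r') ω') ∂(ξ.P (ξ.X (v + r') ω))) ω := fun ω => rfl
      simp only [h3]
      rw [lintegral_indicator (ξ.measurable_X _ (hB r')), Measure.restrict_restrict
        (ξ.measurable_X _ (hB r')), Set.inter_comm]
    have hins : ∀ v, {ω | ∀ r ∈ insert r' t, ξ.X (v + r) ω ∈ B r} =
        {ω | ∀ r ∈ t, ξ.X (v + r) ω ∈ B r} ∩ ξ.X (v + r') ⁻¹' B r' := by
      intro v
      ext ω
      simp [and_comm]
    have hmeas : ∀ v, MeasurableSet[ξ.ℱ (v + r')] {ω | ∀ r ∈ t, ξ.X (v + r) ω ∈ B r} := fun v =>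
      measurableSet_setOf_forall_mem (X := fun r => ξ.X (v + r))
        (fun r hr => ξ.measurable_X_of_le (add_le_add_right (hr' r hr).le v)) hB
    rw [hins, ← Set.inter_assoc, hstep x s _ (MeasurableSet.inter
      (ξ.ℱ.mono (le_self_add : s ≤ s + r') A hA) (hmeas s)),
      ih x s r' hA (fun r hr => (hr' r hr).le) hgm]
    refine lintegral_congr fun ω => ?_
    -- The same reduction, now for the restarted process: base time $0$ and starting point $\xi_s$.
    have h4 := hstep (ξ.X s ω) 0 {ω | ∀ r ∈ t, ξ.X (0 + r) ω ∈ B r} (hmeas 0)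
    rw [← hins 0] at h4
    simp only [zero_add] at h4
    exact h4.symm

/-- The σ-algebra generated by the paths. -/
abbrev pathSigma : MeasurableSpace Ω := ⨆ r, MeasurableSpace.comap (ξ.X r) inferInstance

lemma measurable_X_pathSigma (r : ℝ≥0) : Measurable[ξ.pathSigma] (ξ.X r) :=
  Measurable.of_comap_le (le_iSup (fun r => MeasurableSpace.comap (ξ.X r) inferInstance) r)

lemma pathSigma_le : ξ.pathSigma ≤ mΩ := iSup_le fun r => (ξ.measurable_X r).comap_le

/-- The shift is known only through $\xi_r\circ\theta_s=\xi_{r+s}$, so its measurability is obtained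
on the $\sigma$-algebra of the paths. -/
lemma measurable_shift (s : ℝ≥0) : Measurable[mΩ, ξ.pathSigma] (ξ.shift s) := by
  rw [measurable_iff_comap_le, pathSigma, MeasurableSpace.comap_iSup]
  refine iSup_le fun r => ?_
  rw [MeasurableSpace.comap_comp]
  have h : ξ.X r ∘ ξ.shift s = ξ.X (r + s) := funext fun ω => ξ.X_shift r s ω
  rw [h]
  exact (ξ.measurable_X _).comap_le

/-- Dynkin's $\pi$-$\lambda$ argument: cylinders form a $\pi$-system generating the path
$\sigma$-algebra, and for them the formula is `lintegral_markov_cylinder` with $h=1$. -/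
lemma measure_inter_shift_preimage (x : OnePoint E) (s : ℝ≥0) {A : Set Ω}
    (hA : MeasurableSet[ξ.ℱ s] A) {G : Set Ω} (hG : MeasurableSet[ξ.pathSigma] G) :
    ξ.P x (A ∩ ξ.shift s ⁻¹' G) = ∫⁻ ω in A, ξ.P (ξ.X s ω) G ∂(ξ.P x) := by
  have := ξ.isMarkovKernel
  have hA' : MeasurableSet A := ξ.ℱ.le s A hA
  have hkm : ∀ G, MeasurableSet[ξ.pathSigma] G → Measurable fun ω => ξ.P (ξ.X s ω) G :=
    fun G hG => (ξ.P.measurable_coe (ξ.pathSigma_le G hG)).comp (ξ.measurable_X s)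
  have hgen : ξ.pathSigma = MeasurableSpace.generateFrom
      (piiUnionInter (fun r => {t | MeasurableSet[MeasurableSpace.comap (ξ.X r) inferInstance] t})
        Set.univ) := by
    rw [generateFrom_piiUnionInter_measurableSet fun r => MeasurableSpace.comap (ξ.X r) inferInstance]
    simp [pathSigma]
  induction G, hG using MeasurableSpace.induction_on_inter (m := ξ.pathSigma) hgen
    (isPiSystem_piiUnionInter _ (fun r => @MeasurableSpace.isPiSystem_measurableSet _
      (MeasurableSpace.comap (ξ.X r) inferInstance)) _) with
  | empty => simp
  | basic G hG =>
    obtain ⟨t, -, f, hf, rfl⟩ := hG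
    choose! B hB hBf using hf
    classical
    set B' : ℝ≥0 → Set (OnePoint E) := fun r => if r ∈ t then B r else Set.univ with hB'
    have hB'm : ∀ r, MeasurableSet (B' r) := by
      intro r
      simp only [hB']
      split_ifs with h
      · exact hB r h
      · exact MeasurableSet.univ
    have hB't : ∀ r ∈ t, B' r = B r := fun r hr => if_pos hr
    have h1 : (⋂ r ∈ t, f r) = ξ.cylinder t B' := by
      ext ω
      simp only [Set.mem_iInter, cylinder, Set.mem_ofPred_eq]
      refine forall₂_congr fun r hr => ?_
      rw [hB't r hr, ← hBf r hr]
      rfl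
    have h2 : ξ.shift s ⁻¹' ξ.cylinder t B' = {ω | ∀ r ∈ t, ξ.X (s + r) ω ∈ B' r} := by
      ext ω
      simp only [cylinder, Set.mem_preimage, Set.mem_ofPred_eq, ξ.X_shift, add_comm]
    have h3 := ξ.lintegral_markov_cylinder hB'm t x s (t.sup id) hA
      (fun r hr => Finset.le_sup (f := id) hr) (h := fun _ => 1) measurable_const
    rw [h1, h2]
    simpa using h3
  | compl G hG ih =>
    rw [Set.preimage_compl, ← Set.sdiff_eq, ← Set.sdiff_inter_self_eq_sdiff,
      measure_sdiff Set.inter_subset_right (((ξ.measurable_shift s hG).inter hA').nullMeasurableSet)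
      (measure_ne_top _ _), Set.inter_comm, ih]
    have h1 : ∀ ω, ξ.P (ξ.X s ω) Gᶜ = 1 - ξ.P (ξ.X s ω) G := fun ω =>
      prob_compl_eq_one_sub (ξ.pathSigma_le G hG)
    simp only [h1]
    rw [lintegral_sub (hkm G hG)]
    · simp
    · refine ((lintegral_mono fun ω => prob_le_one).trans_lt ?_).ne
      simp
    · exact ae_of_all _ fun ω => prob_le_one
  | iUnion f hd hf ih =>
    rw [Set.preimage_iUnion, Set.inter_iUnion, measure_iUnion]
    · simp only [ih]
      rw [← lintegral_tsum fun n => (hkm _ (hf n)).aemeasurable]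
      refine lintegral_congr fun ω => ?_
      rw [measure_iUnion hd fun n => ξ.pathSigma_le _ (hf n)]
    · intro i j hij
      exact ((hd hij).preimage _).mono Set.inter_subset_right Set.inter_subset_right
    · exact fun n => hA'.inter (ξ.measurable_shift s (hf n))

/-- The Markov property for functionals of the whole path. -/
theorem lintegral_mul_shift (x : OnePoint E) (s : ℝ≥0) {D F : Ω → ℝ≥0∞}
    (hD : Measurable[ξ.ℱ s] D) (hF : Measurable[ξ.pathSigma] F) :
    ∫⁻ ω, D ω * F (ξ.shift s ω) ∂(ξ.P x) = ∫⁻ ω, D ω * ∫⁻ ω', F ω' ∂(ξ.P (ξ.X s ω)) ∂(ξ.P x) := by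
  have hFs : ∀ G : Ω → ℝ≥0∞, Measurable[ξ.pathSigma] G → Measurable fun ω => G (ξ.shift s ω) :=
    fun G hG => @Measurable.comp _ _ _ _ ξ.pathSigma _ G (ξ.shift s) hG (ξ.measurable_shift s)
  have hFk : ∀ G : Ω → ℝ≥0∞, Measurable[ξ.pathSigma] G →
      Measurable fun ω => ∫⁻ ω', G ω' ∂(ξ.P (ξ.X s ω)) := fun G hG =>
    ((hG.mono ξ.pathSigma_le le_rfl).lintegral_kernel (κ := ξ.P)).comp (ξ.measurable_X s)
  have hDF : ∀ D : Ω → ℝ≥0∞, Measurable[ξ.ℱ s] D → ∀ G : Ω → ℝ≥0∞, Measurable G →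
      Measurable fun ω => D ω * G ω := fun D hD G hG => (hD.mono (ξ.ℱ.le s) le_rfl).mul hG
  -- Monotone class argument in $F$ with $D$ an indicator; a second one in $D$ follows.
  have key : ∀ A, MeasurableSet[ξ.ℱ s] A → ∫⁻ ω in A, F (ξ.shift s ω) ∂(ξ.P x) =
      ∫⁻ ω in A, ∫⁻ ω', F ω' ∂(ξ.P (ξ.X s ω)) ∂(ξ.P x) := by
    intro A hA
    have hA' : MeasurableSet A := ξ.ℱ.le s A hA
    refine Measurable.ennreal_induction (mα := ξ.pathSigma) ?_ ?_ ?_ hF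
    · intro c G hG
      have hG' := ξ.measurable_shift s hG
      have h1 : ∀ ω, G.indicator (fun _ => c) (ξ.shift s ω) =
        (ξ.shift s ⁻¹' G).indicator (fun _ => c) ω := fun ω => rfl
      simp only [h1]
      rw [lintegral_indicator_const hG', Measure.restrict_apply hG', Set.inter_comm,
        ξ.measure_inter_shift_preimage x s hA hG]
      simp only [lintegral_indicator_const (ξ.pathSigma_le G hG)]
      rw [lintegral_const_mul]
      exact (ξ.P.measurable_coe (ξ.pathSigma_le G hG)).comp (ξ.measurable_X s)
    · intro f g _ hf hg ihf ihg
      simp only [Pi.add_apply]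
      rw [lintegral_add_left (hFs f hf), ihf, ihg, ← lintegral_add_left (hFk f hf)]
      refine lintegral_congr fun ω => ?_
      rw [lintegral_add_left (hf.mono ξ.pathSigma_le le_rfl)]
    · intro f hf hmono ih
      rw [lintegral_iSup (fun n => hFs _ (hf n)) fun i j hij ω => hmono hij _]
      have h1 : ∀ ω, ∫⁻ ω', ⨆ n, f n ω' ∂(ξ.P (ξ.X s ω)) =
          ⨆ n, ∫⁻ ω', f n ω' ∂(ξ.P (ξ.X s ω)) := fun ω =>
        lintegral_iSup (fun n => (hf n).mono ξ.pathSigma_le le_rfl) hmono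
      simp only [h1]
      rw [lintegral_iSup (fun n => hFk _ (hf n)) fun i j hij ω => lintegral_mono (hmono hij)]
      exact iSup_congr ih
  refine Measurable.ennreal_induction (mα := ξ.ℱ s) ?_ ?_ ?_ hD
  · intro c A hA
    have hA' : MeasurableSet A := ξ.ℱ.le s A hA
    have h1 : ∀ (G : Ω → ℝ≥0∞) ω, A.indicator (fun _ => c) ω * G ω =
        A.indicator (fun ω => c * G ω) ω := by
      intro G ω
      by_cases h : ω ∈ A <;> simp [h]
    rw [lintegral_congr (h1 _), lintegral_congr (h1 _), lintegral_indicator hA',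
      lintegral_indicator hA', lintegral_const_mul _ (hFs F hF), lintegral_const_mul _ (hFk F hF),
      key A hA]
  · intro f g _ hf hg ihf ihg
    simp only [Pi.add_apply, add_mul]
    rw [lintegral_add_left (hDF f hf _ (hFs F hF)), ihf, ihg,
      ← lintegral_add_left (hDF f hf _ (hFk F hF))]
  · intro f hf hmono ih
    simp only [ENNReal.iSup_mul]
    rw [lintegral_iSup (fun n => hDF _ (hf n) _ (hFs F hF))
      fun i j hij ω => mul_le_mul_left (hmono hij ω) _,
      lintegral_iSup (fun n => hDF _ (hf n) _ (hFk F hF))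
      fun i j hij ω => mul_le_mul_left (hmono hij ω) _]
    exact iSup_congr ih

end HuntProcess

/-! ### The mean semigroup -/

namespace Branching

variable {E : Type*} [MeasurableSpace E] (𝔟 : Branching E)

lemma summable_mul_offspring (x : E) : Summable fun n : ℕ => (n : ℝ) * 𝔟.offspring n x := by
  obtain ⟨C, hC⟩ := 𝔟.secondMoment
  refine (hC x).1.of_nonneg_of_le (fun n => mul_nonneg n.cast_nonneg (𝔟.offspring_nonneg n x))
    fun n => mul_le_mul_of_nonneg_right ?_ (𝔟.offspring_nonneg n x)
  exact_mod_cast Nat.le_self_pow two_ne_zero n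

lemma measurable_α : Measurable 𝔟.α := by
  refine 𝔟.measurable_β.mul (Measurable.sub_const ?_ 1)
  refine measurable_of_tendsto_metrizable
    (f := fun (N : ℕ) x => ∑ n ∈ Finset.range N, (n : ℝ) * 𝔟.offspring n x) (fun N => ?_) ?_
  · exact Finset.measurable_fun_sum _ fun n _ => (𝔟.measurable_offspring n).const_mul _
  · rw [tendsto_pi_nhds]
    exact fun x => (𝔟.summable_mul_offspring x).hasSum.tendsto_sum_nat

lemma exists_abs_α_le : ∃ K, 0 ≤ K ∧ ∀ x, |𝔟.α x| ≤ K := by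
  obtain ⟨C, hC⟩ := 𝔟.secondMoment
  obtain ⟨B, hB⟩ := 𝔟.β_bounded
  refine ⟨|B| * (|C| + 1), by positivity, fun x => ?_⟩
  have h0 : 0 ≤ ∑' n : ℕ, (n : ℝ) * 𝔟.offspring n x :=
    tsum_nonneg fun n => mul_nonneg n.cast_nonneg (𝔟.offspring_nonneg n x)
  have h1 : ∑' n : ℕ, (n : ℝ) * 𝔟.offspring n x ≤ C := by
    refine ((𝔟.summable_mul_offspring x).tsum_le_tsum (fun n => ?_) (hC x).1).trans (hC x).2
    refine mul_le_mul_of_nonneg_right ?_ (𝔟.offspring_nonneg n x)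
    exact_mod_cast Nat.le_self_pow two_ne_zero n
  rw [α, abs_mul, abs_of_nonneg (𝔟.β_nonneg x)]
  refine mul_le_mul ((hB x).trans (le_abs_self B)) ?_ (abs_nonneg _) (abs_nonneg _)
  rw [abs_le]
  constructor <;> linarith [le_abs_self C, abs_nonneg C]

end Branching

lemma abs_extend_le {E : Type*} {f : E → ℝ} {K : ℝ} (hK : 0 ≤ K) (hf : ∀ x, |f x| ≤ K)
    (z : OnePoint E) : |extend f z| ≤ K := by
  induction z using OnePoint.rec with
  | infty => simpa [extend] using hK
  | coe x => exact hf x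

lemma extend_nonneg {E : Type*} {f : E → ℝ} (hf : ∀ x, 0 ≤ f x) (z : OnePoint E) :
    0 ≤ extend f z := by
  induction z using OnePoint.rec with
  | infty => simp [extend]
  | coe x => exact hf x

section MeanSemigroup

variable {E : Type*} [TopologicalSpace E] [MeasurableSpace E]
  {Ω : Type*} {𝓜 : MeasurableSpace Ω} [MeasurableSpace Ω]
  (ξ : HuntProcess E Ω) (𝔟 : Branching E)

/-- The additive functional `∫_0^t α(ξ_s) ds`. -/
noncomputable def additiveFunctional (t : ℝ) (ω : Ω) : ℝ :=
  ∫ s in (0 : ℝ)..t, extend 𝔟.α (ξ.X s.toNNReal ω)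

lemma abs_additiveFunctional_le {K : ℝ} (hK : 0 ≤ K) (hα : ∀ x, |𝔟.α x| ≤ K) {t : ℝ}
    (ht : 0 ≤ t) (ω : Ω) : |additiveFunctional ξ 𝔟 t ω| ≤ K * t := by
  have h := intervalIntegral.norm_integral_le_of_norm_le_const (a := 0) (b := t) (C := K)
    (f := fun s => extend 𝔟.α (ξ.X s.toNNReal ω)) fun s _ => abs_extend_le hK hα _
  rwa [sub_zero, abs_of_nonneg ht] at h

/-- The mean semigroup as a lower integral, for nonnegative functions. -/
noncomputable def meanLIntegral (t : ℝ) (f : E → ℝ) (z : OnePoint E) : ℝ≥0∞ :=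
  ∫⁻ ω, ENNReal.ofReal (Real.exp (additiveFunctional ξ 𝔟 t ω) * extend f (ξ.X t.toNNReal ω))
    ∂(ξ.P z)

variable {f : E → ℝ}

lemma meanLIntegral_infty {t : ℝ} : meanLIntegral ξ 𝔟 t f OnePoint.infty = 0 := by
  rw [meanLIntegral]
  refine (lintegral_congr_ae (g := fun _ => 0) ?_).trans lintegral_zero
  filter_upwards [ξ.normal OnePoint.infty] with ω hω
  rw [ξ.cemetery 0 t.toNNReal ω zero_le hω]
  simp [extend]

lemma meanLIntegral_le {K : ℝ} (hK : 0 ≤ K) (hα : ∀ x, |𝔟.α x| ≤ K) {t : ℝ} (ht : 0 ≤ t)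
    (hf0 : ∀ x, 0 ≤ f x) (z : OnePoint E) :
    meanLIntegral ξ 𝔟 t f z ≤ ENNReal.ofReal (Real.exp (K * t)) *
      ∫⁻ ω, ENNReal.ofReal (extend f (ξ.X t.toNNReal ω)) ∂(ξ.P z) := by
  rw [← lintegral_const_mul' _ _ ENNReal.ofReal_ne_top]
  refine lintegral_mono fun ω => ?_
  rw [← ENNReal.ofReal_mul (Real.exp_pos _).le]
  refine ENNReal.ofReal_le_ofReal (mul_le_mul_of_nonneg_right ?_ (extend_nonneg hf0 _))
  exact Real.exp_le_exp.2 ((le_abs_self _).trans (abs_additiveFunctional_le ξ 𝔟 hK hα ht ω))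

lemma le_meanLIntegral {K : ℝ} (hK : 0 ≤ K) (hα : ∀ x, |𝔟.α x| ≤ K) {t : ℝ} (ht : 0 ≤ t)
    (hf0 : ∀ x, 0 ≤ f x) (z : OnePoint E) :
    ENNReal.ofReal (Real.exp (-(K * t))) *
      ∫⁻ ω, ENNReal.ofReal (extend f (ξ.X t.toNNReal ω)) ∂(ξ.P z) ≤ meanLIntegral ξ 𝔟 t f z := by
  rw [← lintegral_const_mul' _ _ ENNReal.ofReal_ne_top]
  refine lintegral_mono fun ω => ?_
  rw [← ENNReal.ofReal_mul (Real.exp_pos _).le]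
  refine ENNReal.ofReal_le_ofReal (mul_le_mul_of_nonneg_right ?_ (extend_nonneg hf0 _))
  exact Real.exp_le_exp.2 (neg_le_of_abs_le (abs_additiveFunctional_le ξ 𝔟 hK hα ht ω))

lemma meanLIntegral_lt_top {t : ℝ} (ht : 0 ≤ t) (hf0 : ∀ x, 0 ≤ f x) {C : ℝ}
    (hfC : ∀ x, f x ≤ C) (z : OnePoint E) : meanLIntegral ξ 𝔟 t f z < ∞ := by
  obtain ⟨K, hK, hα⟩ := 𝔟.exists_abs_α_le
  have := ξ.isMarkovKernel
  refine (meanLIntegral_le ξ 𝔟 hK hα ht hf0 z).trans_lt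
    (ENNReal.mul_lt_top ENNReal.ofReal_lt_top ?_)
  have h1 : ∫⁻ ω, ENNReal.ofReal (extend f (ξ.X t.toNNReal ω)) ∂(ξ.P z) ≤
      ∫⁻ ω, ENNReal.ofReal |C| ∂(ξ.P z) := by
    refine lintegral_mono fun ω => ENNReal.ofReal_le_ofReal ?_
    refine (le_abs_self _).trans (abs_extend_le (abs_nonneg C) (fun x => ?_) _)
    rw [abs_of_nonneg (hf0 x)]
    exact (hfC x).trans (le_abs_self C)
  refine h1.trans_lt ?_
  simp

variable [BorelSpace E] [TopologicalSpace.PseudoMetrizableSpace (OnePoint E)]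

lemma measurable_additiveFunctional {t : ℝ} (ht : 0 ≤ t)
    (hX : ∀ r ≤ t.toNNReal, Measurable[𝓜] (ξ.X r)) :
    Measurable[𝓜] (additiveFunctional ξ 𝔟 t) :=
  measurable_integral_of_rightCont ht hX ξ.rightCont_paths (measurable_extend 𝔟.measurable_α)

/-- Additivity over $[0,s]$ and $[s,s+t]$, the second piece being a functional of the shifted path.
This is what turns the Markov property into a semigroup law for the weighted expectations. -/
lemma additiveFunctional_add {s t : ℝ} (hs : 0 ≤ s) (ht : 0 ≤ t) (ω : Ω) :
    additiveFunctional ξ 𝔟 (s + t) ω =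
      additiveFunctional ξ 𝔟 s ω + additiveFunctional ξ 𝔟 t (ξ.shift s.toNNReal ω) := by
  obtain ⟨K, hK, hα⟩ := 𝔟.exists_abs_α_le
  have hmeas : Measurable fun r : ℝ => extend 𝔟.α (ξ.X r.toNNReal ω) :=
    (measurable_extend 𝔟.measurable_α).comp
      ((measurable_uncurry_of_rightCont ξ.measurable_X ξ.rightCont_paths).comp
        (measurable_real_toNNReal.prodMk measurable_const))
  have hint : ∀ a b : ℝ, IntervalIntegrable (fun r => extend 𝔟.α (ξ.X r.toNNReal ω)) volume a b :=
    fun a b => (intervalIntegrable_const (c := K)).mono_fun hmeas.aestronglyMeasurable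
      (ae_of_all _ fun r => by
        change |extend 𝔟.α (ξ.X r.toNNReal ω)| ≤ |K|
        rw [abs_of_nonneg hK]
        exact abs_extend_le hK hα _)
  rw [additiveFunctional, ← intervalIntegral.integral_add_adjacent_intervals (hint 0 s)
    (hint s (s + t))]
  congr 1
  rw [additiveFunctional]
  have h := intervalIntegral.integral_comp_add_left (a := 0) (b := t)
    (fun r => extend 𝔟.α (ξ.X r.toNNReal ω)) s
  rw [add_zero] at h
  rw [← h]
  refine intervalIntegral.integral_congr fun r hr => ?_
  rw [Set.uIcc_of_le ht] at hr
  rw [ξ.X_shift, ← Real.toNNReal_add hr.1 hs, add_comm]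

lemma measurable_meanLIntegral_integrand {t : ℝ} (ht : 0 ≤ t)
    (hX : ∀ r ≤ t.toNNReal, Measurable[𝓜] (ξ.X r)) (hf : Measurable f) :
    Measurable[𝓜] fun ω =>
      Real.exp (additiveFunctional ξ 𝔟 t ω) * extend f (ξ.X t.toNNReal ω) :=
  (Real.measurable_exp.comp (measurable_additiveFunctional ξ 𝔟 ht hX)).mul
    ((measurable_extend hf).comp (hX _ le_rfl))

lemma measurable_meanLIntegral {t : ℝ} (ht : 0 ≤ t) (hf : Measurable f) :
    Measurable (meanLIntegral ξ 𝔟 t f) :=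
  (measurable_meanLIntegral_integrand ξ 𝔟 ht (fun r _ => ξ.measurable_X r)
    hf).ennreal_ofReal.lintegral_kernel

lemma meanSemigroup_eq_toReal {t : ℝ} (ht : 0 ≤ t) (hf : Measurable f) (hf0 : ∀ x, 0 ≤ f x)
    (x : E) : meanSemigroup ξ 𝔟 t f x = (meanLIntegral ξ 𝔟 t f x).toReal := by
  refine integral_eq_lintegral_of_nonneg_ae (ae_of_all _ fun ω => ?_) ?_
  · exact mul_nonneg (Real.exp_pos _).le (extend_nonneg hf0 _)
  · exact (measurable_meanLIntegral_integrand ξ 𝔟 ht (fun r _ => ξ.measurable_X r)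
      hf).aestronglyMeasurable

lemma ofReal_extend_meanSemigroup {t : ℝ} (ht : 0 ≤ t) (hf : Measurable f)
    (hf0 : ∀ x, 0 ≤ f x) {C : ℝ} (hfC : ∀ x, f x ≤ C) (z : OnePoint E) :
    ENNReal.ofReal (extend (meanSemigroup ξ 𝔟 t f) z) = meanLIntegral ξ 𝔟 t f z := by
  induction z using OnePoint.rec with
  | infty =>
    rw [meanLIntegral_infty]
    simp [extend]
  | coe x =>
    change ENNReal.ofReal (meanSemigroup ξ 𝔟 t f x) = _
    rw [meanSemigroup_eq_toReal ξ 𝔟 ht hf hf0,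
      ENNReal.ofReal_toReal (meanLIntegral_lt_top ξ 𝔟 ht hf0 hfC _).ne]

lemma measurable_meanSemigroup {t : ℝ} (ht : 0 ≤ t) (hf : Measurable f) (hf0 : ∀ x, 0 ≤ f x) :
    Measurable (meanSemigroup ξ 𝔟 t f) := by
  have h : meanSemigroup ξ 𝔟 t f = fun x : E => (meanLIntegral ξ 𝔟 t f x).toReal :=
    funext fun x => meanSemigroup_eq_toReal ξ 𝔟 ht hf hf0 x
  rw [h]
  exact ((measurable_meanLIntegral ξ 𝔟 ht hf).comp
    OnePoint.continuous_coe.measurable).ennreal_toReal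

/-- The semigroup property `T_{s+t} f = T_s (T_t f)`. -/
theorem meanSemigroup_add {s t : ℝ} (hs : 0 ≤ s) (ht : 0 ≤ t) (hf : Measurable f)
    (hf0 : ∀ x, 0 ≤ f x) {C : ℝ} (hfC : ∀ x, f x ≤ C) (x : E) :
    meanSemigroup ξ 𝔟 (s + t) f x = meanSemigroup ξ 𝔟 s (meanSemigroup ξ 𝔟 t f) x := by
  have hm := measurable_meanSemigroup ξ 𝔟 ht hf hf0
  have hm0 : ∀ x, 0 ≤ meanSemigroup ξ 𝔟 t f x := fun x => by
    rw [meanSemigroup_eq_toReal ξ 𝔟 ht hf hf0]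
    exact ENNReal.toReal_nonneg
  rw [meanSemigroup_eq_toReal ξ 𝔟 (by linarith) hf hf0, meanSemigroup_eq_toReal ξ 𝔟 hs hm hm0]
  congr 1
  -- The weight over $[0,s+t]$ splits into $D$, measurable at time $s$, and a path functional $F$ of
  -- the shifted trajectory.
  let D : Ω → ℝ≥0∞ := fun ω => ENNReal.ofReal (Real.exp (additiveFunctional ξ 𝔟 s ω))
  let F : Ω → ℝ≥0∞ := fun ω =>
    ENNReal.ofReal (Real.exp (additiveFunctional ξ 𝔟 t ω) * extend f (ξ.X t.toNNReal ω))
  have hD : Measurable[ξ.ℱ s.toNNReal] D :=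
    (Real.measurable_exp.comp (measurable_additiveFunctional ξ 𝔟 hs
      fun r hr => ξ.measurable_X_of_le hr)).ennreal_ofReal
  have hF : Measurable[ξ.pathSigma] F :=
    (measurable_meanLIntegral_integrand ξ 𝔟 ht (fun r _ => ξ.measurable_X_pathSigma r)
      hf).ennreal_ofReal
  have h1 : meanLIntegral ξ 𝔟 (s + t) f x =
      ∫⁻ ω, D ω * F (ξ.shift s.toNNReal ω) ∂(ξ.P x) := by
    refine lintegral_congr fun ω => ?_
    rw [← ENNReal.ofReal_mul (Real.exp_pos _).le, additiveFunctional_add ξ 𝔟 hs ht, Real.exp_add,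
      ξ.X_shift, Real.toNNReal_add hs ht, add_comm t.toNNReal, mul_assoc]
  rw [h1, ξ.lintegral_mul_shift x _ hD hF]
  refine lintegral_congr fun ω => ?_
  rw [ENNReal.ofReal_mul (Real.exp_pos _).le, ofReal_extend_meanSemigroup ξ 𝔟 ht hf hf0 hfC]
  rfl

end MeanSemigroup

/-! ### Hilbert–Schmidt and Schur bounds for integral operators -/

section HilbertSchmidt

/-- An operator on a Hilbert space which is square summable along a Hilbert basis is compact. -/
theorem isCompactOperator_of_sum_norm_sq_le {H ι : Type*} [NormedAddCommGroup H]
    [InnerProductSpace ℂ H] [CompleteSpace H] (b : HilbertBasis ι ℂ H) (T : H →L[ℂ] H) {C : ℝ}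
    (hC : ∀ F : Finset ι, ∑ i ∈ F, ‖T (b i)‖ ^ 2 ≤ C) : IsCompactOperator T := by
  classical
  have hsum : Summable fun i => ‖T (b i)‖ ^ 2 :=
    summable_of_sum_le (fun i => sq_nonneg _) hC
  -- Finite-rank truncations along the basis. By Cauchy–Schwarz and Bessel, the error is at most the
  -- square root of the tail of $\sum\|Tb_i\|^2$, so $T$ is a norm limit of compact operators.
  let A : Finset ι → H →L[ℂ] H := fun F => ∑ i ∈ F, (innerSL ℂ (b i)).smulRight (T (b i))
  have hA : ∀ F f, A F f = ∑ i ∈ F, inner ℂ (b i) f • T (b i) := by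
    intro F f
    simp [A]
  have hAc : ∀ F, IsCompactOperator (A F) := by
    intro F
    induction F using Finset.induction_on with
    | empty => simpa [A] using isCompactOperator_zero
    | insert i F hi ih =>
      have h1 : A (insert i F) = (innerSL ℂ (b i)).smulRight (T (b i)) + A F := by
        simp [A, Finset.sum_insert hi]
      have h2 : IsCompactOperator ((innerSL ℂ (b i)).smulRight (T (b i))) := by
        have h3 : IsCompactOperator (innerSL ℂ (b i)) :=
          isCompactOperator_of_locallyCompactSpace_dom _
        exact h3.clm_comp ((1 : ℂ →L[ℂ] ℂ).smulRight (T (b i)))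
      rw [h1]
      exact h2.add ih
  have hlim : Tendsto A atTop (𝓝 T) := by
    rw [Metric.tendsto_atTop]
    intro ε hε
    obtain ⟨F, hF⟩ := summable_iff_vanishing_norm.1 hsum ((ε / 2) ^ 2) (by positivity)
    refine ⟨F, fun G hFG => ?_⟩
    rw [dist_comm, dist_eq_norm]
    refine lt_of_le_of_lt (ContinuousLinearMap.opNorm_le_bound _ (half_pos hε).le fun f => ?_)
      (half_lt_self hε)
    have h1 : HasSum (fun i => inner ℂ (b i) f • T (b i)) (T f) := by
      have := (b.hasSum_repr f).mapL T
      simpa [HilbertBasis.repr_apply_apply] using this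
    have h2 : Tendsto (fun G' => ∑ i ∈ G' \ G, inner ℂ (b i) f • T (b i)) atTop
        (𝓝 ((T - A G) f)) := by
      have h3 : Tendsto (fun G' => ∑ i ∈ G', inner ℂ (b i) f • T (b i) - A G f) atTop
          (𝓝 (T f - A G f)) := Tendsto.sub_const h1 _
      refine h3.congr' ?_
      filter_upwards [eventually_ge_atTop G] with G' hG'
      rw [hA, sub_eq_iff_eq_add, Finset.sum_sdiff hG']
    refine le_of_tendsto h2.norm (Eventually.of_forall fun G' => ?_)
    have h4 : ∑ i ∈ G' \ G, ‖T (b i)‖ ^ 2 ≤ (ε / 2) ^ 2 := by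
      have hd : Disjoint (G' \ G) F := Finset.disjoint_of_subset_right hFG Finset.sdiff_disjoint
      have := hF _ hd
      rw [Real.norm_eq_abs] at this
      exact (le_abs_self _).trans this.le
    have h5 : ∑ i ∈ G' \ G, ‖inner ℂ (b i) f‖ ^ 2 ≤ ‖f‖ ^ 2 :=
      b.orthonormal.sum_inner_products_le f
    have h6 : (∑ i ∈ G' \ G, ‖inner ℂ (b i) f‖ * ‖T (b i)‖) ^ 2 ≤ ‖f‖ ^ 2 * (ε / 2) ^ 2 :=
      (Finset.sum_mul_sq_le_sq_mul_sq _ _ _).trans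
        (mul_le_mul h5 h4 (Finset.sum_nonneg fun i _ => sq_nonneg _) (sq_nonneg _))
    calc ‖∑ i ∈ G' \ G, inner ℂ (b i) f • T (b i)‖
        ≤ ∑ i ∈ G' \ G, ‖inner ℂ (b i) f‖ * ‖T (b i)‖ :=
          (norm_sum_le _ _).trans (le_of_eq (Finset.sum_congr rfl fun i _ => norm_smul _ _))
      _ ≤ ε / 2 * ‖f‖ := by
          refine le_of_sq_le_sq ?_ (by positivity)
          linarith [h6, mul_pow (ε / 2) ‖f‖ 2]
  exact isCompactOperator_of_tendsto hlim (Eventually.of_forall hAc)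

variable {E : Type*} [MeasurableSpace E]

lemma enorm_sq_eq_lintegral {m : Measure E} (f : L2 m) : ‖f‖ₑ ^ 2 = ∫⁻ x, ‖f x‖ₑ ^ 2 ∂m := by
  rw [Lp.enorm_def, eLpNorm_eq_lintegral_rpow_enorm_toReal (by norm_num) (by norm_num),
    ← ENNReal.rpow_natCast, ← ENNReal.rpow_mul]
  norm_num

/-- Operators on `L²` agreeing on indicators are equal. -/
lemma clm_ext_indicator {m : Measure E} {S T : L2 m →L[ℂ] L2 m}
    (h : ∀ (B : Set E) (hB : MeasurableSet B) (hmB : m B ≠ ∞),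
      S (indicatorConstLp 2 hB hmB (1 : ℂ)) = T (indicatorConstLp 2 hB hmB (1 : ℂ))) : S = T := by
  ext1 f
  induction f using Lp.induction (p := 2) ENNReal.ofNat_ne_top with
  | indicatorConst c hs hμs =>
    have h1 : ((Lp.simpleFunc.indicatorConst 2 hs hμs.ne c : Lp.simpleFunc ℂ 2 m) : L2 m) =
        c • indicatorConstLp 2 hs hμs.ne (1 : ℂ) := by
      rw [Lp.simpleFunc.coe_indicatorConst]
      refine Lp.ext ?_
      filter_upwards [indicatorConstLp_coeFn (p := 2) (hs := hs) (hμs := hμs.ne) (c := c),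
        indicatorConstLp_coeFn (p := 2) (hs := hs) (hμs := hμs.ne) (c := (1 : ℂ)),
        Lp.coeFn_smul c (indicatorConstLp 2 hs hμs.ne (1 : ℂ))] with x h2 h3 h4
      rw [h2, h4, Pi.smul_apply, h3]
      simp [Set.indicator]
    rw [h1, map_smul, map_smul, h]
  | add hf hg _ ihf ihg => rw [map_add, map_add, ihf, ihg]
  | isClosed => exact isClosed_eq S.continuous T.continuous

variable (m : Measure E) [SFinite m] (k : E → E → ℝ)

/-- Integral operators with square integrable kernels are compact. -/
theorem isCompactOperator_kernelOp : IsCompactOperator (kernelOp m k) := by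
  by_cases hk : MemLp (Function.uncurry k) 2 (m.prod m)
  swap
  · rw [kernelOp, dif_neg hk]
    exact isCompactOperator_zero
  obtain ⟨w, b, -⟩ := exists_hilbertBasis ℂ (L2 m)
  refine isCompactOperator_of_sum_norm_sq_le b (kernelOp m k)
    (C := (eLpNorm (Function.uncurry k) 2 (m.prod m) ^ 2).toReal) fun F => ?_
  have hfin : eLpNorm (Function.uncurry k) 2 (m.prod m) ^ 2 < ∞ := ENNReal.pow_lt_top hk.2
  -- For almost every $x$ the values $(Tb_i)(x)$ have the moduli of the coefficients of the section
  -- $k(x,\cdot)$ in the basis. Bessel's inequality is applied to it and integrated in $x$.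
  have h1 : ∑ i ∈ F, ‖kernelOp m k (b i)‖ₑ ^ 2 ≤ eLpNorm (Function.uncurry k) 2 (m.prod m) ^ 2 := by
    simp only [enorm_sq_eq_lintegral]
    rw [← lintegral_finsetSum' F fun i _ => (Lp.aestronglyMeasurable _).enorm.pow_const 2,
      ← kernel_sq m k hk]
    refine lintegral_mono_ae ?_
    have h2 : ∀ᵐ x ∂m, ∫⁻ y, ‖k x y‖ₑ ^ 2 ∂m < ∞ := by
      refine ae_lt_top' ?_ ?_
      · have : AEMeasurable (fun z => ‖Function.uncurry k z‖ₑ ^ 2) (m.prod m) :=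
          hk.1.enorm.pow_const _
        exact this.lintegral_prod_right'
      · rw [kernel_sq m k hk]
        exact hfin.ne
    have h3 : ∀ᵐ x ∂m, ∀ i ∈ F, kernelOp m k (b i) x = ∫ y, (k x y : ℂ) * b i y ∂m :=
      (Finset.eventually_all _).2 fun i _ => kernelOp_apply m k hk (b i)
    filter_upwards [h2, h3, hk.1.prodMk_left] with x h4 h5 h6
    have hkx : MemLp (fun y => (k x y : ℂ)) 2 m := by
      refine MemLp.ofReal ⟨h6, ?_⟩
      rw [eLpNorm_lt_top_iff_lintegral_rpow_enorm_lt_top (by norm_num) (by norm_num)]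
      simpa using h4
    have h7 : ∀ i ∈ F, ‖kernelOp m k (b i) x‖ₑ = ‖inner ℂ (b i) hkx.toLp‖ₑ := by
      intro i hi
      rw [h5 i hi, ← enorm_norm (inner ℂ (b i) hkx.toLp), norm_inner_symm, enorm_norm, L2.inner_def]
      congr 1
      refine integral_congr_ae ?_
      filter_upwards [hkx.coeFn_toLp] with y hy
      rw [hy, RCLike.inner_apply, mul_comm, Complex.conj_ofReal]
    have h8 : ‖hkx.toLp‖ₑ ^ 2 = ∫⁻ y, ‖k x y‖ₑ ^ 2 ∂m := by
      rw [enorm_sq_eq_lintegral]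
      refine lintegral_congr_ae ?_
      filter_upwards [hkx.coeFn_toLp] with y hy
      rw [hy, ← ofReal_norm, Complex.norm_real, ofReal_norm]
    rw [← h8, Finset.sum_congr rfl fun i hi => by rw [h7 i hi]]
    have h9 := b.orthonormal.sum_inner_products_le hkx.toLp (s := F)
    simp only [← ofReal_norm]
    rw [← ENNReal.ofReal_pow (norm_nonneg _)]
    refine le_trans (le_of_eq ?_) (ENNReal.ofReal_le_ofReal h9)
    rw [ENNReal.ofReal_sum_of_nonneg fun i _ => sq_nonneg _]
    exact Finset.sum_congr rfl fun i _ => (ENNReal.ofReal_pow (norm_nonneg _) 2).symm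
  have h2 := ENNReal.toReal_mono hfin.ne h1
  refine le_trans (le_of_eq ?_) h2
  rw [ENNReal.toReal_sum fun i _ => ENNReal.pow_ne_top enorm_ne_top]
  exact Finset.sum_congr rfl fun i _ => by simp

/-- The Schur test. -/
theorem norm_kernelOp_le {p : E → E → ℝ≥0∞} (hp : Measurable (Function.uncurry p))
    (hrow : ∀ x, ∫⁻ y, p x y ∂m ≤ 1) (hcol : ∀ y, ∫⁻ x, p x y ∂m ≤ 1) {A : ℝ} (hA : 0 ≤ A)
    (hk : ∀ x y, ‖k x y‖ₑ ≤ ENNReal.ofReal A * p x y) (f : L2 m) :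
    ‖kernelOp m k f‖ ≤ A * ‖f‖ := by
  by_cases hkm : MemLp (Function.uncurry k) 2 (m.prod m)
  swap
  · rw [kernelOp, dif_neg hkm, zero_apply, norm_zero]
    positivity
  have hpx : ∀ x, Measurable (p x) := fun x => hp.comp measurable_prodMk_left
  have hfm : AEMeasurable (fun y => ‖f y‖ₑ) m := (Lp.aestronglyMeasurable f).enorm
  have h1 : ∀ x, ‖∫ y, (k x y : ℂ) * f y ∂m‖ₑ ^ 2 ≤
      ENNReal.ofReal A ^ 2 * ∫⁻ y, p x y * ‖f y‖ₑ ^ 2 ∂m := by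
    intro x
    -- Writing $p=p^{1/2}p^{1/2}$ prepares Cauchy–Schwarz: one factor is controlled by the row sum,
    -- and the other keeps $p|f|^2$, which Tonelli and the column sum handle.
    have e1 : ‖∫ y, (k x y : ℂ) * f y ∂m‖ₑ ≤
        ENNReal.ofReal A * ∫⁻ y, p x y ^ (1 / 2 : ℝ) * (p x y ^ (1 / 2 : ℝ) * ‖f y‖ₑ) ∂m := by
      refine (enorm_integral_le_lintegral_enorm _).trans ?_
      rw [← lintegral_const_mul' _ _ ENNReal.ofReal_ne_top]
      refine lintegral_mono fun y => ?_
      have e0 : p x y ^ (1 / 2 : ℝ) * (p x y ^ (1 / 2 : ℝ) * ‖f y‖ₑ) = p x y * ‖f y‖ₑ := by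
        rw [← mul_assoc, ← ENNReal.rpow_add_of_nonneg _ _ (by norm_num) (by norm_num)]
        norm_num
      rw [enorm_mul, ← ofReal_norm (k x y : ℂ), Complex.norm_real, ofReal_norm, e0, ← mul_assoc]
      gcongr
      exact hk x y
    have e2 := ENNReal.lintegral_mul_le_Lp_mul_Lq m Real.HolderConjugate.two_two
      ((hpx x).pow_const (1 / 2 : ℝ)).aemeasurable
      (((hpx x).pow_const (1 / 2 : ℝ)).aemeasurable.mul hfm)
    have e3 : ∀ c : ℝ≥0∞, (c ^ (1 / 2 : ℝ)) ^ (2 : ℝ) = c := fun c => by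
      rw [← ENNReal.rpow_mul]
      norm_num
    have e4 : ∀ c : ℝ≥0∞, (c ^ (1 / 2 : ℝ)) ^ 2 = c := fun c => by
      rw [← ENNReal.rpow_natCast, ← ENNReal.rpow_mul]
      norm_num
    simp only [Pi.mul_apply, ENNReal.mul_rpow_of_nonneg _ _ (zero_le_two (α := ℝ)), e3] at e2
    have e5 := pow_le_pow_left' (e1.trans (mul_le_mul_right e2 _)) 2
    refine e5.trans ?_
    rw [mul_pow, mul_pow, e4, e4]
    gcongr
    refine (mul_le_mul_left (hrow x) _).trans (le_of_eq ?_)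
    rw [one_mul]
    simp
  have h2 : ‖kernelOp m k f‖ₑ ^ 2 ≤ (ENNReal.ofReal A * ‖f‖ₑ) ^ 2 := by
    rw [mul_pow, enorm_sq_eq_lintegral, enorm_sq_eq_lintegral]
    have e1 : ∫⁻ x, ‖kernelOp m k f x‖ₑ ^ 2 ∂m ≤
        ∫⁻ x, ENNReal.ofReal A ^ 2 * ∫⁻ y, p x y * ‖f y‖ₑ ^ 2 ∂m ∂m := by
      refine lintegral_mono_ae ?_
      filter_upwards [kernelOp_apply m k hkm f] with x hx
      rw [hx]
      exact h1 x
    refine e1.trans ?_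
    rw [lintegral_const_mul' _ _ (ENNReal.pow_ne_top ENNReal.ofReal_ne_top)]
    refine mul_le_mul_right ?_ _
    have hpf : AEMeasurable (Function.uncurry fun x y => p x y * ‖f y‖ₑ ^ 2) (m.prod m) :=
      hp.aemeasurable.mul (hfm.pow_const 2).comp_snd
    rw [lintegral_lintegral_swap hpf]
    refine lintegral_mono fun y => ?_
    have hpy : Measurable fun x => p x y := hp.comp measurable_prodMk_right
    rw [lintegral_mul_const _ hpy]
    exact (mul_le_mul_left (hcol y) _).trans (le_of_eq (one_mul _))
  have h3 := (ENNReal.pow_le_pow_left_iff (two_ne_zero)).1 h2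
  have h4 := ENNReal.toReal_mono (ENNReal.mul_ne_top ENNReal.ofReal_ne_top enorm_ne_top) h3
  simpa [ENNReal.toReal_mul, hA] using h4

variable {m k}

lemma kernelOp_indicator (hk : MemLp (Function.uncurry k) 2 (m.prod m)) {B : Set E}
    (hB : MeasurableSet B) (hmB : m B ≠ ∞) :
    kernelOp m k (indicatorConstLp 2 hB hmB (1 : ℂ)) =ᵐ[m]
      fun x => ((∫ y in B, k x y ∂m : ℝ) : ℂ) := by
  filter_upwards [kernelOp_apply m k hk (indicatorConstLp 2 hB hmB (1 : ℂ))] with x hx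
  rw [hx, ← integral_complex_ofReal, ← integral_indicator hB]
  refine integral_congr_ae ?_
  filter_upwards [indicatorConstLp_coeFn (p := 2) (hs := hB) (hμs := hmB) (c := (1 : ℂ))] with y hy
  rw [hy]
  by_cases h : y ∈ B <;> simp [h]

end HilbertSchmidt

/-! ### The transition density and the mean kernel -/

section Kernels

/-- A generalized dominated convergence theorem: integrals of functions dominated by a family
with continuous integrals are continuous. -/
theorem continuousAt_integral_of_le {X E : Type*} [TopologicalSpace X] [FirstCountableTopology X]
    [MeasurableSpace E] {m : Measure E} {u v : X → E → ℝ} {C : ℝ} {x₀ : X} (hC : 0 ≤ C)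
    (hu0 : ∀ x y, 0 ≤ u x y) (hv0 : ∀ x y, 0 ≤ v x y) (huv : ∀ x y, u x y ≤ C * v x y)
    (hu : ∀ x, AEStronglyMeasurable (u x) m) (hv : ∀ x, Integrable (v x) m)
    (huc : ∀ y, ContinuousAt (fun x => u x y) x₀) (hvc : ∀ y, ContinuousAt (fun x => v x y) x₀)
    (hvI : ContinuousAt (fun x => ∫ y, v x y ∂m) x₀) :
    ContinuousAt (fun x => ∫ y, u x y ∂m) x₀ := by
  have hui : ∀ x, Integrable (u x) m := fun x =>
    ((hv x).const_mul C).mono' (hu x) (ae_of_all _ fun y => by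
      rw [Real.norm_eq_abs, abs_of_nonneg (hu0 x y)]
      exact huv x y)
  have hCv : Integrable (fun y => C * v x₀ y) m := (hv x₀).const_mul C
  have hminu : ∀ x, Integrable (fun y => min (u x y) (C * v x₀ y)) m := fun x => (hui x).inf hCv
  have hminv : ∀ x, Integrable (fun y => min (v x y) (v x₀ y)) m := fun x => (hv x).inf (hv x₀)
  have h1 : Tendsto (fun x => ∫ y, min (u x y) (C * v x₀ y) ∂m) (𝓝 x₀) (𝓝 (∫ y, u x₀ y ∂m)) := by
    refine tendsto_integral_filter_of_dominated_convergence (fun y => C * v x₀ y)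
      (Eventually.of_forall fun x => (hminu x).aestronglyMeasurable)
      (Eventually.of_forall fun x => ae_of_all _ fun y => ?_) hCv (ae_of_all _ fun y => ?_)
    · rw [Real.norm_eq_abs, abs_of_nonneg (le_min (hu0 x y) (mul_nonneg hC (hv0 x₀ y)))]
      exact min_le_right _ _
    · have := (huc y).tendsto.min (tendsto_const_nhds (x := C * v x₀ y))
      rwa [min_eq_left (huv x₀ y)] at this
  have h2 : Tendsto (fun x => ∫ y, min (v x y) (v x₀ y) ∂m) (𝓝 x₀) (𝓝 (∫ y, v x₀ y ∂m)) := by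
    refine tendsto_integral_filter_of_dominated_convergence (fun y => v x₀ y)
      (Eventually.of_forall fun x => (hminv x).aestronglyMeasurable)
      (Eventually.of_forall fun x => ae_of_all _ fun y => ?_) (hv x₀) (ae_of_all _ fun y => ?_)
    · rw [Real.norm_eq_abs, abs_of_nonneg (le_min (hv0 x y) (hv0 x₀ y))]
      exact min_le_right _ _
    · have := (hvc y).tendsto.min (tendsto_const_nhds (x := v x₀ y))
      rwa [min_self] at this
  have h3 : Tendsto (fun x => C * (∫ y, v x y ∂m - ∫ y, min (v x y) (v x₀ y) ∂m)) (𝓝 x₀) (𝓝 0) := by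
    have := (hvI.tendsto.sub h2).const_mul C
    simpa using this
  -- Ordinary dominated convergence applies after truncation at $Cv_{x_0}$. The discarded part of
  -- $u_x$ is at most $C(v_x-\min(v_x,v_{x_0}))$, whose integral vanishes in the limit because $\int
  -- v_x$ is continuous.
  have h4 : Tendsto (fun x => ∫ y, min (u x y) (C * v x₀ y) ∂m +
      C * (∫ y, v x y ∂m - ∫ y, min (v x y) (v x₀ y) ∂m)) (𝓝 x₀) (𝓝 (∫ y, u x₀ y ∂m)) := by
    simpa using h1.add h3
  refine tendsto_of_tendsto_of_tendsto_of_le_of_le h1 h4 (fun x => ?_) (fun x => ?_)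
  · exact integral_mono (hminu x) (hui x) fun y => min_le_left _ _
  · simp only
    have hd : Integrable (fun y => C * (v x y - min (v x y) (v x₀ y))) m :=
      ((hv x).sub (hminv x)).const_mul C
    rw [← integral_sub (hv x) (hminv x), ← integral_const_mul, ← integral_add (hminu x) hd]
    refine integral_mono (hui x) ((hminu x).add hd) fun y => ?_
    simp only
    rcases min_choice (u x y) (C * v x₀ y) with h | h <;> rw [h]
    · have : 0 ≤ C * (v x y - min (v x y) (v x₀ y)) :=
        mul_nonneg hC (sub_nonneg.2 (min_le_left _ _))
      linarith
    · rw [mul_sub]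
      have h5 : C * min (v x y) (v x₀ y) ≤ C * v x₀ y :=
        mul_le_mul_of_nonneg_left (min_le_right _ _) hC
      linarith [huv x y]

/-- A continuous function with nonnegative integrals over sets of finite measure is
nonnegative. -/
theorem nonneg_of_forall_setIntegral_nonneg {E : Type*} [TopologicalSpace E] [MeasurableSpace E]
    [BorelSpace E] {m : Measure E} [IsLocallyFiniteMeasure m] [m.IsOpenPosMeasure] {g : E → ℝ}
    (hg : Continuous g) (h : ∀ B, MeasurableSet B → m B ≠ ∞ → 0 ≤ ∫ y in B, g y ∂m) (y : E) :
    0 ≤ g y := by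
  by_contra! hy
  obtain ⟨U, hyU, hUo, hUm⟩ := m.exists_isOpen_measure_lt_top y
  -- With $g(y)<0$, the upper bound $g(y)/2$ makes the integral over $B$ negative, and the lower
  -- bound $2g(y)$ ensures integrability.
  set B := U ∩ g ⁻¹' Set.Ioo (2 * g y) (g y / 2) with hB
  have hBo : IsOpen B := hUo.inter (isOpen_Ioo.preimage hg)
  have hyB : y ∈ B := ⟨hyU, by constructor <;> linarith⟩
  have hBm : m B < ∞ := (measure_mono Set.inter_subset_left).trans_lt hUm
  have hint : IntegrableOn g B m := by
    refine Measure.integrableOn_of_bounded (M := 2 * |g y|) hBm.ne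
      hg.aestronglyMeasurable ?_
    refine (ae_restrict_iff' hBo.measurableSet).2 (ae_of_all _ fun z hz => ?_)
    rw [Real.norm_eq_abs, abs_le, abs_of_neg hy]
    have := hz.2
    constructor <;> linarith [this.1, this.2]
  have h1 : ∫ z in B, g z ∂m ≤ ∫ _ in B, g y / 2 ∂m := by
    refine setIntegral_mono_on hint ?_ hBo.measurableSet fun z hz => hz.2.2.le
    exact integrableOn_const hBm.ne
  rw [setIntegral_const, smul_eq_mul] at h1
  have h2 : 0 < m.real B := ENNReal.toReal_pos (hBo.measure_pos m ⟨y, hyB⟩).ne' hBm.ne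
  have h3 := h B hBo.measurableSet hBm.ne
  nlinarith

variable {E : Type*} [MeasurableSpace E] {m : Measure E}

lemma MemLp.of_integrable_sqInt [SFinite m] {p : ℝ → E → E → ℝ} {t : ℝ}
    (hm : Measurable (Function.uncurry (p t)))
    (h1 : ∀ x, Integrable (fun y => p t x y ^ 2) m) (h2 : Integrable (sqInt m p t) m) :
    MemLp (Function.uncurry (p t)) 2 (m.prod m) := by
  refine (memLp_two_iff_integrable_sq hm.aestronglyMeasurable).2 ?_
  refine (integrable_prod_iff (hm.pow_const 2).aestronglyMeasurable).2 ⟨ae_of_all _ h1, ?_⟩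
  refine h2.congr (ae_of_all _ fun x => ?_)
  refine integral_congr_ae (ae_of_all _ fun y => ?_)
  simp

variable [TopologicalSpace E] {Ω : Type*} [MeasurableSpace Ω]
  {ξ : HuntProcess E Ω} {p : ℝ → E → E → ℝ}

lemma IsTransitionDensity.lintegral_le_one (hp : IsTransitionDensity m ξ p) {t : ℝ} (ht : 0 < t)
    (x : E) : ∫⁻ y, ENNReal.ofReal (p t x y) ∂m ≤ 1 := by
  have := ξ.isMarkovKernel
  have h := hp.density t ht (fun _ => 1) measurable_const x
  simp only [mul_one] at h
  rw [← h]
  have h1 : ∀ z : OnePoint E, extend (fun _ : E => (1 : ℝ≥0∞)) z ≤ 1 := by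
    intro z
    induction z using OnePoint.rec with
    | infty => simp [extend]
    | coe x => exact le_rfl
  refine (lintegral_mono fun ω => h1 _).trans ?_
  simp

lemma IsTransitionDensity.integrable (hp : IsTransitionDensity m ξ p) {t : ℝ} (ht : 0 < t)
    (hpm : Measurable (Function.uncurry (p t))) (x : E) : Integrable (p t x) m := by
  have hm : Measurable (p t x) := hpm.comp measurable_prodMk_left
  refine ⟨hm.aestronglyMeasurable, ?_⟩
  rw [hasFiniteIntegral_iff_ofReal (ae_of_all _ fun y => (hp.pos t ht x y).le)]
  exact (hp.lintegral_le_one ht x).trans_lt ENNReal.one_lt_top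

lemma IsTransitionDensity.integral_le_one (hp : IsTransitionDensity m ξ p) {t : ℝ} (ht : 0 < t)
    (hpm : Measurable (Function.uncurry (p t))) (x : E) : ∫ y, p t x y ∂m ≤ 1 := by
  have hm : Measurable (p t x) := hpm.comp measurable_prodMk_left
  rw [integral_eq_lintegral_of_nonneg_ae (ae_of_all _ fun y => (hp.pos t ht x y).le)
    hm.aestronglyMeasurable]
  exact ENNReal.toReal_le_of_le_ofReal zero_le_one (by simpa using hp.lintegral_le_one ht x)

variable [BorelSpace E]

/-- The density $p(1,x,\cdot)$ is bounded below near $x$ and has total mass at most one, so Markov's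
inequality gives that neighbourhood finite measure. -/
lemma IsTransitionDensity.isLocallyFiniteMeasure (hp : IsTransitionDensity m ξ p) :
    IsLocallyFiniteMeasure m := by
  refine ⟨fun x => ?_⟩
  have hc : Continuous (p 1 x) := (hp.continuous 1 one_pos).comp (Continuous.prodMk_right x)
  set c := p 1 x x / 2 with hcdef
  have hpos := hp.pos 1 one_pos x x
  have hc0 : 0 < c := by positivity
  have hU : IsOpen {y | c < p 1 x y} := isOpen_lt continuous_const hc
  refine ⟨_, hU.mem_nhds (show c < p 1 x x by rw [hcdef]; linarith), ?_⟩
  have h1 : ENNReal.ofReal c * m {y | c < p 1 x y} ≤ 1 := by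
    refine le_trans ?_ (hp.lintegral_le_one one_pos x)
    rw [← lintegral_indicator_const hU.measurableSet]
    refine lintegral_mono fun y => ?_
    by_cases hy : c < p 1 x y
    · rw [Set.indicator_of_mem (show y ∈ {y | c < p 1 x y} from hy)]
      exact ENNReal.ofReal_le_ofReal hy.le
    · rw [Set.indicator_of_notMem (show y ∉ {y | c < p 1 x y} from hy)]
      exact zero_le
  have hc' : ENNReal.ofReal c ≠ 0 := (ENNReal.ofReal_pos.2 hc0).ne'
  rw [mul_comm, ← ENNReal.le_div_iff_mul_le (Or.inl hc') (Or.inl ENNReal.ofReal_ne_top)] at h1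
  exact h1.trans_lt (ENNReal.div_lt_top ENNReal.one_ne_top hc')

/-- The density formula for bounded complex functions. -/
theorem IsTransitionDensity.integral_extend (hp : IsTransitionDensity m ξ p) {t : ℝ} (ht : 0 < t)
    (hpm : Measurable (Function.uncurry (p t))) {g : E → ℂ} (hg : Measurable g) (x : E) :
    ∫ ω, extend g (ξ.X t.toNNReal ω) ∂(ξ.P x) = ∫ y, (p t x y : ℂ) * g y ∂m := by
  have hX := ξ.measurable_X t.toNNReal
  set ν := (ξ.P x).map (ξ.X t.toNNReal) with hν
  have hemb : MeasurableEmbedding ((↑) : E → OnePoint E) :=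
    OnePoint.isOpenEmbedding_coe.measurableEmbedding
  have hpx : Measurable (p t x) := hpm.comp measurable_prodMk_left
  -- The law of $\xi_t$ restricted to $E$ has density $p(t,x,\cdot)$; the cemetery contributes
  -- nothing because extensions vanish there.
  have hcomap : ν.comap (↑) = m.withDensity fun y => ENNReal.ofReal (p t x y) := by
    ext B hB
    rw [hemb.comap_apply, hν, Measure.map_apply hX (hemb.measurableSet_image.2 hB),
      withDensity_apply _ hB]
    have h := hp.density t ht (B.indicator 1) (measurable_one.indicator hB) x
    have h1 : ∀ z : OnePoint E, extend (B.indicator (1 : E → ℝ≥0∞)) z =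
        (((↑) : E → OnePoint E) '' B).indicator 1 z := by
      intro z
      induction z using OnePoint.rec with
      | infty => simp [extend]
      | coe y =>
        change B.indicator 1 y = _
        by_cases hy : y ∈ B <;> simp [hy]
    have h2 : ∀ ω, extend (B.indicator (1 : E → ℝ≥0∞)) (ξ.X t.toNNReal ω) =
        (ξ.X t.toNNReal ⁻¹' (((↑) : E → OnePoint E) '' B)).indicator 1 ω := fun ω => h1 _
    simp only [h2] at h
    rw [lintegral_indicator_one (hX (hemb.measurableSet_image.2 hB))] at h
    rw [h, ← lintegral_indicator hB]
    refine lintegral_congr fun y => ?_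
    by_cases hy : y ∈ B <;> simp [hy]
  have h1 : ∫ ω, extend g (ξ.X t.toNNReal ω) ∂(ξ.P x) = ∫ z, extend g z ∂ν :=
    (integral_map hX.aemeasurable (measurable_extend hg).aestronglyMeasurable).symm
  have h2 : ∫ z, extend g z ∂ν = ∫ z in Set.range ((↑) : E → OnePoint E), extend g z ∂ν := by
    refine (setIntegral_eq_integral_of_forall_compl_eq_zero fun z hz => ?_).symm
    induction z using OnePoint.rec with
    | infty => rfl
    | coe y => exact absurd (Set.mem_range_self y) hz
  rw [h1, h2, ← hemb.map_comap, hemb.integral_map, hcomap,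
    integral_withDensity_eq_integral_toReal_smul hpx.ennreal_ofReal
      (ae_of_all _ fun y => ENNReal.ofReal_lt_top)]
  refine integral_congr_ae (ae_of_all _ fun y => ?_)
  change (ENNReal.ofReal (p t x y)).toReal • g y = (p t x y : ℂ) * g y
  rw [ENNReal.toReal_ofReal (hp.pos t ht x y).le, Complex.real_smul]

end Kernels

/-! ### Comparison of the mean kernel with the transition density, and the semigroup law -/

section MeanKernel

lemma indicator_one_nonneg {E : Type*} (B : Set E) (y : E) : 0 ≤ B.indicator (1 : E → ℝ) y :=
  Set.indicator_nonneg (fun _ _ => zero_le_one) y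

lemma indicator_one_le {E : Type*} (B : Set E) (y : E) : B.indicator (1 : E → ℝ) y ≤ 1 :=
  Set.indicator_le_self' (fun _ _ => zero_le_one) y

variable {E : Type*} [MetricSpace E] [MeasurableSpace E] {m : Measure E}
  {Ω : Type*} [MeasurableSpace Ω] {ξ : HuntProcess E Ω} {p q : ℝ → E → E → ℝ} {𝔟 : Branching E}

lemma IsMeanKernel.continuous_left (hq : IsMeanKernel m ξ 𝔟 q) {t : ℝ} (ht : 0 < t) (x : E) :
    Continuous (q t x) := (hq.continuous t ht).comp (Continuous.prodMk_right x)

lemma IsTransitionDensity.continuous_left (hp : IsTransitionDensity m ξ p) {t : ℝ} (ht : 0 < t)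
    (x : E) : Continuous (p t x) := (hp.continuous t ht).comp (Continuous.prodMk_right x)

lemma IsMeanKernel.meanSemigroup_indicator (hq : IsMeanKernel m ξ 𝔟 q) {t : ℝ} (ht : 0 < t)
    {B : Set E} (hB : MeasurableSet B) (x : E) :
    meanSemigroup ξ 𝔟 t (B.indicator 1) x = ∫ y in B, q t x y ∂m := by
  rw [hq.density t ht _ (measurable_one.indicator hB) ⟨1, fun y => ?_⟩, ← integral_indicator hB]
  · refine integral_congr_ae (ae_of_all _ fun y => ?_)
    by_cases hy : y ∈ B <;> simp [hy]
  · by_cases hy : y ∈ B <;> simp [hy]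

variable [SecondCountableTopology E] [BorelSpace E]

lemma IsTransitionDensity.measurable_uncurry (hp : IsTransitionDensity m ξ p) {t : ℝ}
    (ht : 0 < t) : Measurable (Function.uncurry (p t)) := (hp.continuous t ht).measurable

lemma IsMeanKernel.measurable_uncurry (hq : IsMeanKernel m ξ 𝔟 q) {t : ℝ}
    (ht : 0 < t) : Measurable (Function.uncurry (q t)) := (hq.continuous t ht).measurable

lemma IsTransitionDensity.lintegral_indicator (hp : IsTransitionDensity m ξ p) {t : ℝ} (ht : 0 < t)
    {B : Set E} (hB : MeasurableSet B) (x : E) :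
    ∫⁻ ω, ENNReal.ofReal (extend (B.indicator (1 : E → ℝ)) (ξ.X t.toNNReal ω)) ∂(ξ.P x) =
      ENNReal.ofReal (∫ y in B, p t x y ∂m) := by
  have h := hp.density t ht (B.indicator 1) (measurable_one.indicator hB) x
  have h1 : ∀ z : OnePoint E, extend (B.indicator (1 : E → ℝ≥0∞)) z =
      ENNReal.ofReal (extend (B.indicator (1 : E → ℝ)) z) := by
    intro z
    induction z using OnePoint.rec with
    | infty => simp [extend]
    | coe y =>
      change B.indicator 1 y = ENNReal.ofReal (B.indicator 1 y)
      by_cases hy : y ∈ B <;> simp [hy]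
  simp only [h1] at h
  rw [h, ofReal_integral_eq_lintegral_ofReal
    (hp.integrable ht (hp.measurable_uncurry ht) x).integrableOn
    (ae_of_all _ fun y => (hp.pos t ht x y).le), ← MeasureTheory.lintegral_indicator hB]
  refine lintegral_congr fun y => ?_
  by_cases hy : y ∈ B <;> simp [hy]

/-- Schur's test relative to the transition density. -/
lemma IsTransitionDensity.norm_kernelOp_le [SFinite m] (hp : IsTransitionDensity m ξ p)
    (hA : DensityAssumption m p) {t : ℝ} (ht : 0 < t) {k : E → E → ℝ} {A : ℝ} (hA0 : 0 ≤ A)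
    (hk : ∀ x y, |k x y| ≤ A * p t x y) (f : L2 m) : ‖kernelOp m k f‖ ≤ A * ‖f‖ := by
  refine BranchingCLT.norm_kernelOp_le m k (p := fun x y => ENNReal.ofReal (p t x y))
    (hp.measurable_uncurry ht).ennreal_ofReal (hp.lintegral_le_one ht) (hA.dual_subMarkov t ht) hA0
    (fun x y => ?_) f
  rw [← ENNReal.ofReal_mul hA0, ← ofReal_norm, Real.norm_eq_abs]
  exact ENNReal.ofReal_le_ofReal (hk x y)

variable [LocallyCompactSpace E]

/-- The Feynman–Kac exponent is at most $Kt$ in absolute value, so the weight lies between $e^{-Kt}$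
and $e^{Kt}$. -/
theorem IsTransitionDensity.meanSemigroup_indicator_mem (hp : IsTransitionDensity m ξ p) {K : ℝ}
    (hK : 0 ≤ K) (hα : ∀ x, |𝔟.α x| ≤ K) {t : ℝ} (ht : 0 < t) {B : Set E} (hB : MeasurableSet B)
    (x : E) :
    meanSemigroup ξ 𝔟 t (B.indicator 1) x ∈
      Set.Icc (Real.exp (-(K * t)) * ∫ y in B, p t x y ∂m)
        (Real.exp (K * t) * ∫ y in B, p t x y ∂m) := by
  have := pseudoMetrizableSpace_onePoint (E := E)
  have hI : 0 ≤ ∫ y in B, p t x y ∂m := integral_nonneg fun y => (hp.pos t ht x y).le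
  rw [meanSemigroup_eq_toReal ξ 𝔟 ht.le (measurable_one.indicator hB) (indicator_one_nonneg B)]
  have h1 := meanLIntegral_le ξ 𝔟 hK hα ht.le (indicator_one_nonneg B) (x : OnePoint E)
  have h2 := le_meanLIntegral ξ 𝔟 hK hα ht.le (indicator_one_nonneg B) (x : OnePoint E)
  rw [hp.lintegral_indicator ht hB, ← ENNReal.ofReal_mul (Real.exp_pos _).le] at h1 h2
  constructor
  · exact (ENNReal.ofReal_le_iff_le_toReal (ne_top_of_le_ne_top ENNReal.ofReal_ne_top h1)).1 h2
  · exact ENNReal.toReal_le_of_le_ofReal (by positivity) h1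

variable [m.IsOpenPosMeasure]

lemma IsMeanKernel.nonneg (hq : IsMeanKernel m ξ 𝔟 q) (hp : IsTransitionDensity m ξ p) {t : ℝ}
    (ht : 0 < t) (x y : E) : 0 ≤ q t x y := by
  obtain ⟨K, hK, hα⟩ := 𝔟.exists_abs_α_le
  have := hp.isLocallyFiniteMeasure
  refine nonneg_of_forall_setIntegral_nonneg (m := m) (hq.continuous_left ht x)
    (fun B hB _ => ?_) y
  rw [← hq.meanSemigroup_indicator ht hB]
  exact le_trans (mul_nonneg (Real.exp_pos _).le (integral_nonneg fun y => (hp.pos t ht x y).le))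
    (hp.meanSemigroup_indicator_mem hK hα ht hB x).1

/-- A non-integrable $q(t,x,\cdot)$ would have Bochner integral zero, against the lower bound
$e^{-Kt}\int p(t,x,y)\,m(dy)>0$ for the test function $1$. -/
lemma IsMeanKernel.integrable (hq : IsMeanKernel m ξ 𝔟 q) (hp : IsTransitionDensity m ξ p) {t : ℝ}
    (ht : 0 < t) (x : E) : Integrable (q t x) m := by
  obtain ⟨K, hK, hα⟩ := 𝔟.exists_abs_α_le
  have hpi := hp.integrable ht (hp.measurable_uncurry ht) x
  by_contra h
  have h1 := (hp.meanSemigroup_indicator_mem (B := Set.univ) hK hα ht MeasurableSet.univ x).1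
  rw [hq.meanSemigroup_indicator ht MeasurableSet.univ, setIntegral_univ, setIntegral_univ,
    integral_undef h] at h1
  have h2 : 0 < ∫ y, p t x y ∂m := by
    rw [integral_pos_iff_support_of_nonneg (fun y => (hp.pos t ht x y).le) hpi]
    have : Function.support (p t x) = Set.univ :=
      Set.eq_univ_of_forall fun y => (hp.pos t ht x y).ne'
    rw [this]
    exact isOpen_univ.measure_pos m ⟨x, trivial⟩
  have := mul_pos (Real.exp_pos (-(K * t))) h2
  linarith

/-- Comparison of the mean kernel with the transition density. -/
theorem IsMeanKernel.mem_Icc (hq : IsMeanKernel m ξ 𝔟 q) (hp : IsTransitionDensity m ξ p) {K : ℝ}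
    (hK : 0 ≤ K) (hα : ∀ x, |𝔟.α x| ≤ K) {t : ℝ} (ht : 0 < t) (x y : E) :
    q t x y ∈ Set.Icc (Real.exp (-(K * t)) * p t x y) (Real.exp (K * t) * p t x y) := by
  have := hp.isLocallyFiniteMeasure
  have hpi := hp.integrable ht (hp.measurable_uncurry ht) x
  have hqi := hq.integrable hp ht x
  have hB := fun B hB => hp.meanSemigroup_indicator_mem (B := B) hK hα ht hB x
  constructor
  · refine sub_nonneg.1 (nonneg_of_forall_setIntegral_nonneg (m := m)
      (g := fun y => q t x y - Real.exp (-(K * t)) * p t x y)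
      ((hq.continuous_left ht x).sub ((hp.continuous_left ht x).const_mul _)) (fun B h _ => ?_) y)
    rw [integral_sub hqi.integrableOn (hpi.const_mul _).integrableOn, integral_const_mul,
      ← hq.meanSemigroup_indicator ht h]
    exact sub_nonneg.2 (hB B h).1
  · refine sub_nonneg.1 (nonneg_of_forall_setIntegral_nonneg (m := m)
      (g := fun y => Real.exp (K * t) * p t x y - q t x y)
      (((hp.continuous_left ht x).const_mul _).sub (hq.continuous_left ht x)) (fun B h _ => ?_) y)
    rw [integral_sub (hpi.const_mul _).integrableOn hqi.integrableOn, integral_const_mul,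
      ← hq.meanSemigroup_indicator ht h]
    exact sub_nonneg.2 (hB B h).2

/-- The lower deviation $1-e^{-Kt}$ is also at most $e^{Kt}-1$, since $e^s+e^{-s}\ge2$. The constant
tends to $0$ with $t$, which transfers strong continuity from $p$ to $q$. -/
lemma IsMeanKernel.abs_sub_le (hq : IsMeanKernel m ξ 𝔟 q) (hp : IsTransitionDensity m ξ p) {K : ℝ}
    (hK : 0 ≤ K) (hα : ∀ x, |𝔟.α x| ≤ K) {t : ℝ} (ht : 0 < t) (x y : E) :
    |q t x y - p t x y| ≤ (Real.exp (K * t) - 1) * p t x y := by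
  have h := hq.mem_Icc hp hK hα ht x y
  have hpos := hp.pos t ht x y
  have h1 : 2 ≤ Real.exp (K * t) + Real.exp (-(K * t)) := by
    have := Real.add_one_le_exp (K * t)
    have := Real.add_one_le_exp (-(K * t))
    linarith
  rw [abs_le]
  constructor
  · nlinarith [h.1]
  · linarith [h.2]

lemma IsMeanKernel.sq_le (hq : IsMeanKernel m ξ 𝔟 q) (hp : IsTransitionDensity m ξ p) {K : ℝ}
    (hK : 0 ≤ K) (hα : ∀ x, |𝔟.α x| ≤ K) {t : ℝ} (ht : 0 < t) (x y : E) :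
    q t x y ^ 2 ≤ Real.exp (K * t) ^ 2 * p t x y ^ 2 := by
  rw [← mul_pow]
  exact pow_le_pow_left₀ (hq.nonneg hp ht x y) (hq.mem_Icc hp hK hα ht x y).2 2

lemma IsMeanKernel.integrable_sq (hq : IsMeanKernel m ξ 𝔟 q) (hp : IsTransitionDensity m ξ p)
    (hA : DensityAssumption m p) {t : ℝ} (ht : 0 < t) (x : E) :
    Integrable (fun y => q t x y ^ 2) m := by
  obtain ⟨K, hK, hα⟩ := 𝔟.exists_abs_α_le
  refine ((hA.sq_integrable t ht x).const_mul (Real.exp (K * t) ^ 2)).mono'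
    ((hq.continuous_left ht x).pow 2).aestronglyMeasurable (ae_of_all _ fun y => ?_)
  rw [Real.norm_of_nonneg (sq_nonneg _)]
  exact hq.sq_le hp hK hα ht x y

lemma IsMeanKernel.integrable_sq_dual (hq : IsMeanKernel m ξ 𝔟 q) (hp : IsTransitionDensity m ξ p)
    (hA : DensityAssumption m p) {t : ℝ} (ht : 0 < t) (y : E) :
    Integrable (fun x => q t x y ^ 2) m := by
  obtain ⟨K, hK, hα⟩ := 𝔟.exists_abs_α_le
  refine ((hA.sq_integrable_dual t ht y).const_mul (Real.exp (K * t) ^ 2)).mono'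
    (((hq.continuous t ht).comp (Continuous.prodMk_left y)).pow 2).aestronglyMeasurable
    (ae_of_all _ fun x => ?_)
  rw [Real.norm_of_nonneg (sq_nonneg _)]
  exact hq.sq_le hp hK hα ht x y

/-- The bound $q^2\le e^{2Kt}p^2$ varies with $x$, so no fixed dominating function is at hand.
Continuity of $a_t$ replaces it through `continuousAt_integral_of_le`. -/
theorem IsMeanKernel.continuous_sqInt (hq : IsMeanKernel m ξ 𝔟 q) (hp : IsTransitionDensity m ξ p)
    (hA : DensityAssumption m p) {t : ℝ} (ht : 0 < t) : Continuous (sqInt m q t) := by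
  obtain ⟨K, hK, hα⟩ := 𝔟.exists_abs_α_le
  refine continuous_iff_continuousAt.2 fun x₀ => ?_
  refine continuousAt_integral_of_le (u := fun x y => q t x y ^ 2) (v := fun x y => p t x y ^ 2)
    (C := Real.exp (K * t) ^ 2) (by positivity) (fun x y => sq_nonneg _) (fun x y => sq_nonneg _)
    (hq.sq_le hp hK hα ht) (fun x => (hq.integrable_sq hp hA ht x).aestronglyMeasurable)
    (hA.sq_integrable t ht) (fun y => ?_) (fun y => ?_)
    (hA.continuous_sqInt t ht).continuousAt
  · exact (((hq.continuous t ht).comp (Continuous.prodMk_left y)).pow 2).continuousAt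
  · exact (((hp.continuous t ht).comp (Continuous.prodMk_left y)).pow 2).continuousAt

theorem IsMeanKernel.continuous_sqIntDual (hq : IsMeanKernel m ξ 𝔟 q)
    (hp : IsTransitionDensity m ξ p)
    (hA : DensityAssumption m p) {t : ℝ} (ht : 0 < t) : Continuous (sqIntDual m q t) := by
  obtain ⟨K, hK, hα⟩ := 𝔟.exists_abs_α_le
  refine continuous_iff_continuousAt.2 fun x₀ => ?_
  refine continuousAt_integral_of_le (u := fun y x => q t x y ^ 2) (v := fun y x => p t x y ^ 2)
    (C := Real.exp (K * t) ^ 2) (by positivity) (fun x y => sq_nonneg _) (fun x y => sq_nonneg _)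
    (fun y x => hq.sq_le hp hK hα ht x y)
    (fun x => (hq.integrable_sq_dual hp hA ht x).aestronglyMeasurable)
    (hA.sq_integrable_dual t ht) (fun y => ?_) (fun y => ?_)
    (hA.continuous_sqIntDual t ht).continuousAt
  · exact ((hq.continuous_left ht y).pow 2).continuousAt
  · exact ((hp.continuous_left ht y).pow 2).continuousAt

variable [SFinite m]

lemma IsMeanKernel.memLp (hq : IsMeanKernel m ξ 𝔟 q) (hp : IsTransitionDensity m ξ p)
    (hA : DensityAssumption m p) {t : ℝ} (ht : 0 < t) :
    MemLp (Function.uncurry (q t)) 2 (m.prod m) := by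
  obtain ⟨K, hK, hα⟩ := 𝔟.exists_abs_α_le
  refine ((MemLp.of_integrable_sqInt (hp.measurable_uncurry ht) (hA.sq_integrable t ht)
    (hA.integrable_sqInt t ht)).const_mul (Real.exp (K * t))).mono
    (hq.measurable_uncurry ht).aestronglyMeasurable (ae_of_all _ fun z => ?_)
  simp only [Function.uncurry]
  rw [Real.norm_of_nonneg (hq.nonneg hp ht _ _),
    Real.norm_of_nonneg (mul_nonneg (Real.exp_pos _).le (hp.pos t ht _ _).le)]
  exact (hq.mem_Icc hp hK hα ht _ _).2

/-- The operators with kernel `q` form a semigroup. -/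
theorem IsMeanKernel.kernelOp_add (hq : IsMeanKernel m ξ 𝔟 q) (hp : IsTransitionDensity m ξ p)
    (hA : DensityAssumption m p) {s t : ℝ} (hs : 0 < s) (ht : 0 < t) :
    kernelOp m (q (s + t)) = kernelOp m (q s) * kernelOp m (q t) := by
  obtain ⟨K, hK, hα⟩ := 𝔟.exists_abs_α_le
  have := pseudoMetrizableSpace_onePoint (E := E)
  refine clm_ext_indicator fun B hB hmB => Lp.ext ?_
  change _ =ᵐ[m] kernelOp m (q s) (kernelOp m (q t) _)
  have hst : 0 < s + t := add_pos hs ht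
  filter_upwards [kernelOp_indicator (hq.memLp hp hA hst) hB hmB,
    kernelOp_apply m (q s) (hq.memLp hp hA hs)
      (kernelOp m (q t) (indicatorConstLp 2 hB hmB (1 : ℂ)))] with x h1 h2
  -- The function $T_t1_B$ is measurable and bounded by $e^{Kt}$, so the density formula at time $s$
  -- applies to it.
  have hm := measurable_meanSemigroup ξ 𝔟 ht.le (measurable_one.indicator hB)
    (indicator_one_nonneg B)
  rw [h1, h2, ← hq.meanSemigroup_indicator hst hB, meanSemigroup_add ξ 𝔟 hs.le ht.le
    (measurable_one.indicator hB) (indicator_one_nonneg B) (indicator_one_le B),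
    hq.density s hs _ hm ⟨Real.exp (K * t), fun y => ?_⟩, ← integral_complex_ofReal]
  · refine integral_congr_ae ?_
    filter_upwards [kernelOp_indicator (hq.memLp hp hA ht) hB hmB] with y hy
    rw [hy, ← hq.meanSemigroup_indicator ht hB, Complex.ofReal_mul]
  · have h := hp.meanSemigroup_indicator_mem hK hα ht hB y
    have h0 : 0 ≤ ∫ z in B, p t y z ∂m := integral_nonneg fun z => (hp.pos t ht y z).le
    have h3 : ∫ z in B, p t y z ∂m ≤ 1 :=
      (setIntegral_le_integral (hp.integrable ht (hp.measurable_uncurry ht) y)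
        (ae_of_all _ fun z => (hp.pos t ht y z).le)).trans
        (hp.integral_le_one ht (hp.measurable_uncurry ht) y)
    rw [abs_of_nonneg (le_trans (by positivity) h.1)]
    exact h.2.trans (mul_le_of_le_one_right (Real.exp_pos _).le h3)

lemma IsMeanKernel.norm_kernelOp_le (hq : IsMeanKernel m ξ 𝔟 q) (hp : IsTransitionDensity m ξ p)
    (hA : DensityAssumption m p) {K : ℝ}
    (hK : 0 ≤ K) (hα : ∀ x, |𝔟.α x| ≤ K) {t : ℝ} (ht : 0 < t) :
    ‖kernelOp m (q t)‖ ≤ Real.exp (K * t) := by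
  refine ContinuousLinearMap.opNorm_le_bound _ (Real.exp_pos _).le
    (hp.norm_kernelOp_le hA ht (Real.exp_pos _).le fun x y => ?_)
  rw [abs_of_nonneg (hq.nonneg hp ht x y)]
  exact (hq.mem_Icc hp hK hα ht x y).2

end MeanKernel

/-! ### Strong continuity at zero -/

section StrongContinuity

lemma kernelOp_sub {E : Type*} [MeasurableSpace E] {m : Measure E} [SFinite m] {k l : E → E → ℝ}
    (hk : MemLp (Function.uncurry k) 2 (m.prod m)) (hl : MemLp (Function.uncurry l) 2 (m.prod m)) :
    kernelOp m (fun x y => k x y - l x y) = kernelOp m k - kernelOp m l := by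
  ext1 f
  refine Lp.ext ?_
  have hkl : MemLp (Function.uncurry fun x y => k x y - l x y) 2 (m.prod m) := hk.sub hl
  rw [_root_.sub_apply]
  filter_upwards [kernelOp_apply m _ hkl f, kernelOp_apply m _ hk f, kernelOp_apply m _ hl f,
    Lp.coeFn_sub (kernelOp m k f) (kernelOp m l f), kernel_integrable m k hk,
    kernel_integrable m l hl] with x h1 h2 h3 h4 h5 h6
  rw [h1, h4, Pi.sub_apply, h2, h3, ← integral_sub (h5 f) (h6 f)]
  refine integral_congr_ae (ae_of_all _ fun y => ?_)
  simp only [Complex.ofReal_sub, sub_mul]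

/-- A uniformly bounded family of operators that converges strongly to the identity on a dense
set does so everywhere. -/
lemma tendsto_apply_of_dense {ι H : Type*} [NormedAddCommGroup H] [NormedSpace ℂ H]
    {l : Filter ι} {T : ι → H →L[ℂ] H} (hT : ∀ᶠ i in l, ‖T i‖ ≤ 1) {D : Set H} (hD : Dense D)
    (h : ∀ g ∈ D, Tendsto (fun i => T i g) l (𝓝 g)) (f : H) :
    Tendsto (fun i => T i f) l (𝓝 f) := by
  rw [Metric.tendsto_nhds]
  intro ε hε
  obtain ⟨g, hg, hfg⟩ := Metric.dense_iff.1 hD f (ε / 3) (by positivity)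
  rw [Metric.mem_ball, dist_comm, dist_eq_norm] at hg
  filter_upwards [hT, Metric.tendsto_nhds.1 (h g hfg) (ε / 3) (by positivity)] with i h1 h2
  rw [dist_eq_norm] at h2 ⊢
  have h3 : T i f - f = T i (f - g) + (T i g - g) - (f - g) := by
    rw [map_sub]
    abel
  have h4 : ‖T i (f - g)‖ ≤ ‖f - g‖ :=
    ((T i).le_of_opNorm_le h1 _).trans (one_mul _).le
  rw [h3]
  refine (norm_sub_le _ _).trans_lt ?_
  have := norm_add_le (T i (f - g)) (T i g - g)
  linarith

lemma norm_extend_le {E : Type*} {g : E → ℂ} {M : ℝ} (hM : 0 ≤ M) (hg : ∀ x, ‖g x‖ ≤ M) (z : OnePoint E) :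
    ‖extend g z‖ ≤ M := by
  induction z using OnePoint.rec with
  | infty => simpa [extend] using hM
  | coe x => exact hg x

variable {E : Type*} [MetricSpace E] [MeasurableSpace E]
  {m : Measure E} {Ω : Type*} [MeasurableSpace Ω] {ξ : HuntProcess E Ω} {p q : ℝ → E → E → ℝ}
  {𝔟 : Branching E}

lemma HuntProcess.tendsto_path {E : Type*} [TopologicalSpace E] (ξ : HuntProcess E Ω) (ω : Ω) :
    Tendsto (fun t : ℝ => ξ.X t.toNNReal ω) (𝓝[>] 0) (𝓝 (ξ.X 0 ω)) := by
  have h := ξ.rightCont_paths ω 0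
  have h0 : Set.Ici (0 : ℝ≥0) = Set.univ := Set.eq_univ_of_forall fun r => zero_le (a := r)
  rw [h0, continuousWithinAt_univ] at h
  have h1 : Tendsto Real.toNNReal (𝓝[>] 0) (𝓝 0) := by
    have := (continuous_real_toNNReal.tendsto 0).mono_left (nhdsWithin_le_nhds (s := Set.Ioi 0))
    rwa [Real.toNNReal_zero] at this
  exact h.tendsto.comp h1

variable [SecondCountableTopology E] [BorelSpace E]

/-- Right-continuity and normality give $\xi_t\to x$ almost surely. The extension of $g$ need only
be continuous at the starting point, which holds because $E$ is open in its compactification. -/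
theorem IsTransitionDensity.tendsto_integral (hp : IsTransitionDensity m ξ p) {g : E → ℂ}
    (hg : Continuous g) {M : ℝ} (hM : ∀ x, ‖g x‖ ≤ M) (x : E) :
    Tendsto (fun t => ∫ y, (p t x y : ℂ) * g y ∂m) (𝓝[>] 0) (𝓝 (g x)) := by
  have := ξ.isMarkovKernel
  have hM0 : 0 ≤ M := (norm_nonneg _).trans (hM x)
  have h1 : Tendsto (fun t : ℝ => ∫ ω, extend g (ξ.X t.toNNReal ω) ∂(ξ.P x)) (𝓝[>] 0)
      (𝓝 (∫ _, g x ∂(ξ.P x))) := by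
    refine tendsto_integral_filter_of_dominated_convergence (fun _ => M)
      (Eventually.of_forall fun t => ?_) (Eventually.of_forall fun t => ae_of_all _ fun ω => ?_)
      (integrable_const _) ?_
    · exact ((measurable_extend hg.measurable).comp (ξ.measurable_X _)).aestronglyMeasurable
    · exact norm_extend_le hM0 hM _
    · filter_upwards [ξ.normal x] with ω hω
      have h2 : ContinuousAt (extend g) (x : OnePoint E) :=
        OnePoint.continuousAt_coe.2 (show ContinuousAt g x from hg.continuousAt)
      have h3 := ξ.tendsto_path ω
      rw [hω] at h3
      exact h2.tendsto.comp h3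
  rw [integral_const, probReal_univ, one_smul] at h1
  refine h1.congr' ?_
  filter_upwards [self_mem_nhdsWithin] with t ht
  exact hp.integral_extend ht (hp.measurable_uncurry ht) hg.measurable x

lemma IsTransitionDensity.norm_integral_le (hp : IsTransitionDensity m ξ p) {g : E → ℂ}
    {M : ℝ} (hM : ∀ x, ‖g x‖ ≤ M) {t : ℝ} (ht : 0 < t) (x : E) :
    ‖∫ y, (p t x y : ℂ) * g y ∂m‖ ≤ M := by
  have hM0 : 0 ≤ M := (norm_nonneg _).trans (hM x)
  have hpi := hp.integrable ht (hp.measurable_uncurry ht) x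
  have h1 : ‖∫ y, (p t x y : ℂ) * g y ∂m‖ ≤ ∫ y, p t x y * M ∂m := by
    refine norm_integral_le_of_norm_le (hpi.mul_const M) (ae_of_all _ fun y => ?_)
    rw [norm_mul, Complex.norm_real, Real.norm_of_nonneg (hp.pos t ht x y).le]
    exact mul_le_mul_of_nonneg_left (hM y) (hp.pos t ht x y).le
  rw [integral_mul_const] at h1
  exact h1.trans (mul_le_of_le_one_left hM0 (hp.integral_le_one ht (hp.measurable_uncurry ht) x))

variable [SFinite m]

lemma IsTransitionDensity.memLp (hp : IsTransitionDensity m ξ p) (hA : DensityAssumption m p)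
    {t : ℝ} (ht : 0 < t) : MemLp (Function.uncurry (p t)) 2 (m.prod m) :=
  MemLp.of_integrable_sqInt (hp.measurable_uncurry ht) (hA.sq_integrable t ht)
    (hA.integrable_sqInt t ht)

lemma IsTransitionDensity.norm_kernelOp_le_one (hp : IsTransitionDensity m ξ p)
    (hA : DensityAssumption m p) {t : ℝ} (ht : 0 < t) : ‖kernelOp m (p t)‖ ≤ 1 :=
  ContinuousLinearMap.opNorm_le_bound _ zero_le_one
    (hp.norm_kernelOp_le hA ht zero_le_one fun x y => by
      rw [abs_of_nonneg (hp.pos t ht x y).le, one_mul])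

variable [LocallyCompactSpace E]

/-- Weak convergence of contractions becomes strong: $\|P_tf-f\|^2\le2(\|f\|^2-\Re\langle
f,P_tf\rangle)$. The inner product converges by dominated convergence with majorant $M|g|$. -/
lemma IsTransitionDensity.tendsto_kernelOp_of_hasCompactSupport (hp : IsTransitionDensity m ξ p)
    (hA : DensityAssumption m p) {g : E → ℂ} (hg : Continuous g) (hgc : HasCompactSupport g)
    (hgm : MemLp g 2 m) :
    Tendsto (fun t => kernelOp m (p t) hgm.toLp) (𝓝[>] 0) (𝓝 hgm.toLp) := by
  have := hp.isLocallyFiniteMeasure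
  obtain ⟨M, hM⟩ := hgc.exists_bound_of_continuous hg
  have hgi : Integrable g m := hg.integrable_of_hasCompactSupport hgc
  set f : L2 m := hgm.toLp with hf
  have hfg : f =ᵐ[m] g := hgm.coeFn_toLp
  have hin : Tendsto (fun t => inner ℂ f (kernelOp m (p t) f)) (𝓝[>] 0) (𝓝 (inner ℂ f f)) := by
    have h1 : inner ℂ f f = ∫ x, inner ℂ (g x) (g x) ∂m := by
      rw [L2.inner_def]
      refine integral_congr_ae ?_
      filter_upwards [hfg] with x hx
      rw [hx]
    have h2 : ∀ t, 0 < t → ∫ x, inner ℂ (g x) (∫ y, (p t x y : ℂ) * g y ∂m) ∂m =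
        inner ℂ f (kernelOp m (p t) f) := by
      intro t ht
      rw [L2.inner_def]
      refine integral_congr_ae ?_
      filter_upwards [hfg, kernelOp_apply m _ (hp.memLp hA ht) f] with x hx hx'
      rw [hx, hx']
      congr 1
      refine integral_congr_ae ?_
      filter_upwards [hfg] with y hy
      rw [hy]
    rw [h1]
    refine Tendsto.congr' (f₁ := fun t => ∫ x, inner ℂ (g x) (∫ y, (p t x y : ℂ) * g y ∂m) ∂m)
      (by filter_upwards [self_mem_nhdsWithin] with t ht using h2 t ht) ?_
    refine tendsto_integral_filter_of_dominated_convergence (fun x => ‖g x‖ * M) ?_ ?_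
      (hgi.norm.mul_const M) (ae_of_all _ fun x => ?_)
    · filter_upwards [self_mem_nhdsWithin] with t ht
      have h3 : AEStronglyMeasurable (fun x => ∫ y, (p t x y : ℂ) * g y ∂m) m := by
        have h4 : AEStronglyMeasurable (fun z : E × E => (p t z.1 z.2 : ℂ) * g z.2) (m.prod m) :=
          ((Complex.continuous_ofReal.comp (hp.continuous t ht)).mul
            (hg.comp continuous_snd)).aestronglyMeasurable
        exact h4.integral_prod_right'
      exact hg.aestronglyMeasurable.inner h3
    · filter_upwards [self_mem_nhdsWithin] with t ht
      refine ae_of_all _ fun x => (norm_inner_le_norm _ _).trans ?_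
      exact mul_le_mul_of_nonneg_left (hp.norm_integral_le hM ht x) (norm_nonneg _)
    · exact tendsto_const_nhds.inner (hp.tendsto_integral hg hM x)
  rw [tendsto_iff_norm_sub_tendsto_zero]
  have hre : Tendsto (fun t => 2 * (‖f‖ ^ 2 - (inner ℂ f (kernelOp m (p t) f)).re)) (𝓝[>] 0)
      (𝓝 0) := by
    have h5 := ((Complex.continuous_re.tendsto _).comp hin)
    have h6 : (inner ℂ f f).re = ‖f‖ ^ 2 := (norm_sq_eq_re_inner (𝕜 := ℂ) f).symm
    rw [h6] at h5
    have := ((tendsto_const_nhds (x := ‖f‖ ^ 2)).sub h5).const_mul 2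
    simpa using this
  have hsq : Tendsto (fun t => ‖kernelOp m (p t) f - f‖ ^ 2) (𝓝[>] 0) (𝓝 0) := by
    refine tendsto_of_tendsto_of_tendsto_of_le_of_le' tendsto_const_nhds hre
      (Eventually.of_forall fun t => sq_nonneg _) ?_
    filter_upwards [self_mem_nhdsWithin] with t ht
    rw [norm_sub_rev, norm_sub_sq (𝕜 := ℂ)]
    have h7 : ‖kernelOp m (p t) f‖ ≤ ‖f‖ := by
      simpa using (kernelOp m (p t)).le_of_opNorm_le (hp.norm_kernelOp_le_one hA ht) f
    have h8 : ‖kernelOp m (p t) f‖ ^ 2 ≤ ‖f‖ ^ 2 := pow_le_pow_left₀ (norm_nonneg _) h7 2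
    have h9 : RCLike.re (inner ℂ f (kernelOp m (p t) f)) =
      (inner ℂ f (kernelOp m (p t) f)).re := rfl
    rw [h9]
    linarith
  have := hsq.sqrt
  simpa [Real.sqrt_sq] using this

theorem IsTransitionDensity.tendsto_kernelOp (hp : IsTransitionDensity m ξ p)
    (hA : DensityAssumption m p) (f : L2 m) :
    Tendsto (fun t => kernelOp m (p t) f) (𝓝[>] 0) (𝓝 f) := by
  have := hp.isLocallyFiniteMeasure
  refine tendsto_apply_of_dense (D := {f : L2 m | ∃ (g : E → ℂ) (hgm : MemLp g 2 m),
    Continuous g ∧ HasCompactSupport g ∧ hgm.toLp = f}) ?_ ?_ ?_ f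
  · filter_upwards [self_mem_nhdsWithin] with t ht using hp.norm_kernelOp_le_one hA ht
  · rw [Metric.dense_iff]
    intro f ε hε
    obtain ⟨g, hgc, hgε, hg, hgm⟩ := (Lp.memLp f).exists_hasCompactSupport_eLpNorm_sub_le
      (by norm_num) (ε := ENNReal.ofReal (ε / 2)) (ENNReal.ofReal_pos.2 (by positivity)).ne'
    refine ⟨hgm.toLp, ?_, g, hgm, hg, hgc, rfl⟩
    rw [Metric.mem_ball, dist_comm, dist_eq_norm, Lp.norm_def]
    have h1 : eLpNorm (f - hgm.toLp : L2 m) 2 m = eLpNorm (⇑f - g) 2 m := by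
      refine eLpNorm_congr_ae ?_
      filter_upwards [Lp.coeFn_sub f hgm.toLp, hgm.coeFn_toLp] with x h1 h2
      rw [h1, Pi.sub_apply, Pi.sub_apply, h2]
    rw [h1]
    have := ENNReal.toReal_le_of_le_ofReal (by positivity) hgε
    linarith
  · rintro _ ⟨g, hgm, hg, hgc, rfl⟩
    exact hp.tendsto_kernelOp_of_hasCompactSupport hA hg hgc hgm

variable [m.IsOpenPosMeasure]

/-- The mean semigroup is a strongly continuous semigroup on `L²`. -/
theorem IsMeanKernel.isC0Semigroup (hq : IsMeanKernel m ξ 𝔟 q) (hp : IsTransitionDensity m ξ p)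
    (hA : DensityAssumption m p) {K : ℝ} (hK : 0 ≤ K) (hα : ∀ x, |𝔟.α x| ≤ K) :
    IsC0Semigroup (fun t => kernelOp m (q t)) K where
  add s t hs ht := hq.kernelOp_add hp hA hs ht
  bound t ht := hq.norm_kernelOp_le hp hA hK hα ht
  tendsto f := by
    have h1 : Tendsto (fun t => (Real.exp (K * t) - 1) * ‖f‖) (𝓝[>] 0) (𝓝 0) := by
      have : Continuous fun t => (Real.exp (K * t) - 1) * ‖f‖ := by fun_prop
      simpa using (this.tendsto 0).mono_left (nhdsWithin_le_nhds (s := Set.Ioi 0))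
    -- Schur's test bounds the difference in norm by $(e^{Kt}-1)\|f\|$.
    have h2 : Tendsto (fun t => kernelOp m (q t) f - kernelOp m (p t) f) (𝓝[>] 0) (𝓝 0) := by
      refine squeeze_zero_norm' ?_ h1
      filter_upwards [self_mem_nhdsWithin] with t ht
      rw [← _root_.sub_apply, ← kernelOp_sub (hq.memLp hp hA ht) (hp.memLp hA ht)]
      have ht' : (0 : ℝ) < t := ht
      exact hp.norm_kernelOp_le hA ht (sub_nonneg.2 (Real.one_le_exp (by positivity)))
        (hq.abs_sub_le hp hK hα ht) f
    simpa using h2.add (hp.tendsto_kernelOp hA f)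

end StrongContinuity

/-! ### From operator norms to pointwise kernel bounds -/

section Pointwise

section Estimates

variable {E : Type*} [MeasurableSpace E] {m : Measure E} {k : ℝ → E → E → ℝ} {t : ℝ}

lemma lintegral_enorm_sq_eq_sqInt (h1 : ∀ x, Integrable (fun y => k t x y ^ 2) m) (x : E) :
    ∫⁻ y, ‖k t x y‖ₑ ^ 2 ∂m = ENNReal.ofReal (sqInt m k t x) := by
  rw [sqInt, ofReal_integral_eq_lintegral_ofReal (h1 x) (ae_of_all _ fun y => sq_nonneg _)]
  refine lintegral_congr fun y => ?_
  rw [← sq_abs, ENNReal.ofReal_pow (abs_nonneg _), ← Real.norm_eq_abs, ofReal_norm]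

variable [SFinite m]

/-- Cauchy–Schwarz against the section $k_t(x,\cdot)$: smoothing on the left trades an $L^2$ norm
for a pointwise value. -/
lemma norm_kernelOp_apply_le (hm : Measurable (Function.uncurry (k t)))
    (hk : MemLp (Function.uncurry (k t)) 2 (m.prod m))
    (h1 : ∀ x, Integrable (fun y => k t x y ^ 2) m) (f : L2 m) :
    ∀ᵐ x ∂m, ‖kernelOp m (k t) f x‖ ≤ Real.sqrt (sqInt m k t x) * ‖f‖ := by
  filter_upwards [kernelOp_apply m _ hk f] with x hx
  have h := kernel_bound m (k t) f (Lp.aestronglyMeasurable f) x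
    (hm.comp measurable_prodMk_left).aestronglyMeasurable
  rw [← hx, lintegral_enorm_sq_eq_sqInt h1, ← Lp.enorm_def, ← ofReal_norm, ← ofReal_norm,
    ← ENNReal.ofReal_pow (norm_nonneg _), ← ENNReal.ofReal_pow (norm_nonneg _)] at h
  have hb : 0 ≤ sqInt m k t x := integral_nonneg fun y => sq_nonneg _
  rw [← ENNReal.ofReal_mul hb, ENNReal.ofReal_le_ofReal_iff (by positivity)] at h
  refine abs_le_of_sq_le_sq' ?_ (by positivity) |>.2
  rwa [mul_pow, Real.sq_sqrt hb]

/-- Cauchy–Schwarz on $B$ followed by Tonelli gives $\|T1_B\|^2\le m(B)\int_B\widehat b\,dm$. The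
bound is linear in $m(B)$, so it survives division by $m(B)$ as $B$ shrinks to a point. -/
lemma norm_kernelOp_indicator_le (hm : Measurable (Function.uncurry (k t)))
    (hk : MemLp (Function.uncurry (k t)) 2 (m.prod m))
    (h2 : ∀ y, Integrable (fun x => k t x y ^ 2) m) {B : Set E} (hB : MeasurableSet B)
    (hmB : m B ≠ ∞) {c : ℝ} (hc : ∀ y ∈ B, sqIntDual m k t y ≤ c) :
    ‖kernelOp m (k t) (indicatorConstLp 2 hB hmB (1 : ℂ))‖ ≤ m.real B * Real.sqrt c := by
  have hsq : ∀ x, ‖∫ y in B, k t x y ∂m‖ₑ ^ 2 ≤ m B * ∫⁻ y in B, ‖k t x y‖ₑ ^ 2 ∂m := by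
    intro x
    have hx : Measurable (k t x) := hm.comp measurable_prodMk_left
    have h3 : ‖∫ y in B, k t x y ∂m‖ₑ ≤ ∫⁻ y in B, 1 * ‖k t x y‖ₑ ∂m := by
      simpa using enorm_integral_le_lintegral_enorm (μ := m.restrict B) (k t x)
    have h4 := ENNReal.lintegral_mul_le_Lp_mul_Lq (m.restrict B) Real.HolderConjugate.two_two
      (f := fun _ => 1) (g := fun y => ‖k t x y‖ₑ) aemeasurable_const hx.enorm.aemeasurable
    refine (pow_le_pow_left' (h3.trans h4) 2).trans (le_of_eq ?_)
    rw [mul_pow, ← ENNReal.rpow_natCast, ← ENNReal.rpow_natCast, ← ENNReal.rpow_mul,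
      ← ENNReal.rpow_mul]
    norm_num
  have hsum : ‖kernelOp m (k t) (indicatorConstLp 2 hB hmB (1 : ℂ))‖ₑ ^ 2 ≤
      m B * ∫⁻ y in B, ENNReal.ofReal c ∂m := by
    rw [enorm_sq_eq_lintegral]
    have h5 : ∫⁻ x, ‖kernelOp m (k t) (indicatorConstLp 2 hB hmB (1 : ℂ)) x‖ₑ ^ 2 ∂m ≤
        ∫⁻ x, m B * ∫⁻ y in B, ‖k t x y‖ₑ ^ 2 ∂m ∂m := by
      refine lintegral_mono_ae ?_
      filter_upwards [kernelOp_indicator hk hB hmB] with x hx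
      rw [hx, ← ofReal_norm, Complex.norm_real, ofReal_norm]
      exact hsq x
    refine h5.trans ?_
    rw [lintegral_const_mul' _ _ hmB, lintegral_lintegral_swap]
    · refine mul_le_mul_right (setLIntegral_mono measurable_const fun y hy => ?_) _
      have h6 := lintegral_enorm_sq_eq_sqInt (k := fun t y x => k t x y) h2 y
      rw [h6]
      exact ENNReal.ofReal_le_ofReal (hc y hy)
    · exact (hm.enorm.pow_const 2).aemeasurable
  rcases B.eq_empty_or_nonempty with rfl | ⟨y, hy⟩
  · simp
  have hc0 : 0 ≤ c := (integral_nonneg fun x => sq_nonneg (k t x y)).trans (hc y hy)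
  rw [setLIntegral_const, ← ofReal_norm, ← ENNReal.ofReal_pow (norm_nonneg _),
    ← ENNReal.ofReal_toReal hmB, ← ENNReal.ofReal_mul hc0,
    ← ENNReal.ofReal_mul ENNReal.toReal_nonneg,
    ENNReal.ofReal_le_ofReal_iff (by positivity)] at hsum
  refine abs_le_of_sq_le_sq' ?_ (by positivity) |>.2
  rw [mul_pow, Real.sq_sqrt hc0]
  refine hsum.trans (le_of_eq ?_)
  rw [Measure.real]
  ring

end Estimates

variable {E : Type*} [TopologicalSpace E] [SecondCountableTopology E]
  [MeasurableSpace E] [BorelSpace E]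
  {m : Measure E} [SFinite m] [IsLocallyFiniteMeasure m] [m.IsOpenPosMeasure]

/-- Pointwise bound for a continuous kernel of an operator that factors through an integral
operator on both sides. -/
theorem norm_kernel_le_of_factor {k : ℝ → E → E → ℝ} {t : ℝ}
    (hkc : Continuous (Function.uncurry (k t)))
    (hk : MemLp (Function.uncurry (k t)) 2 (m.prod m))
    (h1 : ∀ x, Integrable (fun y => k t x y ^ 2) m)
    (h2 : ∀ y, Integrable (fun x => k t x y ^ 2) m)
    (hb : Continuous (sqInt m k t)) (hb' : Continuous (sqIntDual m k t))
    {G : E → E → ℂ} (hG : Continuous (Function.uncurry G)) {R : L2 m →L[ℂ] L2 m}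
    (hR : ∀ (B : Set E) (hB : MeasurableSet B) (hmB : m B ≠ ∞),
      kernelOp m (k t) (R (kernelOp m (k t) (indicatorConstLp 2 hB hmB (1 : ℂ)))) =ᵐ[m]
        fun x => ∫ y in B, G x y ∂m) (x₀ y₀ : E) :
    ‖G x₀ y₀‖ ≤ ‖R‖ * Real.sqrt (sqInt m k t x₀) * Real.sqrt (sqIntDual m k t y₀) := by
  have key : ∀ ε : ℝ, 0 < ε → ‖G x₀ y₀‖ - ε ≤
      ‖R‖ * Real.sqrt (sqInt m k t x₀ + ε) * Real.sqrt (sqIntDual m k t y₀ + ε) := by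
    intro ε hε
    obtain ⟨U, V, hU, hxU, hV, hyV, hUV⟩ := mem_nhds_prod_iff'.1
      (hG.continuousAt.preimage_mem_nhds (Metric.ball_mem_nhds (Function.uncurry G (x₀, y₀)) hε))
    obtain ⟨W, hyW, hWo, hWm⟩ := m.exists_isOpen_measure_lt_top y₀
    -- On $U'\times B$ the kernel $G$ and the two square integrals are within $\varepsilon$ of,
    -- respectively at most $\varepsilon$ above, their values at $(x_0,y_0)$; $B$ also has finite
    -- positive measure.
    set U' := U ∩ {x | sqInt m k t x < sqInt m k t x₀ + ε} with hU'
    set B := V ∩ W ∩ {y | sqIntDual m k t y < sqIntDual m k t y₀ + ε} with hBdef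
    have hU'o : IsOpen U' := hU.inter (isOpen_lt hb continuous_const)
    have hBo : IsOpen B := (hV.inter hWo).inter (isOpen_lt hb' continuous_const)
    have hxU' : x₀ ∈ U' := ⟨hxU, lt_add_of_pos_right _ hε⟩
    have hyB : y₀ ∈ B := ⟨⟨hyV, hyW⟩, lt_add_of_pos_right _ hε⟩
    have hmB : m B ≠ ∞ := ((measure_mono fun y hy => hy.1.2).trans_lt hWm).ne
    have hB := hBo.measurableSet
    have hpos : 0 < m.real B := ENNReal.toReal_pos (hBo.measure_pos m ⟨y₀, hyB⟩).ne' hmB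
    -- The almost-everywhere identities hold at some point of $U'$ because nonempty open sets have
    -- positive measure.
    obtain ⟨x, hxU, hx, hx'⟩ := ((frequently_ae_mem_iff.2
      (hU'o.measure_pos m ⟨x₀, hxU'⟩).ne').and_eventually ((hR B hB hmB).and
      (norm_kernelOp_apply_le hkc.measurable hk h1
        (R (kernelOp m (k t) (indicatorConstLp 2 hB hmB (1 : ℂ))))))).exists
    rw [hx] at hx'
    have hGx : ∀ y ∈ B, ‖G x y - G x₀ y₀‖ ≤ ε := fun y hy => by
      have := hUV (Set.mk_mem_prod hxU.1 hy.1.1)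
      rw [← dist_eq_norm]
      exact (Metric.mem_ball.1 this).le
    have hGc : Continuous (G x) := hG.comp (Continuous.prodMk_right x)
    have hGi : IntegrableOn (G x) B m := by
      refine Measure.integrableOn_of_bounded (M := ‖G x₀ y₀‖ + ε) hmB hGc.aestronglyMeasurable ?_
      refine (ae_restrict_iff' hB).2 (ae_of_all _ fun y hy => ?_)
      have := norm_sub_norm_le (G x y) (G x₀ y₀)
      linarith [hGx y hy]
    have h3 := norm_setIntegral_le_of_norm_le_const hmB.lt_top hGx
    rw [integral_sub hGi (integrableOn_const hmB), setIntegral_const] at h3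
    have h4 : ‖m.real B • G x₀ y₀‖ = m.real B * ‖G x₀ y₀‖ := by
      rw [norm_smul, Real.norm_of_nonneg hpos.le]
    have h5 := norm_sub_norm_le (m.real B • G x₀ y₀) (∫ y in B, G x y ∂m)
    rw [norm_sub_rev, h4] at h5
    have h6 : ‖R (kernelOp m (k t) (indicatorConstLp 2 hB hmB (1 : ℂ)))‖ ≤
        ‖R‖ * (m.real B * Real.sqrt (sqIntDual m k t y₀ + ε)) :=
      (R.le_opNorm _).trans (mul_le_mul_of_nonneg_left (norm_kernelOp_indicator_le
        hkc.measurable hk h2 hB hmB fun y hy => (show _ < _ from hy.2).le) (norm_nonneg _))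
    have h7 : Real.sqrt (sqInt m k t x) ≤ Real.sqrt (sqInt m k t x₀ + ε) :=
      Real.sqrt_le_sqrt (show _ < _ from hxU.2).le
    have h8 := hx'.trans (mul_le_mul h7 h6 (norm_nonneg _) (Real.sqrt_nonneg _))
    -- Both sides carry a factor $m(B)$, which cancels; then $\varepsilon\to0$.
    refine le_of_mul_le_mul_left ?_ hpos
    calc m.real B * (‖G x₀ y₀‖ - ε) ≤ ‖∫ y in B, G x y ∂m‖ := by linarith
      _ ≤ _ := h8
      _ = _ := by ring
  have hl : Tendsto (fun ε : ℝ => ‖G x₀ y₀‖ - ε) (𝓝[>] 0) (𝓝 ‖G x₀ y₀‖) := by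
    have : Continuous fun ε : ℝ => ‖G x₀ y₀‖ - ε := by fun_prop
    simpa using (this.tendsto 0).mono_left (nhdsWithin_le_nhds (s := Set.Ioi 0))
  have hr : Tendsto (fun ε : ℝ => ‖R‖ * Real.sqrt (sqInt m k t x₀ + ε) *
      Real.sqrt (sqIntDual m k t y₀ + ε)) (𝓝[>] 0)
      (𝓝 (‖R‖ * Real.sqrt (sqInt m k t x₀) * Real.sqrt (sqIntDual m k t y₀))) := by
    have : Continuous fun ε : ℝ => ‖R‖ * Real.sqrt (sqInt m k t x₀ + ε) *
      Real.sqrt (sqIntDual m k t y₀ + ε) := by fun_prop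
    simpa using (this.tendsto 0).mono_left (nhdsWithin_le_nhds (s := Set.Ioi 0))
  refine le_of_tendsto_of_tendsto hl hr ?_
  filter_upwards [self_mem_nhdsWithin] with ε hε using key ε hε

end Pointwise

/-! ### Continuity and integration of the finite expansion -/

section Expansion

lemma integrable_dotProduct_mulVec {E ι : Type*} [MeasurableSpace E] [Fintype ι] {μ : Measure E} (v : ι → ℂ)
    (M : Matrix ι ι ℂ) {w : ι → E → ℂ} (hw : ∀ l, Integrable (w l) μ) :
    Integrable (fun y => v ⬝ᵥ M.mulVec (fun l => w l y)) μ :=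
  integrable_finsetSum _ fun i _ => (integrable_finsetSum _ fun l _ =>
    (hw l).const_mul (M i l)).const_mul (v i)

lemma integral_dotProduct_mulVec {E ι : Type*} [MeasurableSpace E] [Fintype ι] {μ : Measure E} (v : ι → ℂ)
    (M : Matrix ι ι ℂ) {w : ι → E → ℂ} (hw : ∀ l, Integrable (w l) μ) :
    ∫ y, v ⬝ᵥ M.mulVec (fun l => w l y) ∂μ = v ⬝ᵥ M.mulVec (fun l => ∫ y, w l y ∂μ) := by
  have h1 : ∀ i, Integrable (fun y => ∑ l, M i l * w l y) μ := fun i =>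
    integrable_finsetSum _ fun l _ => (hw l).const_mul (M i l)
  simp only [dotProduct, Matrix.mulVec]
  rw [integral_finsetSum _ fun i _ => (h1 i).const_mul (v i)]
  refine Finset.sum_congr rfl fun i _ => ?_
  rw [integral_const_mul, integral_finsetSum _ fun l _ => (hw l).const_mul (M i l)]
  simp only [integral_const_mul]

variable {E : Type*} [TopologicalSpace E] [MeasurableSpace E] {m : Measure E}
  {T : ℝ → L2 m →L[ℂ] L2 m} (S : SpectralData m T)

lemma SpectralData.continuous_ψ {k : ℕ} (hk1 : 1 ≤ k) (hkN : (k : ℕ∞) ≤ S.N) (l) :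
    Continuous (S.ψ k l) :=
  continuous_finsetSum _ fun j _ => (S.ψhat_continuous k hk1 hkN j).mul continuous_const

lemma SpectralData.continuous_expansion {k : ℕ} (hkN : (k : ℕ∞) ≤ S.N) (t : ℝ) :
    Continuous (Function.uncurry (S.expansion k t)) := by
  change Continuous fun z : E × E => S.expansion k t z.1 z.2
  unfold SpectralData.expansion dotProduct Matrix.mulVec dotProduct
  refine continuous_finsetSum _ fun j hj => continuous_const.mul
    (continuous_finsetSum _ fun i _ => Continuous.mul ?_ (continuous_finsetSum _ fun l _ =>
      continuous_const.mul ?_))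
  all_goals
    have hj1 := (Finset.mem_Icc.1 hj).1
    have hjN : (j : ℕ∞) ≤ S.N := le_trans (by exact_mod_cast (Finset.mem_Icc.1 hj).2) hkN
  · exact (S.φ_continuous j hj1 hjN i).comp continuous_fst
  · exact Complex.continuous_conj.comp ((S.continuous_ψ hj1 hjN l).comp continuous_snd)

lemma SpectralData.integrableOn_expansion {k : ℕ} {B : Set E} (t : ℝ)
    (h : ∀ j ∈ Finset.Icc 1 k, ∀ l, IntegrableOn (fun y => starRingEnd ℂ (S.ψ j l y)) B m)
    (x : E) : IntegrableOn (S.expansion k t x) B m :=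
  integrable_finsetSum _ fun j hj =>
    (integrable_dotProduct_mulVec _ _ fun l => h j hj l).const_mul _

lemma SpectralData.setIntegral_expansion {k : ℕ} {B : Set E} (t : ℝ)
    (h : ∀ j ∈ Finset.Icc 1 k, ∀ l, IntegrableOn (fun y => starRingEnd ℂ (S.ψ j l y)) B m)
    (x : E) :
    ∫ y in B, S.expansion k t x y ∂m = ∑ j ∈ Finset.Icc 1 k, Complex.exp (-S.lam j * t) *
      ((fun i => S.φ j i x) ⬝ᵥ (S.D j t).mulVec
        (fun l => ∫ y in B, starRingEnd ℂ (S.ψ j l y) ∂m)) := by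
  unfold SpectralData.expansion
  rw [integral_finsetSum _ fun j hj =>
    (integrable_dotProduct_mulVec _ _ fun l => h j hj l).const_mul _]
  refine Finset.sum_congr rfl fun j hj => ?_
  rw [integral_const_mul, integral_dotProduct_mulVec _ _ fun l => h j hj l]

end Expansion

end BranchingCLT

theorem lemma2p2 {E : Type*} [MetricSpace E] [LocallyCompactSpace E]
    [TopologicalSpace.SeparableSpace E] [MeasurableSpace E] [BorelSpace E]
    (m : Measure E) [SigmaFinite m] [m.IsOpenPosMeasure]
    {Ω : Type*} [MeasurableSpace Ω] (ξ : BranchingCLT.HuntProcess E Ω)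
    (p : ℝ → E → E → ℝ) (hp : BranchingCLT.IsTransitionDensity m ξ p)
    (hA : BranchingCLT.DensityAssumption m p)
    (𝔟 : BranchingCLT.Branching E)
    (q : ℝ → E → E → ℝ) (hq : BranchingCLT.IsMeanKernel m ξ 𝔟 q)
    (S : BranchingCLT.SpectralData m (fun t => BranchingCLT.kernelOp m (q t)))
    (k : ℕ) (hk1 : 1 ≤ k) (hkN : (k : ℕ∞) ≤ S.N) (t₁ : ℝ) (ht₁ : 0 < t₁)
    (a : ℝ) (ha : (a : EReal) < S.reIndex (k + 1)) :
    ∃ c : ℝ, 0 < c ∧ ∀ (t : ℝ) (x y : E), 2 * t₁ < t →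
      ‖(q t x y : ℂ) - S.expansion k t x y‖ ≤
        c * Real.exp (-a * t) * Real.sqrt (BranchingCLT.sqInt m q t₁ x) *
          Real.sqrt (BranchingCLT.sqIntDual m q t₁ y) := by
  open BranchingCLT in
  have := UniformSpace.secondCountable_of_separable E
  have := hp.isLocallyFiniteMeasure
  obtain ⟨K, hK, hα⟩ := 𝔟.exists_abs_α_le
  have hT := hq.isC0Semigroup hp hA hK hα
  obtain ⟨P, hPc, ⟨C, hC, hPb⟩, hPe, hmem⟩ := exists_spectral_decomposition S hT
    (fun t _ => isCompactOperator_kernelOp m (q t)) hkN ha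
  -- The operator decay is used at time $t-2t_1$, and $e^{-a(t-2t_1)}=e^{2at_1}e^{-at}$.
  refine ⟨C * Real.exp (2 * a * t₁), by positivity, fun t x y ht => ?_⟩
  have ht0 : 0 < t := by linarith
  have hs : 0 < t - 2 * t₁ := by linarith
  have hbound := norm_kernel_le_of_factor (hq.continuous t₁ ht₁) (hq.memLp hp hA ht₁)
    (hq.integrable_sq hp hA ht₁) (hq.integrable_sq_dual hp hA ht₁)
    (hq.continuous_sqInt hp hA ht₁) (hq.continuous_sqIntDual hp hA ht₁)
    (G := fun x y => (q t x y : ℂ) - S.expansion k t x y)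
    (R := kernelOp m (q (t - 2 * t₁)) * (1 - P))
    ((Complex.continuous_ofReal.comp (hq.continuous t ht0)).sub (S.continuous_expansion hkN t))
    ?_ x y
  · refine hbound.trans ?_
    gcongr
    refine (hPb _ hs).trans (le_of_eq ?_)
    rw [mul_assoc, ← Real.exp_add]
    congr 2
    ring
  · intro B hB hmB
    -- Since $P$ commutes with $T_{t_1}$, the sandwiched operator is $T_t(1-P)$, whose kernel is $q$
    -- minus the expansion.
    have hop : kernelOp m (q t₁) * (kernelOp m (q (t - 2 * t₁)) * (1 - P)) * kernelOp m (q t₁) =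
        kernelOp m (q t) - kernelOp m (q t) * P := by
      have h1 : kernelOp m (q t) =
          kernelOp m (q t₁) * kernelOp m (q (t - 2 * t₁)) * kernelOp m (q t₁) := by
        rw [← hq.kernelOp_add hp hA ht₁ hs, ← hq.kernelOp_add hp hA (by linarith) ht₁]
        congr 2
        ring
      have h2 := hPc t₁ ht₁
      rw [h1]
      simp only [mul_assoc, sub_mul, mul_sub, mul_one, h2]
    -- The $\psi$'s are in $L^2$, hence integrable on sets of finite measure.
    have hψ : ∀ j ∈ Finset.Icc 1 k, ∀ l,
        IntegrableOn (fun y => starRingEnd ℂ (S.ψ j l y)) B m := fun j hj l => by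
      have := isFiniteMeasure_restrict.2 hmB
      have h3 : IntegrableOn (S.ψ j l) B m :=
        (MemLp.restrict B ((hmem j hj).2 l)).integrable one_le_two
      exact (Complex.conjCLE : ℂ →L[ℝ] ℂ).integrable_comp h3
    set f : L2 m := indicatorConstLp 2 hB hmB (1 : ℂ) with hf
    have hind : ∀ g : E → ℂ, ∫ y, g y * f y ∂m = ∫ y in B, g y ∂m := fun g => by
      rw [← integral_indicator hB]
      refine integral_congr_ae ?_
      filter_upwards [indicatorConstLp_coeFn (p := 2) (hs := hB) (hμs := hmB) (c := (1 : ℂ))]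
        with y hy
      rw [hf, hy]
      by_cases hyB : y ∈ B <;> simp [hyB]
    have happ := congrArg (fun A : L2 m →L[ℂ] L2 m => A f) hop
    change kernelOp m (q t₁) ((kernelOp m (q (t - 2 * t₁)) * (1 - P)) (kernelOp m (q t₁) f)) =
      kernelOp m (q t) f - kernelOp m (q t) (P f) at happ
    rw [happ]
    filter_upwards [Lp.coeFn_sub (kernelOp m (q t) f) (kernelOp m (q t) (P f)), hPe t ht0 f,
      kernelOp_indicator (hq.memLp hp hA ht0) hB hmB] with x h1 h2 h3
    have h4 : IntegrableOn (fun y => (q t x y : ℂ)) B m :=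
      (hq.integrable hp ht0 x).ofReal.integrableOn
    rw [h1, Pi.sub_apply, h2, h3, integral_sub h4 (S.integrableOn_expansion t hψ x), S.setIntegral_expansion t hψ, integral_complex_ofReal]
    simp only [hind]
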